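/- Let $n\ge 1$ and let $\mathbb{H}^{n+1}=\{X=(x,x_{n+1})\in\mathbb{R}^{n+1}\times\mathbb{R}:\langle X,X\rangle=-1,\ x_{n+1}>0\}$, where $\langle X,Y\rangle=x\cdot y-x_{n+1}y_{n+1}$, with geodesic distance $d$, $\cosh d(X,Y)=-\langle X,Y\rangle$. For $z\in\mathbb{S}^n$ and $r\in\mathbb{R}$ the closed horo-ball $\overline B_z(r)$ is $\{X\in\mathbb{H}^{n+1}:\log(-\langle X,(z,1)\rangle)\le r\}$; an h-convex bounded domain is a nonempty compact intersection of closed horo-balls (single points are allowed as degenerate domains), and the horospherical support function of a compact set $\Omega\neq\emptyset$ is $u_\Omega(z)=\sup_{X\in\Omega}\log(-\langle X,(z,1)\rangle)$. A smooth uniformly h-convex bounded domain is a compact set with nonempty connected interior and smooth boundary whose principal curvatures, with respect to the outward normal, are all greater than $1+\delta$ for some $\delta>0$. Let $\frac12\le p\le 2$, $a,b\ge 0$, $a+b\ge 1$. Let each of $K$, $L$ be a smooth uniformly h-convex bounded domain in $\mathbb{H}^{n+1}$ or a single point. The hyperbolic $p$-sum $a\cdot K+_p b\cdot L$ is the h-convex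 bounded domain $\Omega$ with $$u_\Omega(z)=\tfrac1p\log\left(a\,e^{p\,u_K(z)}+b\,e^{p\,u_L(z)}\right),\qquad z\in\mathbb{S}^n .$$ For points $X,Y$ and reals $\alpha,\beta\ge0$ (not both $0$) put $R=(\alpha^2+\beta^2+2\alpha\beta\cosh d(X,Y))^{1/2}$. If $R\ge1$, let $B(\alpha,X,\beta,Y)$ be the closed geodesic ball of radius $\log R$ centered at the point $P$ of the geodesic segment $XY$ with $\cosh d(P,X)=(\alpha+\beta\cosh d(X,Y))/R$; if $R<1$, let it be empty (also when $\alpha=\beta=0$). With $\frac1p+\frac1q=1$, $\alpha_t=(1-t)^{1/q}a^{1/p}$, $\beta_t=t^{1/q}b^{1/p}$, define the pointwise sum of $K$ and $L$ as $$\bigcup_{X\in K,\,Y\in L}\ \bigcup_{t\in[0,1]}B(\alpha_t,X,\beta_t,Y)\ (p>1),\qquad \bigcup_{X\in K,\,Y\in L}B(a,X,b,Y)\ (p=1),\qquad \bigcup_{X\in K,\,Y\in L}\ \bigcap_{t\in[0,1]}B(\alpha_t,X,\beta_t,Y)\ (p<1),$$ where for $p<1$ and $t\in\{0,1\}$, when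 $0^{1/q}=+\infty$, the ball is all of $\mathbb{H}^{n+1}$. Let $a\cdot K\,\widetilde{+}_p\,b\cdot L$ be the set obtained in the same way with each ball $B(\alpha,X,\beta,Y)$ replaced by the set of $W\in\mathbb{H}^{n+1}$ for which $V=\alpha X+\beta Y-W$ lies in the closed future light cone, i.e. $v_{n+1}\ge|v|$ (again with no condition if $p<1$ and $t\in\{0,1\}$). Then $a\cdot K+_p b\cdot L$ exists and is unique, and it equals both $a\cdot K\,\widetilde{+}_p\,b\cdot L$ and the pointwise sum by geodesic balls. Consequently the sum depends only on the relative position of $K$ and $L$: for every isometry $\varphi$ of $\mathbb{H}^{n+1}$, $a\cdot\varphi(K)+_p b\cdot\varphi(L)=\varphi(a\cdot K+_p b\cdot L)$, and likewise for the two pointwise sums. -/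

import Mathlib

open Set Topology
open scoped ContDiff

namespace HypSum

noncomputable section

/-- The vector space underlying Minkowski space `ℝ^{n+1,1}`: pairs `X = (x, x_{n+1})` with
`x ∈ ℝ^{n+1}` and `x_{n+1} ∈ ℝ`. -/
abbrev Mink (n : ℕ) : Type := EuclideanSpace ℝ (Fin (n + 1)) × ℝ

/-- The Lorentzian inner product `⟨X, Y⟩ = x · y - x_{n+1} y_{n+1}`. -/
def lor {n : ℕ} (X Y : Mink n) : ℝ := inner ℝ X.1 Y.1 - X.2 * Y.2

/-- The hyperboloid model of `ℍ^{n+1}`, with the topology induced from `ℝ^{n+1,1}`. -/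
abbrev Hyp (n : ℕ) : Type := {X : Mink n // lor X X = -1 ∧ 0 < X.2}

/-- The unit sphere `𝕊ⁿ ⊂ ℝ^{n+1}`. -/
abbrev Sph (n : ℕ) : Type := Metric.sphere (0 : EuclideanSpace ℝ (Fin (n + 1))) 1

/-- The geodesic distance of the hyperboloid model. -/
def hdist {n : ℕ} (X Y : Hyp n) : ℝ := Real.arcosh (-lor X.1 Y.1)

/-- The geodesic segment joining `X` and `Y`. -/
def geodSegment {n : ℕ} (X Y : Hyp n) : Set (Hyp n) :=
  {P | hdist X P + hdist P Y = hdist X Y}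

/-- The closed geodesic ball of radius `r` centered at `P`. -/
def closedGeodBall {n : ℕ} (P : Hyp n) (r : ℝ) : Set (Hyp n) := {W | hdist W P ≤ r}

/-- The light-like vector `(z, 1)`. -/
def nullVec {n : ℕ} (z : Sph n) : Mink n := (z.1, 1)

/-- The closed horo-ball centered at the ideal point `z`, at signed distance `r` from the
origin `(0, 1)`. -/
def closedHoroball {n : ℕ} (z : Sph n) (r : ℝ) : Set (Hyp n) :=
  {X | Real.log (-lor X.1 (nullVec z)) ≤ r}

/-- The horospherical support function `u_Ω(z) = sup {log (-⟨X, (z, 1)⟩) : X ∈ Ω}`. -/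
def supp {n : ℕ} (Ω : Set (Hyp n)) (z : Sph n) : ℝ :=
  sSup ((fun X : Hyp n => Real.log (-lor X.1 (nullVec z))) '' Ω)

/-- h-convex bounded domains: nonempty compact intersections of closed horo-balls. Single points
(the degenerate domains) are included; every other such set has nonempty interior. -/
def IsHConvex {n : ℕ} (Ω : Set (Hyp n)) : Prop :=
  Ω.Nonempty ∧ IsCompact Ω ∧
    ∃ S : Set (Sph n × ℝ), Ω = ⋂ s ∈ S, closedHoroball s.1 s.2

/-- `f` is a smooth function on the ambient space such that, near the point `X` of the hyperboloid,
`K` is the sublevel set `{f ≤ 0}`, with `f X = 0`. -/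
def IsLocalDefiningFunction {n : ℕ} (K : Set (Hyp n)) (X : Hyp n) (f : Mink n → ℝ) : Prop :=
  ContDiff ℝ ∞ f ∧ f X.1 = 0 ∧ ∀ᶠ Y : Hyp n in 𝓝 X, (Y ∈ K ↔ f Y.1 ≤ 0)

/-- `ν ∈ T_X ℍ^{n+1}` is the unit vector in the direction of the (nonzero) gradient at `X` of the
restriction of `f` to `ℍ^{n+1}`. If `f` is a local defining function of `K` at `X ∈ ∂K`, then `ν`
is the outward unit normal of `∂K` at `X`. -/
def IsUnitNormal {n : ℕ} (f : Mink n → ℝ) (X : Hyp n) (ν : Mink n) : Prop :=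
  lor X.1 ν = 0 ∧ lor ν ν = 1 ∧
    ∃ c : ℝ, 0 < c ∧ ∀ w : Mink n, lor X.1 w = 0 → fderiv ℝ f X.1 w = c * lor ν w

/-- The second fundamental form at `X`, with respect to the unit normal `ν`, of the level set of `f`
in `ℍ^{n+1}`: the Hessian of `f` on `ℍ^{n+1}`, which is `D²f(v, w) + ⟨v, w⟩ Df(X)` on the
hyperboloid, divided by `|grad f| = Df(ν)`. The sign is such that geodesic spheres of radius `r`,
with their outward normal, have principal curvatures `coth r`. -/
def secondFF {n : ℕ} (f : Mink n → ℝ) (X : Hyp n) (ν v w : Mink n) : ℝ :=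
  (fderiv ℝ (fderiv ℝ f) X.1 v w + lor v w * fderiv ℝ f X.1 X.1) / fderiv ℝ f X.1 ν

/-- Smooth uniformly h-convex bounded domains: compact sets with connected nonempty interior and
smooth boundary, all of whose principal curvatures are greater than `1 + δ` for some `δ > 0`. -/
def IsSmoothUnifHConvex {n : ℕ} (K : Set (Hyp n)) : Prop :=
  IsCompact K ∧ IsConnected (interior K) ∧
    ∃ δ : ℝ, 0 < δ ∧ ∀ X ∈ frontier K, ∃ (f : Mink n → ℝ) (ν : Mink n),
      IsLocalDefiningFunction K X f ∧ IsUnitNormal f X ν ∧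
        ∀ v : Mink n, lor X.1 v = 0 → lor ν v = 0 → v ≠ 0 →
          (1 + δ) * lor v v < secondFF f X ν v v

/-- `Ω = a · K +_p b · L`: the h-convex bounded domain whose horospherical support function is
`(1/p) log (a e^{p u_K} + b e^{p u_L})`. -/
def IsHypPSum {n : ℕ} (p a b : ℝ) (K L Ω : Set (Hyp n)) : Prop :=
  IsHConvex Ω ∧ ∀ z : Sph n,
    supp Ω z = 1 / p * Real.log (a * Real.exp (p * supp K z) + b * Real.exp (p * supp L z))

/-- The coefficient `s^{1/q} a^{1/p}`, where `1/p + 1/q = 1`. -/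
def coef (p s a : ℝ) : ℝ := s ^ (1 - 1 / p) * a ^ (1 / p)

/-- `(α² + β² + 2 α β cosh d(X, Y))^{1/2}`. -/
def radiusR {n : ℕ} (α : ℝ) (X : Hyp n) (β : ℝ) (Y : Hyp n) : ℝ :=
  Real.sqrt (α ^ 2 + β ^ 2 + 2 * α * β * Real.cosh (hdist X Y))

/-- `P` is the point of the segment `XY` with `cosh d(P, X) = (α + β cosh d(X, Y)) / R`. -/
def IsCenterP {n : ℕ} (α : ℝ) (X : Hyp n) (β : ℝ) (Y : Hyp n) (P : Hyp n) : Prop :=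
  P ∈ geodSegment X Y ∧
    Real.cosh (hdist P X) = (α + β * Real.cosh (hdist X Y)) / radiusR α X β Y

/-- The closed geodesic ball of radius `log R` centered at `P` if `R ≥ 1`, and `∅` if `R < 1`. -/
def pairBall {n : ℕ} (α : ℝ) (X : Hyp n) (β : ℝ) (Y : Hyp n) : Set (Hyp n) :=
  {W | 1 ≤ radiusR α X β Y ∧
    ∃ P, IsCenterP α X β Y P ∧ W ∈ closedGeodBall P (Real.log (radiusR α X β Y))}

open Classical in
/-- The ball `B(p, t; a, X, b, Y)` for `p ≠ 1`. If `p < 1` then `1/q < 0`, so for `t ∈ {0, 1}` one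
of the coefficients is `0^{1/q} = +∞`; the ball is then all of `ℍ^{n+1}`. -/
def ballPT {n : ℕ} (p t a : ℝ) (X : Hyp n) (b : ℝ) (Y : Hyp n) : Set (Hyp n) :=
  if p < 1 ∧ (t = 0 ∨ t = 1) then univ
  else pairBall (coef p (1 - t) a) X (coef p t b) Y

open Classical in
/-- The pointwise hyperbolic `p`-sum of arbitrary sets, through geodesic balls. -/
def ballSum {n : ℕ} (p a b : ℝ) (K L : Set (Hyp n)) : Set (Hyp n) :=
  if 1 < p then ⋃ X ∈ K, ⋃ Y ∈ L, ⋃ t ∈ Icc (0 : ℝ) 1, ballPT p t a X b Y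
  else if p = 1 then ⋃ X ∈ K, ⋃ Y ∈ L, pairBall a X b Y
  else ⋃ X ∈ K, ⋃ Y ∈ L, ⋂ t ∈ Icc (0 : ℝ) 1, ballPT p t a X b Y

/-- The vector `V` lies in the closed future light cone of the origin: `V_{n+1} ≥ |v|`. -/
def InFutureCone {n : ℕ} (V : Mink n) : Prop := ‖V.1‖ ≤ V.2

open Classical in
/-- The points `W` such that `(1-t)^{1/q} a^{1/p} X + t^{1/q} b^{1/p} Y - W` (if `p = 1`, the vector
`a X + b Y - W`) lies in the closed future light cone. If `p < 1` and `t ∈ {0, 1}`, a coefficient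
is `+∞` and the condition is void. -/
def coneSet {n : ℕ} (p t a : ℝ) (X : Hyp n) (b : ℝ) (Y : Hyp n) : Set (Hyp n) :=
  if p = 1 then {W | InFutureCone (a • X.1 + b • Y.1 - W.1)}
  else if p < 1 ∧ (t = 0 ∨ t = 1) then univ
  else {W | InFutureCone (coef p (1 - t) a • X.1 + coef p t b • Y.1 - W.1)}

open Classical in
/-- The pointwise hyperbolic `p`-sum of arbitrary sets, through light cones. -/
def coneSum {n : ℕ} (p a b : ℝ) (K L : Set (Hyp n)) : Set (Hyp n) :=
  if 1 ≤ p then ⋃ X ∈ K, ⋃ Y ∈ L, ⋃ t ∈ Icc (0 : ℝ) 1, coneSet p t a X b Y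
  else ⋃ X ∈ K, ⋃ Y ∈ L, ⋂ t ∈ Icc (0 : ℝ) 1, coneSet p t a X b Y

end

end HypSum

/-! With the sign of the Lorentzian form reversed (`eta`), `eta X (nullVec z)` is the exponential of
the horospherical support function of the point X at z. Put ψ(s, r) = (a s^p + b r^p)^{1/p} (`psi`).
The sum of two points X, Y is `pointSum`: the W whose height at every z is at most ψ of the heights
of X and Y. Since the future cone is cut out by null vectors, each description of the sum is an
exchange of quantifiers.

For fixed X and Y, Hölder's inequality makes ψ(s, r) the supremum (p > 1) or infimum (p < 1) over t
of α_t s + β_t r. For p < 1 this is directly an intersection of cone conditions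
(`pointSum_eq_iInter`). For p > 1 one t has to serve all z, which is a minimax statement resting on
the connectedness of caps of the sphere (`exists_mem_coneSet_of_mem_pointSum`).

For sets, a point W below the support function of the sum has at each z its own pair (X, Y), and one
pair has to serve all z (`exists_mem_pointSum`). K and L are shrunk to concentric caps until the sum
of the caps touches W at some ideal point w. The first order condition there, together with
convexity of the faces of the caps on horospheres, gives X and Y such that αX + βY - W is a multiple
of (w, 1), with (α, β) the gradient of ψ. By `mem_pointSum_of_touching` such first order contact
implies the inequality at all ideal points. This is where 1/2 ≤ p ≤ 2 and a + b ≥ 1 matter: the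
lower bound on p controls the concavity defect of ψ if p ≤ 1, and the upper bound controls the sign
of the null multiple if p ≥ 1. The same contact points show that the prescribed support function is
attained, and an h-convex set is determined by its support function (`isHypPSum_iff`).

K and L enter only through compactness, nonemptiness and `ConeConvex`. For smooth uniformly h-convex
sets the last property needs a passage from local to global: a horospherical height function has
only strict local maxima as critical points on K, so by a mountain pass argument a tangent
horosphere at the boundary supports all of K.

Finally, each ball is a cone condition read off from the radial projection of αX + βY
(`mem_pairBall_iff`), and cone conditions depend only on mutual distances, whence the invariance
under isometries. -/

namespace HypSum

/-- The form `-⟨X, Y⟩`, which is at least `1` on pairs of points of the hyperboloid. -/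
noncomputable def eta {n : ℕ} (X Y : Mink n) : ℝ := X.2 * Y.2 - inner ℝ X.1 Y.1

/-! ### Lorentzian geometry of the hyperboloid and of the light cone -/

section Form

variable {n : ℕ}

lemma neg_lor (X Y : Mink n) : -lor X Y = eta X Y := by simp [lor, eta]

lemma lor_eq (X Y : Mink n) : lor X Y = -eta X Y := by simp [lor, eta]

lemma eta_comm (X Y : Mink n) : eta X Y = eta Y X := by
  simp only [eta, real_inner_comm]; ring

@[simp] lemma eta_add_left (X Y Z : Mink n) : eta (X + Y) Z = eta X Z + eta Y Z := by
  simp only [eta, Prod.fst_add, Prod.snd_add, inner_add_left]; ring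

@[simp] lemma eta_add_right (X Y Z : Mink n) : eta X (Y + Z) = eta X Y + eta X Z := by
  simp only [eta, Prod.fst_add, Prod.snd_add, inner_add_right]; ring

@[simp] lemma eta_sub_left (X Y Z : Mink n) : eta (X - Y) Z = eta X Z - eta Y Z := by
  simp only [eta, Prod.fst_sub, Prod.snd_sub, inner_sub_left]; ring

@[simp] lemma eta_sub_right (X Y Z : Mink n) : eta X (Y - Z) = eta X Y - eta X Z := by
  simp only [eta, Prod.fst_sub, Prod.snd_sub, inner_sub_right]; ring

@[simp] lemma eta_smul_left (c : ℝ) (X Y : Mink n) : eta (c • X) Y = c * eta X Y := by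
  simp only [eta, Prod.smul_fst, Prod.smul_snd, smul_eq_mul, real_inner_smul_left]; ring

@[simp] lemma eta_smul_right (c : ℝ) (X Y : Mink n) : eta X (c • Y) = c * eta X Y := by
  simp only [eta, Prod.smul_fst, Prod.smul_snd, smul_eq_mul, real_inner_smul_right]; ring

@[simp] lemma eta_zero_right (Y : Mink n) : eta Y 0 = 0 := by simp [eta]

@[simp] lemma eta_neg_left (X Y : Mink n) : eta (-X) Y = -eta X Y := by
  simp only [eta, Prod.fst_neg, Prod.snd_neg, inner_neg_left]; ring

@[simp] lemma eta_neg_right (X Y : Mink n) : eta X (-Y) = -eta X Y := by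
  simp only [eta, Prod.fst_neg, Prod.snd_neg, inner_neg_right]; ring

lemma eta_self (X : Mink n) : eta X X = X.2 ^ 2 - ‖X.1‖ ^ 2 := by
  simp only [eta, real_inner_self_eq_norm_sq]; ring

@[fun_prop]
lemma continuous_eta {α : Type*} [TopologicalSpace α] {f g : α → Mink n} (hf : Continuous f)
    (hg : Continuous g) : Continuous fun x => eta (f x) (g x) := by
  unfold eta; fun_prop

lemma abs_inner_le_mul (x y : EuclideanSpace ℝ (Fin (n + 1))) {s t : ℝ} (hs : ‖x‖ ≤ s)
    (ht : ‖y‖ ≤ t) : |(inner ℝ x y : ℝ)| ≤ s * t :=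
  (abs_real_inner_le_norm x y).trans
    (mul_le_mul hs ht (norm_nonneg _) ((norm_nonneg _).trans hs))

lemma InFutureCone.eta_nonneg {V W : Mink n} (hV : InFutureCone V) (hW : InFutureCone W) :
    0 ≤ eta V W := by
  have := abs_inner_le_mul V.1 W.1 hV hW
  have := le_abs_self (inner ℝ V.1 W.1 : ℝ)
  unfold eta; linarith

lemma InFutureCone.snd_nonneg {V : Mink n} (hV : InFutureCone V) : 0 ≤ V.2 :=
  (norm_nonneg _).trans hV

lemma InFutureCone.add {V W : Mink n} (hV : InFutureCone V) (hW : InFutureCone W) :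
    InFutureCone (V + W) := by
  unfold InFutureCone at *
  exact (norm_add_le _ _).trans (add_le_add hV hW)

lemma InFutureCone.smul {V : Mink n} (hV : InFutureCone V) {c : ℝ} (hc : 0 ≤ c) :
    InFutureCone (c • V) := by
  unfold InFutureCone at *
  simp only [Prod.smul_fst, Prod.smul_snd, norm_smul, Real.norm_of_nonneg hc, smul_eq_mul]
  exact mul_le_mul_of_nonneg_left hV hc

lemma inFutureCone_zero : InFutureCone (0 : Mink n) := by simp [InFutureCone]

/-- A vector orthogonal to a nonzero null or timelike vector of the cone is not timelike. -/
lemma eta_self_nonpos_of_eta_eq_zero {D N : Mink n} (hN : InFutureCone N) (hN0 : N ≠ 0)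
    (h : eta D N = 0) : eta D D ≤ 0 := by
  have hN2 : 0 < N.2 := by
    rcases hN.snd_nonneg.lt_or_eq with h1 | h1
    · exact h1
    · exfalso; apply hN0
      have : ‖N.1‖ ≤ 0 := by have := hN; unfold InFutureCone at this; linarith
      exact Prod.ext (norm_le_zero_iff.1 this) h1.symm
  have h1 := abs_real_inner_le_norm D.1 N.1
  have h2 : D.2 * N.2 = inner ℝ D.1 N.1 := by unfold eta at h; linarith
  rw [← h2, abs_mul, abs_of_pos hN2] at h1
  have h3 : |D.2| * N.2 ≤ ‖D.1‖ * N.2 := h1.trans (mul_le_mul_of_nonneg_left hN (norm_nonneg _))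
  have h4 : |D.2| ≤ ‖D.1‖ := le_of_mul_le_mul_right h3 hN2
  rw [eta_self, ← sq_abs D.2]
  have := abs_nonneg D.2
  nlinarith

/-- Equality in the previous lemma occurs only for multiples of a null vector. -/
lemma eq_zero_of_eta_eq_zero {D N : Mink n} (hN : 0 < eta N N)
    (h : eta D N = 0) (hD : 0 ≤ eta D D) : D = 0 := by
  rw [eta_self] at hN hD
  have h1 := abs_real_inner_le_norm D.1 N.1
  have h2 : D.2 * N.2 = inner ℝ D.1 N.1 := by unfold eta at h; linarith
  rw [← h2] at h1
  have h3 : (D.2 * N.2) ^ 2 ≤ (‖D.1‖ * ‖N.1‖) ^ 2 := by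
    rw [← sq_abs (D.2 * N.2)]; exact pow_le_pow_left₀ (abs_nonneg _) h1 2
  have h5 : D.2 ^ 2 * (N.2 ^ 2 - ‖N.1‖ ^ 2) ≤ 0 := by
    nlinarith [mul_nonneg hD (sq_nonneg ‖N.1‖)]
  have h4 : D.2 ^ 2 ≤ 0 := by
    by_contra hc
    push Not at hc
    nlinarith [mul_pos hc hN]
  have h6 : D.2 = 0 := by nlinarith
  have h7 : ‖D.1‖ = 0 := by nlinarith [norm_nonneg D.1]
  exact Prod.ext (norm_eq_zero.1 h7) h6

section Points

variable (X Y : Hyp n)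

lemma eta_point_self : eta X.1 X.1 = 1 := by rw [← neg_lor, X.2.1]; norm_num

lemma norm_lt_snd : ‖X.1.1‖ < X.1.2 := by
  have h := eta_point_self X
  rw [eta_self] at h
  have := X.2.2
  nlinarith [norm_nonneg X.1.1]

lemma inFutureCone_point : InFutureCone X.1 := (norm_lt_snd X).le

lemma point_ne_zero : X.1 ≠ 0 := fun h => by
  have := X.2.2; rw [h] at this; simp at this

lemma eta_point_pos {T : Mink n} (hT : InFutureCone T) (h0 : T ≠ 0) : 0 < eta X.1 T := by
  refine lt_of_le_of_ne ((inFutureCone_point X).eta_nonneg hT) fun h => h0 ?_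
  refine eq_zero_of_eta_eq_zero (N := X.1) (by rw [eta_point_self]; norm_num)
    (by rw [eta_comm]; exact h.symm) (hT.eta_nonneg hT)

lemma eta_points_pos : 0 < eta X.1 Y.1 :=
  eta_point_pos X (inFutureCone_point Y) (point_ne_zero Y)

lemma one_le_eta : 1 ≤ eta X.1 Y.1 := by
  set c := eta X.1 Y.1 with hc
  -- Y - cX is orthogonal to X, hence spacelike, so that 1 - c² ≤ 0.
  have h := eta_self_nonpos_of_eta_eq_zero (D := Y.1 - c • X.1) (N := X.1)
    (inFutureCone_point X) (point_ne_zero X)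
    (by simp [eta_comm Y.1 X.1, ← hc, eta_point_self])
  simp only [eta_sub_left, eta_sub_right, eta_smul_left, eta_smul_right, eta_point_self,
    eta_comm Y.1 X.1, ← hc] at h
  nlinarith [eta_points_pos X Y]

variable {X Y} in
lemma eq_of_eta_eq_one (h : eta X.1 Y.1 = 1) : X = Y := by
  have : X.1 - Y.1 = 0 := by
    refine eq_zero_of_eta_eq_zero (N := Y.1) (by rw [eta_point_self]; norm_num) ?_ ?_
    · simp [h, eta_point_self]
    · simp [h, eta_point_self, eta_comm Y.1 X.1]
  exact Subtype.ext (sub_eq_zero.1 this)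

end Points

section Null

variable (z w : Sph n)

lemma norm_sph : ‖z.1‖ = 1 := by simp

lemma inFutureCone_nullVec : InFutureCone (nullVec z) := by
  simp [InFutureCone, nullVec]

@[simp] lemma eta_nullVec_self : eta (nullVec z) (nullVec z) = 0 := by
  rw [eta_self]; simp [nullVec]

lemma eta_nullVec_right (V : Mink n) : eta V (nullVec z) = V.2 - inner ℝ V.1 z.1 := by
  simp [eta, nullVec]

lemma nullVec_ne_zero : nullVec z ≠ 0 := fun h => by
  have := congrArg Prod.snd h; simp [nullVec] at this

lemma eta_nullVec_nonneg : 0 ≤ eta (nullVec z) (nullVec w) :=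
  (inFutureCone_nullVec z).eta_nonneg (inFutureCone_nullVec w)

lemma eta_point_nullVec_pos (X : Hyp n) : 0 < eta X.1 (nullVec z) :=
  eta_point_pos X (inFutureCone_nullVec z) (nullVec_ne_zero z)

@[fun_prop]
lemma continuous_nullVec : Continuous (nullVec : Sph n → Mink n) := by
  unfold nullVec; fun_prop

instance : Nonempty (Sph n) :=
  ⟨⟨EuclideanSpace.single 0 1, by simp⟩⟩

/-- The cone is self-dual and generated by its null rays. The critical test direction is z = v/|v|,
where the pairing equals v_{n+1} - |v|. Cone conditions thereby become inequalities between
horospherical heights. -/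
lemma inFutureCone_iff (V : Mink n) : InFutureCone V ↔ ∀ z, 0 ≤ eta V (nullVec z) := by
  refine ⟨fun h z => h.eta_nonneg (inFutureCone_nullVec z), fun h => ?_⟩
  unfold InFutureCone
  by_cases h0 : V.1 = 0
  · rw [h0, norm_zero]
    obtain ⟨z⟩ : Nonempty (Sph n) := inferInstance
    have := h z
    rwa [eta_nullVec_right, h0, inner_zero_left, sub_zero] at this
  · have hn : ‖V.1‖ ≠ 0 := norm_ne_zero_iff.2 h0
    have := h ⟨‖V.1‖⁻¹ • V.1, by simp [norm_smul, hn]⟩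
    rw [eta_nullVec_right, real_inner_smul_right, real_inner_self_eq_norm_sq] at this
    have h2 : ‖V.1‖⁻¹ * ‖V.1‖ ^ 2 = ‖V.1‖ := by field_simp
    linarith

/-- A nonzero null vector in the future cone is a positive multiple of some `nullVec z`. -/
lemma exists_eq_smul_nullVec {N : Mink n} (hN : InFutureCone N) (h0 : N ≠ 0)
    (hnull : eta N N = 0) : ∃ z : Sph n, 0 < N.2 ∧ N = N.2 • nullVec z := by
  rw [eta_self] at hnull
  have h1 : ‖N.1‖ = N.2 := by
    have := hN.snd_nonneg
    have := norm_nonneg N.1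
    have : (N.2 - ‖N.1‖) * (N.2 + ‖N.1‖) = 0 := by linarith
    rcases mul_eq_zero.1 this with h | h <;> linarith
  have h2 : 0 < N.2 := by
    rcases hN.snd_nonneg.lt_or_eq with h | h
    · exact h
    · exact absurd (Prod.ext (norm_eq_zero.1 (h1.trans h.symm)) h.symm) h0
  refine ⟨⟨N.2⁻¹ • N.1, ?_⟩, h2, ?_⟩
  · simp [norm_smul, h1, abs_of_pos h2, h2.ne']
  · ext1
    · simp [nullVec, smul_smul, h2.ne']
    · simp [nullVec]

end Null

/-- A vector of norm one with positive pairing with a null vector is a point of `ℍ^{n+1}`. -/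
lemma mem_hyp_of_eta {V : Mink n} (h : eta V V = 1) {T : Mink n} (hT : InFutureCone T)
    (hpos : 0 < eta V T) : lor V V = -1 ∧ 0 < V.2 := by
  refine ⟨by rw [lor_eq, h], ?_⟩
  by_contra hV
  push Not at hV
  rw [eta_self] at h
  have hc : InFutureCone (-V) := by
    simp only [InFutureCone, Prod.fst_neg, norm_neg, Prod.snd_neg]
    nlinarith [norm_nonneg V.1]
  have := hc.eta_nonneg hT
  rw [eta_neg_left] at this
  linarith

/-- Moving along a null direction to the hyperboloid. -/
lemma exists_point_eq_sub_smul {V : Mink n} {N : Mink n} (hN : InFutureCone N)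
    (hNN : eta N N = 0) (h : 0 < eta V N) :
    ∃ W : Hyp n, W.1 = V - ((eta V V - 1) / (2 * eta V N)) • N := by
  refine ⟨⟨V - ((eta V V - 1) / (2 * eta V N)) • N, mem_hyp_of_eta ?_ hN ?_⟩, rfl⟩
  · simp only [eta_sub_left, eta_sub_right, eta_smul_left, eta_smul_right, hNN, eta_comm N V]
    field_simp; ring
  · simp [hNN, h]

/-- Radial projection of a timelike vector. -/
lemma exists_point_eq_smul {V : Mink n} (hV : InFutureCone V) (h : 0 < eta V V) :
    ∃ W : Hyp n, V = Real.sqrt (eta V V) • W.1 := by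
  have hs : 0 < Real.sqrt (eta V V) := Real.sqrt_pos.2 h
  refine ⟨⟨(Real.sqrt (eta V V))⁻¹ • V, mem_hyp_of_eta (T := V) ?_ hV ?_⟩, ?_⟩
  · rw [eta_smul_left, eta_smul_right]
    nth_rewrite 3 [← Real.mul_self_sqrt h.le]
    field_simp
  · rw [eta_smul_left]; positivity
  · rw [smul_smul, mul_inv_cancel₀ hs.ne', one_smul]

/-- A vector of the form `V - W` lies in the future cone iff a condition on the forms holds. -/
lemma inFutureCone_sub_iff {V : Mink n} (hV : InFutureCone V) (W : Hyp n) :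
    InFutureCone (V - W.1) ↔ 1 ≤ eta V V ∧ 2 * eta V W.1 ≤ eta V V + 1 := by
  have hself := eta_point_self W
  constructor
  · intro h
    have h1 := h.eta_nonneg h
    have h2 := (inFutureCone_point W).eta_nonneg h
    simp only [eta_sub_left, eta_sub_right, eta_comm W.1 V, hself] at h1 h2
    exact ⟨by linarith, by linarith⟩
  · rintro ⟨h1, h2⟩
    have h3 : 0 ≤ eta (V - W.1) (V - W.1) := by
      simp only [eta_sub_left, eta_sub_right, eta_comm W.1 V, hself]; linarith
    by_contra hc
    -- If V - W is causal without pointing to the future, then W - V does. Pairing it with V and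
    -- using both inequalities leaves only `eta V V = eta V W = 1`, that is V = W.
    have hneg : InFutureCone (W.1 - V) := by
      rw [eta_self] at h3
      unfold InFutureCone at hc ⊢
      push Not at hc
      simp only [Prod.fst_sub, Prod.snd_sub] at h3 hc ⊢
      rw [norm_sub_rev]
      have := norm_nonneg (V.1 - W.1.1)
      nlinarith
    have h4 := hV.eta_nonneg hneg
    have h5 := hneg.eta_nonneg hneg
    simp only [eta_sub_left, eta_sub_right, eta_comm W.1 V, hself] at h4 h5
    have h6 : V - W.1 = 0 := eq_zero_of_eta_eq_zero (N := V) (by linarith)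
      (by simp only [eta_sub_left, eta_comm W.1 V]; linarith) h3
    exact hc (by rw [h6]; exact inFutureCone_zero)

end Form

/-- The weighted `ℓ^p` combination `(a s^p + b r^p)^{1/p}`. -/
noncomputable def psi (p a b s r : ℝ) : ℝ := (a * s ^ p + b * r ^ p) ^ (1 / p)

/-- The partial derivative of `psi p a b` in the first variable (for the second one,
exchange the roles of the variables). -/
noncomputable def grad (p a s ψ : ℝ) : ℝ := a * (s / ψ) ^ (p - 1)

/-! ### Power means and tangent planes of ψ -/

section Means

lemma mean_rpow_le {q w₁ w₂ x y : ℝ} (hq : 1 ≤ q) (h₁ : 0 ≤ w₁) (h₂ : 0 ≤ w₂) (hw : w₁ + w₂ = 1)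
    (hx : 0 ≤ x) (hy : 0 ≤ y) : (w₁ * x + w₂ * y) ^ q ≤ w₁ * x ^ q + w₂ * y ^ q := by
  simpa using (convexOn_rpow hq).2 hx hy h₁ h₂ hw

lemma mean_le_rpow_mean {p w₁ w₂ x y : ℝ} (hp : 1 ≤ p) (h₁ : 0 ≤ w₁) (h₂ : 0 ≤ w₂)
    (hw : w₁ + w₂ = 1) (hx : 0 ≤ x) (hy : 0 ≤ y) :
    w₁ * x + w₂ * y ≤ (w₁ * x ^ p + w₂ * y ^ p) ^ (1 / p) := by
  have h := mean_rpow_le hp h₁ h₂ hw hx hy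
  have h0 : 0 ≤ w₁ * x + w₂ * y := by positivity
  calc w₁ * x + w₂ * y = ((w₁ * x + w₂ * y) ^ p) ^ (1 / p) := by
        rw [← Real.rpow_mul h0, mul_one_div_cancel (by linarith), Real.rpow_one]
    _ ≤ _ := Real.rpow_le_rpow (by positivity) h (by positivity)

lemma rpow_mean_le_mean {p w₁ w₂ x y : ℝ} (hp0 : 0 < p) (hp : p ≤ 1) (h₁ : 0 ≤ w₁) (h₂ : 0 ≤ w₂)
    (hw : w₁ + w₂ = 1) (hx : 0 ≤ x) (hy : 0 ≤ y) :
    (w₁ * x ^ p + w₂ * y ^ p) ^ (1 / p) ≤ w₁ * x + w₂ * y := by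
  have h := mean_rpow_le (q := 1 / p) (by rw [le_div_iff₀ hp0]; linarith) h₁ h₂ hw
    (Real.rpow_nonneg hx p) (Real.rpow_nonneg hy p)
  rwa [← Real.rpow_mul hx, ← Real.rpow_mul hy, mul_one_div_cancel hp0.ne', Real.rpow_one,
    Real.rpow_one] at h

/-- Monotonicity of power means between the exponents 1/2 and p, applied to √x and √y with exponent
2p ≥ 1. It is the source of the restriction p ≥ 1/2. -/
lemma sqrt_mean_le {p w₁ w₂ x y : ℝ} (hp : 1 / 2 ≤ p) (h₁ : 0 ≤ w₁) (h₂ : 0 ≤ w₂)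
    (hw : w₁ + w₂ = 1) (hx : 0 ≤ x) (hy : 0 ≤ y) :
    (w₁ * √x + w₂ * √y) ^ 2 ≤ (w₁ * x ^ p + w₂ * y ^ p) ^ (1 / p) := by
  have h := mean_le_rpow_mean (p := 2 * p) (by linarith) h₁ h₂ hw (Real.sqrt_nonneg x)
    (Real.sqrt_nonneg y)
  have key : ∀ u : ℝ, 0 ≤ u → √u ^ (2 * p) = u ^ p := fun u hu => by
    rw [Real.sqrt_eq_rpow, ← Real.rpow_mul hu]; congr 1; ring
  rw [key x hx, key y hy] at h
  have h3 : 0 ≤ w₁ * x ^ p + w₂ * y ^ p := by positivity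
  calc (w₁ * √x + w₂ * √y) ^ 2 ≤ ((w₁ * x ^ p + w₂ * y ^ p) ^ (1 / (2 * p))) ^ 2 :=
        pow_le_pow_left₀ (by positivity) h 2
    _ = _ := by
      rw [← Real.rpow_natCast, ← Real.rpow_mul h3]
      congr 1
      have : p ≠ 0 := by linarith
      push_cast; field_simp

/-- Bernoulli's inequality for negative exponents. -/
lemma one_add_mul_le_rpow_neg {x e : ℝ} (hx : 0 < x) (he : 0 ≤ e) : 1 + e * (1 - x) ≤ x ^ (-e) := by
  have h1 : 1 - x ≤ -Real.log x := by linarith [Real.log_le_sub_one_of_pos hx]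
  rw [Real.rpow_def_of_pos hx]
  have := Real.add_one_le_exp (Real.log x * -e)
  nlinarith

end Means

section Psi

variable {p a b : ℝ}

lemma psi_arg_pos (ha : 0 ≤ a) (hb : 0 ≤ b) (hab : 1 ≤ a + b) {s r : ℝ} (hs : 0 < s) (hr : 0 < r) :
    0 < a * s ^ p + b * r ^ p := by
  have h1 := Real.rpow_pos_of_pos hs p
  have h2 := Real.rpow_pos_of_pos hr p
  rcases ha.lt_or_eq with h | h
  · positivity
  · have : 0 < b := by linarith
    positivity

lemma psi_pos (ha : 0 ≤ a) (hb : 0 ≤ b) (hab : 1 ≤ a + b) {s r : ℝ} (hs : 0 < s) (hr : 0 < r) :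
    0 < psi p a b s r :=
  Real.rpow_pos_of_pos (psi_arg_pos ha hb hab hs hr) _

lemma psi_rpow (hp : 0 < p) (ha : 0 ≤ a) (hb : 0 ≤ b) {s r : ℝ}
    (hs : 0 ≤ s) (hr : 0 ≤ r) : psi p a b s r ^ p = a * s ^ p + b * r ^ p := by
  have : 0 ≤ a * s ^ p + b * r ^ p := by positivity
  rw [psi, ← Real.rpow_mul this, one_div_mul_cancel hp.ne', Real.rpow_one]

lemma psi_mono (hp : 0 < p) (ha : 0 ≤ a) (hb : 0 ≤ b) {s r s' r' : ℝ} (hs : 0 ≤ s) (hr : 0 ≤ r)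
    (h1 : s ≤ s') (h2 : r ≤ r') : psi p a b s r ≤ psi p a b s' r' := by
  unfold psi
  gcongr

lemma psi_swap (p a b s r : ℝ) : psi p a b s r = psi p b a r s := by
  unfold psi; rw [add_comm]

lemma continuousAt_psi (ha : 0 ≤ a) (hb : 0 ≤ b) (hab : 1 ≤ a + b) {s r : ℝ}
    (hs : 0 < s) (hr : 0 < r) : ContinuousAt (fun x : ℝ × ℝ => psi p a b x.1 x.2) (s, r) := by
  unfold psi
  refine ContinuousAt.rpow_const ?_ (Or.inl (psi_arg_pos ha hb hab hs hr).ne')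
  refine ContinuousAt.add ?_ ?_
  · exact (continuousAt_fst.rpow_const (Or.inl hs.ne')).const_mul a
  · exact (continuousAt_snd.rpow_const (Or.inl hr.ne')).const_mul b

variable {s₀ r₀ : ℝ}

lemma grad_nonneg (ha : 0 ≤ a) {s ψ : ℝ} (hs : 0 ≤ s) (hψ : 0 ≤ ψ) : 0 ≤ grad p a s ψ := by
  unfold grad; positivity

lemma grad_mul {s ψ : ℝ} (hs : 0 < s) (hψ : 0 < ψ) :
    grad p a s ψ * s = ψ * (a * s ^ p / ψ ^ p) := by
  unfold grad
  rw [Real.rpow_sub_one (by positivity), Real.div_rpow hs.le hψ.le]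
  have := Real.rpow_pos_of_pos hψ p
  field_simp

lemma weights_add (hp : 0 < p) (ha : 0 ≤ a) (hb : 0 ≤ b) (hab : 1 ≤ a + b)
    (hs : 0 < s₀) (hr : 0 < r₀) :
    a * s₀ ^ p / psi p a b s₀ r₀ ^ p + b * r₀ ^ p / psi p a b s₀ r₀ ^ p = 1 := by
  rw [← add_div, psi_rpow hp ha hb hs.le hr.le, div_self (psi_arg_pos ha hb hab hs hr).ne']

/-- Normalizing at (s₀, r₀) turns ψ into a power mean of the ratios s/s₀ and r/r₀ with weights of
total mass 1, so the comparison of ψ with its tangent planes becomes a comparison of means. -/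
lemma psi_eq_mul (hp : 0 < p) (ha : 0 ≤ a) (hb : 0 ≤ b) (hab : 1 ≤ a + b)
    (hs : 0 < s₀) (hr : 0 < r₀) {s r : ℝ} (hs' : 0 ≤ s) (hr' : 0 ≤ r) :
    psi p a b s r = psi p a b s₀ r₀ * (a * s₀ ^ p / psi p a b s₀ r₀ ^ p * (s / s₀) ^ p +
      b * r₀ ^ p / psi p a b s₀ r₀ ^ p * (r / r₀) ^ p) ^ (1 / p) := by
  have hψ : 0 < psi p a b s₀ r₀ := psi_pos ha hb hab hs hr
  set ψ := psi p a b s₀ r₀ with hψdef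
  have h1 := Real.rpow_pos_of_pos hψ p
  have h2 := Real.rpow_pos_of_pos hs p
  have h3 := Real.rpow_pos_of_pos hr p
  rw [Real.div_rpow hs' hs.le, Real.div_rpow hr' hr.le]
  have : a * s₀ ^ p / ψ ^ p * (s ^ p / s₀ ^ p) + b * r₀ ^ p / ψ ^ p * (r ^ p / r₀ ^ p)
      = (a * s ^ p + b * r ^ p) / ψ ^ p := by field_simp
  rw [this, Real.div_rpow (by positivity) h1.le, ← Real.rpow_mul hψ.le, mul_one_div_cancel hp.ne',
    Real.rpow_one, psi]
  field_simp

lemma grad_euler (hp : 0 < p) (ha : 0 ≤ a) (hb : 0 ≤ b) (hab : 1 ≤ a + b)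
    (hs : 0 < s₀) (hr : 0 < r₀) :
    grad p a s₀ (psi p a b s₀ r₀) * s₀ + grad p b r₀ (psi p a b s₀ r₀) * r₀ = psi p a b s₀ r₀ := by
  have hψ : 0 < psi p a b s₀ r₀ := psi_pos ha hb hab hs hr
  rw [grad_mul hs hψ, grad_mul hr hψ, ← mul_add, weights_add hp ha hb hab hs hr, mul_one]

lemma grad_mul_eq {s₀ ψ : ℝ} (hs : 0 < s₀) (hψ : 0 < ψ) (s : ℝ) :
    grad p a s₀ ψ * s = ψ * (a * s₀ ^ p / ψ ^ p * (s / s₀)) := by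
  have := grad_mul (p := p) (a := a) hs hψ
  have h : grad p a s₀ ψ * s = grad p a s₀ ψ * s₀ * (s / s₀) := by field_simp
  rw [h, this]; ring

lemma tangent_le_psi (hp : 1 ≤ p) (ha : 0 ≤ a) (hb : 0 ≤ b) (hab : 1 ≤ a + b)
    (hs : 0 < s₀) (hr : 0 < r₀) {s r : ℝ} (hs' : 0 ≤ s) (hr' : 0 ≤ r) :
    grad p a s₀ (psi p a b s₀ r₀) * s + grad p b r₀ (psi p a b s₀ r₀) * r ≤ psi p a b s r := by
  have hp0 : 0 < p := by linarith
  have hψ : 0 < psi p a b s₀ r₀ := psi_pos ha hb hab hs hr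
  rw [psi_eq_mul hp0 ha hb hab hs hr hs' hr', grad_mul_eq hs hψ, grad_mul_eq hr hψ, ← mul_add]
  refine mul_le_mul_of_nonneg_left ?_ hψ.le
  exact mean_le_rpow_mean hp (by positivity) (by positivity) (weights_add hp0 ha hb hab hs hr)
    (by positivity) (by positivity)

lemma psi_le_tangent (hp0 : 0 < p) (hp : p ≤ 1) (ha : 0 ≤ a) (hb : 0 ≤ b) (hab : 1 ≤ a + b)
    (hs : 0 < s₀) (hr : 0 < r₀) {s r : ℝ} (hs' : 0 ≤ s) (hr' : 0 ≤ r) :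
    psi p a b s r ≤ grad p a s₀ (psi p a b s₀ r₀) * s + grad p b r₀ (psi p a b s₀ r₀) * r := by
  have hψ : 0 < psi p a b s₀ r₀ := psi_pos ha hb hab hs hr
  rw [psi_eq_mul hp0 ha hb hab hs hr hs' hr', grad_mul_eq hs hψ, grad_mul_eq hr hψ, ← mul_add]
  refine mul_le_mul_of_nonneg_left ?_ hψ.le
  exact rpow_mean_le_mean hp0 hp (by positivity) (by positivity) (weights_add hp0 ha hb hab hs hr)
    (by positivity) (by positivity)

/-- The defect of concavity of `psi` along tangent planes, for `p ≥ 1/2`. -/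
lemma tangent_sub_le_psi (hp : 1 / 2 ≤ p) (ha : 0 ≤ a) (hb : 0 ≤ b) (hab : 1 ≤ a + b)
    (hs : 0 < s₀) (hr : 0 < r₀) {s r : ℝ} (hs' : 0 ≤ s) (hr' : 0 ≤ r) :
    grad p a s₀ (psi p a b s₀ r₀) * s + grad p b r₀ (psi p a b s₀ r₀) * r -
      grad p a s₀ (psi p a b s₀ r₀) * grad p b r₀ (psi p a b s₀ r₀) / psi p a b s₀ r₀ *
        (√(r₀ * s) - √(s₀ * r)) ^ 2 ≤ psi p a b s r := by
  have hp0 : 0 < p := by linarith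
  have hψ : 0 < psi p a b s₀ r₀ := psi_pos ha hb hab hs hr
  have hw := weights_add hp0 ha hb hab hs hr
  have e1 := grad_mul_eq (p := p) (a := a) hs hψ
  have e2 := grad_mul_eq (p := p) (a := b) hr hψ
  have hpsi := psi_eq_mul hp0 ha hb hab hs hr hs' hr'
  set ψ := psi p a b s₀ r₀ with hψdef
  have hw1 : 0 ≤ a * s₀ ^ p / ψ ^ p := by positivity
  have hw2 : 0 ≤ b * r₀ ^ p / ψ ^ p := by positivity
  set w₁ := a * s₀ ^ p / ψ ^ p with hw₁
  set w₂ := b * r₀ ^ p / ψ ^ p with hw₂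
  set x := s / s₀ with hx
  set y := r / r₀ with hy
  have hx0 : 0 ≤ x := by positivity
  have hy0 : 0 ≤ y := by positivity
  have hmean := sqrt_mean_le hp hw1 hw2 hw hx0 hy0
  have g1 : grad p a s₀ ψ = ψ * w₁ / s₀ := by
    have := e1 1; rw [mul_one] at this; rw [this]; ring
  have g2 : grad p b r₀ ψ = ψ * w₂ / r₀ := by
    have := e2 1; rw [mul_one] at this; rw [this]; ring
  have q1 : √(r₀ * s) = √(s₀ * r₀) * √x := by
    rw [← Real.sqrt_mul (by positivity)]; congr 1; rw [hx]; field_simp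
  have q2 : √(s₀ * r) = √(s₀ * r₀) * √y := by
    rw [← Real.sqrt_mul (by positivity)]; congr 1; rw [hy]; field_simp
  have q3 : (√(r₀ * s) - √(s₀ * r)) ^ 2 = s₀ * r₀ * (√x - √y) ^ 2 := by
    rw [q1, q2, ← mul_sub, mul_pow, Real.sq_sqrt (by positivity)]
  rw [hpsi, e1 s, e2 r, g1, g2, q3, ← hx, ← hy]
  have q4 : ψ * w₁ / s₀ * (ψ * w₂ / r₀) / ψ * (s₀ * r₀ * (√x - √y) ^ 2) =
      ψ * (w₁ * w₂ * (√x - √y) ^ 2) := by field_simp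
  rw [q4, ← mul_add, ← mul_sub]
  -- Since w₁ + w₂ = 1, w₁x + w₂y - w₁w₂(√x - √y)² = (w₁√x + w₂√y)², which is the mean of exponent
  -- 1/2.
  refine mul_le_mul_of_nonneg_left (le_trans (le_of_eq ?_) hmean) hψ.le
  have hsx := Real.sq_sqrt hx0
  have hsy := Real.sq_sqrt hy0
  have hw2' : w₂ = 1 - w₁ := by linarith
  rw [hw2']
  clear_value w₁ w₂ x y
  linear_combination -w₁ * hsx - (1 - w₁) * hsy

/-- A Jensen type inequality: negative power means of the slopes. -/
lemma one_le_sum_rpow {d : ℝ} (hp : 0 < p) (hd : p ≤ d) (ha : 0 ≤ a) (hb : 0 ≤ b)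
    (hab : 1 ≤ a + b) {x y : ℝ} (hx : 0 < x) (hy : 0 < y) (h : a * x ^ p + b * y ^ p = 1) :
    1 ≤ a * x ^ (p - d) + b * y ^ (p - d) := by
  -- Bernoulli's inequality at u^p. Weighted by a and b, the linear terms add up to a multiple of a
  -- + b - 1 ≥ 0, because a x^p + b y^p = 1.
  have key : ∀ u : ℝ, 0 < u → 1 + (d - p) / p * (1 - u ^ p) ≤ u ^ (p - d) := fun u hu => by
    have := one_add_mul_le_rpow_neg (Real.rpow_pos_of_pos hu p)
      (e := (d - p) / p) (by apply div_nonneg <;> linarith)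
    rwa [← Real.rpow_mul hu.le, show p * -((d - p) / p) = p - d by field_simp; ring] at this
  have h1 := mul_le_mul_of_nonneg_left (key x hx) ha
  have h2 := mul_le_mul_of_nonneg_left (key y hy) hb
  have h3 : 0 ≤ (d - p) / p := by apply div_nonneg <;> linarith
  nlinarith

lemma slopes_eq (hp : 0 < p) (ha : 0 ≤ a) (hb : 0 ≤ b) (hab : 1 ≤ a + b)
    (hs : 0 < s₀) (hr : 0 < r₀) :
    a * (s₀ / psi p a b s₀ r₀) ^ p + b * (r₀ / psi p a b s₀ r₀) ^ p = 1 := by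
  have hψ : 0 < psi p a b s₀ r₀ := psi_pos ha hb hab hs hr
  rw [Real.div_rpow hs.le hψ.le, Real.div_rpow hr.le hψ.le, ← weights_add hp ha hb hab hs hr]
  ring

/-- The case d = 1 of `one_le_sum_rpow`: the gradient of ψ is (a x^{p-1}, b y^{p-1}) in terms of the
slopes x = s₀/ψ and y = r₀/ψ. -/
lemma one_le_grad_add (hp0 : 0 < p) (hp : p ≤ 1) (ha : 0 ≤ a) (hb : 0 ≤ b) (hab : 1 ≤ a + b)
    (hs : 0 < s₀) (hr : 0 < r₀) :
    1 ≤ grad p a s₀ (psi p a b s₀ r₀) + grad p b r₀ (psi p a b s₀ r₀) := by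
  have hψ : 0 < psi p a b s₀ r₀ := psi_pos ha hb hab hs hr
  exact one_le_sum_rpow hp0 hp ha hb hab (by positivity) (by positivity)
    (slopes_eq hp0 ha hb hab hs hr)

/-- The case d = 2 of `one_le_sum_rpow`, whence p ≤ 2: division by the coordinates lowers the
exponent of the slopes to p - 2. -/
lemma one_le_grad_div_add (hp0 : 0 < p) (hp : p ≤ 2) (ha : 0 ≤ a) (hb : 0 ≤ b) (hab : 1 ≤ a + b)
    (hs : 0 < s₀) (hr : 0 < r₀) :
    1 ≤ psi p a b s₀ r₀ * (grad p a s₀ (psi p a b s₀ r₀) / s₀ +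
      grad p b r₀ (psi p a b s₀ r₀) / r₀) := by
  have hψ : 0 < psi p a b s₀ r₀ := psi_pos ha hb hab hs hr
  have := one_le_sum_rpow (d := 2) hp0 hp ha hb hab (div_pos hs hψ) (div_pos hr hψ)
    (slopes_eq hp0 ha hb hab hs hr)
  refine this.trans (le_of_eq ?_)
  have key : ∀ u : ℝ, 0 < u → (u / psi p a b s₀ r₀) ^ (p - 2) =
      psi p a b s₀ r₀ * ((u / psi p a b s₀ r₀) ^ (p - 1) / u) := fun u hu => by
    rw [show p - 2 = p - 1 - 1 by ring, Real.rpow_sub_one (by positivity)]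
    field_simp
  rw [key _ hs, key _ hr]
  unfold grad
  ring

end Psi

/-! ### Hölder's inequality and the coefficients α_t, β_t -/

section Coef

variable {p a b s r : ℝ}

lemma coef_nonneg {t : ℝ} (ht : 0 ≤ t) (ha : 0 ≤ a) : 0 ≤ coef p t a := by
  unfold coef; positivity

/-- The optimal coefficient in Hölder's inequality. -/
lemma coef_opt (hp : 0 < p) (ha : 0 ≤ a) {ψ : ℝ} (hs : 0 < s) (hψ : 0 < ψ) :
    coef p (a * s ^ p / ψ ^ p) a = grad p a s ψ := by
  unfold coef grad
  rcases ha.lt_or_eq with h | h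
  · rw [mul_div_assoc, ← Real.div_rpow hs.le hψ.le, Real.mul_rpow h.le (by positivity),
      ← Real.rpow_mul (by positivity), mul_right_comm, ← Real.rpow_add h, sub_add_cancel,
      Real.rpow_one]
    congr 2
    field_simp
  · rw [← h, Real.zero_rpow (one_div_pos.2 hp).ne']; simp

lemma coef_mul_eq {t : ℝ} (ht : 0 < t) :
    coef p t a * s = t * (a ^ (1 / p) * s / t ^ (1 / p)) := by
  unfold coef
  rw [Real.rpow_sub ht, Real.rpow_one]
  ring

lemma mul_rpow_coef (hp : 0 < p) (ha : 0 ≤ a) (hs : 0 ≤ s) {t : ℝ} (ht : 0 < t) :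
    t * (a ^ (1 / p) * s / t ^ (1 / p)) ^ p = a * s ^ p := by
  have e : ∀ u : ℝ, 0 ≤ u → (u ^ (1 / p)) ^ p = u := fun u hu => by
    rw [← Real.rpow_mul hu, one_div_mul_cancel hp.ne', Real.rpow_one]
  rw [Real.div_rpow (by positivity) (by positivity), Real.mul_rpow (by positivity) hs, e a ha,
    e t ht.le]
  field_simp

/-- ψ is written as a power mean with weights 1 - t and t whose arithmetic counterpart is α_t s +
β_t r (`coef_mul_eq`). Hölder's inequality, in either direction, is then monotonicity of means. -/
lemma psi_eq_coef (hp : 0 < p) (ha : 0 ≤ a) (hb : 0 ≤ b) (hs : 0 ≤ s) (hr : 0 ≤ r) {t : ℝ}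
    (ht0 : 0 < t) (ht1 : t < 1) :
    psi p a b s r = ((1 - t) * (a ^ (1 / p) * s / (1 - t) ^ (1 / p)) ^ p +
      t * (b ^ (1 / p) * r / t ^ (1 / p)) ^ p) ^ (1 / p) := by
  rw [mul_rpow_coef hp ha hs (by linarith), mul_rpow_coef hp hb hr ht0, psi]

lemma psi_le_coef (hp0 : 0 < p) (hp : p ≤ 1) (ha : 0 ≤ a) (hb : 0 ≤ b) (hs : 0 ≤ s) (hr : 0 ≤ r)
    {t : ℝ} (ht0 : 0 < t) (ht1 : t < 1) :
    psi p a b s r ≤ coef p (1 - t) a * s + coef p t b * r := by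
  have h1 : 0 < 1 - t := by linarith
  rw [psi_eq_coef hp0 ha hb hs hr ht0 ht1, coef_mul_eq h1, coef_mul_eq ht0]
  exact rpow_mean_le_mean hp0 hp h1.le ht0.le (by ring) (by positivity) (by positivity)

lemma coef_zero (hp : 1 < p) : coef p 0 a = 0 := by
  unfold coef
  rw [Real.zero_rpow, zero_mul]
  have : 1 / p < 1 := by rw [div_lt_one (by linarith)]; exact hp
  linarith

lemma coef_one : coef p 1 a = a ^ (1 / p) := by simp [coef]

lemma rpow_mul_le_psi (hp : 0 < p) (ha : 0 ≤ a) (hb : 0 ≤ b) (hs : 0 ≤ s) (hr : 0 ≤ r) :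
    a ^ (1 / p) * s ≤ psi p a b s r := by
  have e : (s ^ p) ^ (1 / p) = s := by
    rw [← Real.rpow_mul hs, mul_one_div_cancel hp.ne', Real.rpow_one]
  calc a ^ (1 / p) * s = (a * s ^ p) ^ (1 / p) := by
        rw [Real.mul_rpow ha (by positivity), e]
    _ ≤ _ := Real.rpow_le_rpow (by positivity) (by have : 0 ≤ b * r ^ p := by positivity
                                                   linarith) (by positivity)

lemma coef_le_psi (hp : 1 < p) (ha : 0 ≤ a) (hb : 0 ≤ b) (hs : 0 ≤ s) (hr : 0 ≤ r)
    {t : ℝ} (ht : t ∈ Icc (0 : ℝ) 1) :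
    coef p (1 - t) a * s + coef p t b * r ≤ psi p a b s r := by
  have hp0 : 0 < p := by linarith
  rcases ht.1.eq_or_lt with h | h
  · rw [← h, sub_zero, coef_one, coef_zero hp, zero_mul, add_zero]
    exact rpow_mul_le_psi hp0 ha hb hs hr
  rcases ht.2.eq_or_lt with h' | h'
  · rw [h', sub_self, coef_one, coef_zero hp, zero_mul, zero_add, psi_swap]
    exact rpow_mul_le_psi hp0 hb ha hr hs
  have h1 : 0 < 1 - t := by linarith
  rw [psi_eq_coef hp0 ha hb hs hr h h', coef_mul_eq h1, coef_mul_eq h]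
  exact mean_le_rpow_mean hp.le h1.le h.le (by ring) (by positivity) (by positivity)

end Coef

/-! ### The sum of two points -/

section PairOfPoints

variable {n : ℕ} {p a b : ℝ}

lemma eta_nullVec_nullVec (z w : Sph n) :
    eta (nullVec z) (nullVec w) = 1 - inner ℝ z.1 w.1 := by simp [eta, nullVec]

lemma eq_of_eta_nullVec_eq_zero {z w : Sph n} (h : eta (nullVec z) (nullVec w) = 0) : z = w := by
  rw [eta_nullVec_nullVec] at h
  exact Subtype.ext ((inner_eq_one_iff_of_norm_eq_one (𝕜 := ℝ) (norm_sph z) (norm_sph w)).1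
    (sub_eq_zero.1 h).symm)

/-- A four point inequality for two points and two ideal points. -/
lemma sq_sqrt_sub_sqrt_le (X Y : Hyp n) (z w : Sph n) :
    (√(eta Y.1 (nullVec w) * eta X.1 (nullVec z)) -
      √(eta X.1 (nullVec w) * eta Y.1 (nullVec z))) ^ 2 ≤
      (eta X.1 Y.1 - 1) * eta (nullVec z) (nullVec w) := by
  have hs := eta_point_nullVec_pos z X
  have hr := eta_point_nullVec_pos z Y
  have hs₀ := eta_point_nullVec_pos w X
  have hr₀ := eta_point_nullVec_pos w Y
  rcases (eta_nullVec_nonneg z w).eq_or_lt with hδ | hδ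
  · rw [← hδ, eq_of_eta_nullVec_eq_zero hδ.symm, mul_comm (eta Y.1 (nullVec w))]
    simp
  set s := eta X.1 (nullVec z) with hsd
  set r := eta Y.1 (nullVec z) with hrd
  set s₀ := eta X.1 (nullVec w) with hs₀d
  set r₀ := eta Y.1 (nullVec w) with hr₀d
  set δ := eta (nullVec z) (nullVec w) with hδd
  set c := eta X.1 Y.1 with hcd
  -- The components of X and Y orthogonal to both null vectors; their combinations are spacelike.
  set x := X.1 - (s / δ) • nullVec w - (s₀ / δ) • nullVec z with hx
  set y := Y.1 - (r / δ) • nullVec w - (r₀ / δ) • nullVec z with hy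
  have hxx : eta x x = 1 - 2 * (s * s₀) / δ := by
    simp only [hx, eta_sub_left, eta_sub_right, eta_smul_left, eta_smul_right, eta_point_self,
      eta_nullVec_self, eta_comm (nullVec w) (nullVec z), eta_comm (nullVec _) X.1, ← hsd, ← hs₀d,
      ← hδd]
    field_simp; ring
  have hyy : eta y y = 1 - 2 * (r * r₀) / δ := by
    simp only [hy, eta_sub_left, eta_sub_right, eta_smul_left, eta_smul_right, eta_point_self,
      eta_nullVec_self, eta_comm (nullVec w) (nullVec z), eta_comm (nullVec _) Y.1, ← hrd, ← hr₀d,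
      ← hδd]
    field_simp; ring
  have hxy : eta x y = c - (s * r₀ + s₀ * r) / δ := by
    simp only [hx, hy, eta_sub_left, eta_sub_right, eta_smul_left, eta_smul_right,
      eta_nullVec_self, eta_comm (nullVec w) (nullVec z), eta_comm (nullVec _) Y.1, ← hrd, ← hr₀d,
      ← hsd, ← hs₀d, ← hδd, ← hcd]
    field_simp; ring
  have hxz : eta x (nullVec z) = 0 := by
    simp only [hx, eta_sub_left, eta_smul_left, eta_nullVec_self,
      eta_comm (nullVec w) (nullVec z), ← hsd, ← hδd]
    field_simp; ring
  have hyz : eta y (nullVec z) = 0 := by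
    simp only [hy, eta_sub_left, eta_smul_left, eta_nullVec_self,
      eta_comm (nullVec w) (nullVec z), ← hrd, ← hδd]
    field_simp; ring
  have hp : 0 < √(s * s₀) := Real.sqrt_pos.2 (by positivity)
  have hq : 0 < √(r * r₀) := Real.sqrt_pos.2 (by positivity)
  have hp2 : √(s * s₀) ^ 2 = s * s₀ := Real.sq_sqrt (by positivity)
  have hq2 : √(r * r₀) ^ 2 = r * r₀ := Real.sq_sqrt (by positivity)
  have hpq : √(r₀ * s) * √(s₀ * r) = √(s * s₀) * √(r * r₀) := by
    rw [← Real.sqrt_mul (by positivity), ← Real.sqrt_mul (by positivity)]; congr 1; ring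
  have h1 : √(r₀ * s) ^ 2 = r₀ * s := Real.sq_sqrt (by positivity)
  have h2 : √(s₀ * r) ^ 2 = s₀ * r := Real.sq_sqrt (by positivity)
  -- With these weights, the expansion of the norm exceeds a positive multiple of the wanted
  -- inequality exactly by the square (P - Q)², where P = √(s s₀) and Q = √(r r₀).
  have hD := eta_self_nonpos_of_eta_eq_zero (D := √(r * r₀) • x - √(s * s₀) • y)
    (N := nullVec z) (inFutureCone_nullVec z) (nullVec_ne_zero z) (by simp [hxz, hyz])
  simp only [eta_sub_left, eta_sub_right, eta_smul_left, eta_smul_right, eta_comm y x, hxx, hyy,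
    hxy] at hD
  generalize √(s * s₀) = P at *
  generalize √(r * r₀) = Q at *
  rw [← hp2, ← hq2] at hD
  have hexp : (√(r₀ * s) - √(s₀ * r)) ^ 2 = r₀ * s + s₀ * r - 2 * (P * Q) := by
    rw [sub_sq, h1, h2, mul_assoc, hpq]; ring
  rw [hexp]
  have h3 : 2 * P * Q * (1 - c + (s * r₀ + s₀ * r - 2 * (P * Q)) / δ) ≤ 0 := by
    refine le_trans (le_of_sub_nonneg ?_) hD
    have : Q * (Q * (1 - 2 * P ^ 2 / δ)) - Q * (P * (c - (s * r₀ + s₀ * r) / δ)) -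
        (P * (Q * (c - (s * r₀ + s₀ * r) / δ)) - P * (P * (1 - 2 * Q ^ 2 / δ))) -
        2 * P * Q * (1 - c + (s * r₀ + s₀ * r - 2 * (P * Q)) / δ) = (P - Q) ^ 2 := by
      field_simp; ring
    nlinarith [sq_nonneg (P - Q)]
  have h4 : 1 - c + (s * r₀ + s₀ * r - 2 * (P * Q)) / δ ≤ 0 := by
    by_contra hc
    push Not at hc
    have : 0 < 2 * P * Q * (1 - c + (s * r₀ + s₀ * r - 2 * (P * Q)) / δ) := by positivity
    linarith
  have h5 : (s * r₀ + s₀ * r - 2 * (P * Q)) / δ ≤ c - 1 := by linarith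
  rw [div_le_iff₀ hδ] at h5
  linarith

lemma eta_comb_self (α β : ℝ) (X Y : Hyp n) :
    eta (α • X.1 + β • Y.1) (α • X.1 + β • Y.1) = α ^ 2 + β ^ 2 + 2 * α * β * eta X.1 Y.1 := by
  simp only [eta_add_left, eta_add_right, eta_smul_left, eta_smul_right, eta_point_self,
    eta_comm Y.1 X.1]
  ring

lemma sq_add_sq_le_two_mul_eta (X Y : Hyp n) (z : Sph n) :
    eta X.1 (nullVec z) ^ 2 + eta Y.1 (nullVec z) ^ 2 ≤
      2 * eta X.1 Y.1 * (eta X.1 (nullVec z) * eta Y.1 (nullVec z)) := by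
  have h := eta_self_nonpos_of_eta_eq_zero
    (D := eta Y.1 (nullVec z) • X.1 - eta X.1 (nullVec z) • Y.1)
    (inFutureCone_nullVec z) (nullVec_ne_zero z) (by simp; ring)
  simp only [eta_sub_left, eta_sub_right, eta_smul_left, eta_smul_right, eta_point_self,
    eta_comm Y.1 X.1] at h
  linarith

/-- The points `W` whose support function is below the `p`-combination of those of two points. -/
def pointSum (p a b : ℝ) (X Y : Hyp n) : Set (Hyp n) :=
  {W | ∀ z, eta W.1 (nullVec z) ≤ psi p a b (eta X.1 (nullVec z)) (eta Y.1 (nullVec z))}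

variable (hp₁ : 1 / 2 ≤ p) (hp₂ : p ≤ 2) (ha : 0 ≤ a) (hb : 0 ≤ b) (hab : 1 ≤ a + b)

include hp₁ hp₂ ha hb hab in
/-- The sum of two points contains the point that touches its support function to first order at
a given ideal point. -/
lemma mem_pointSum_of_touching {X Y W : Hyp n} {w : Sph n} {ψ k : ℝ}
    (hψ : ψ = psi p a b (eta X.1 (nullVec w)) (eta Y.1 (nullVec w)))
    (h : grad p a (eta X.1 (nullVec w)) ψ • X.1 + grad p b (eta Y.1 (nullVec w)) ψ • Y.1 =
      W.1 + k • nullVec w) : W ∈ pointSum p a b X Y := by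
  intro z
  have hp0 : 0 < p := by linarith
  have hs := eta_point_nullVec_pos z X
  have hr := eta_point_nullVec_pos z Y
  have hs₀ := eta_point_nullVec_pos w X
  have hr₀ := eta_point_nullVec_pos w Y
  have hψ0 : 0 < ψ := hψ ▸ psi_pos ha hb hab hs₀ hr₀
  have hW : eta W.1 (nullVec z) = eta (grad p a (eta X.1 (nullVec w)) ψ • X.1 +
      grad p b (eta Y.1 (nullVec w)) ψ • Y.1) (nullVec z)
        - k * eta (nullVec z) (nullVec w) := by
    rw [h]; simp [eta_comm (nullVec w) (nullVec z)]
  -- Equating the norms of both sides of `h` gives α² + β² + 2αβ cosh d(X, Y) = 1 + 2kψ, which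
  -- determines k.
  have hnorm := eta_comb_self (grad p a (eta X.1 (nullVec w)) ψ) (grad p b (eta Y.1 (nullVec w)) ψ)
    X Y
  have heul := grad_euler hp0 ha hb hab hs₀ hr₀
  have hWw : eta W.1 (nullVec w) = ψ := by
    have : eta (W.1 + k • nullVec w) (nullVec w) = eta W.1 (nullVec w) := by simp
    rw [← this, ← h]
    simp only [eta_add_left, eta_smul_left]
    rw [hψ, heul]
  rw [h] at hnorm
  simp only [eta_add_left, eta_add_right, eta_smul_left, eta_smul_right, eta_point_self,
    eta_nullVec_self, eta_comm (nullVec w) W.1, hWw, mul_zero, add_zero] at hnorm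
  have hα := grad_nonneg (p := p) ha hs₀.le hψ0.le
  have hβ := grad_nonneg (p := p) hb hr₀.le hψ0.le
  rw [hW]
  simp only [eta_add_left, eta_smul_left]
  have hδ := eta_nullVec_nonneg z w
  have hc := one_le_eta X Y
  rcases le_total p 1 with hp | hp
  -- From α + β ≥ 1 the norm identity yields kψ ≥ αβ(cosh d(X, Y) - 1). By the four point
  -- inequality, the null term therefore compensates the concavity defect of ψ.
  · have h1 := one_le_grad_add hp0 hp ha hb hab hs₀ hr₀
    have h2 := tangent_sub_le_psi hp₁ ha hb hab hs₀ hr₀ hs.le hr.le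
    have h3 := sq_sqrt_sub_sqrt_le X Y z w
    rw [← hψ] at h1 h2
    set α := grad p a (eta X.1 (nullVec w)) ψ
    set β := grad p b (eta Y.1 (nullVec w)) ψ
    refine le_trans ?_ h2
    rw [sub_le_sub_iff_left]
    calc α * β / ψ * _ ≤ α * β / ψ * ((eta X.1 Y.1 - 1) * eta (nullVec z) (nullVec w)) :=
          mul_le_mul_of_nonneg_left h3 (by positivity)
      _ = (α * β * (eta X.1 Y.1 - 1) / ψ) * eta (nullVec z) (nullVec w) := by ring
      _ ≤ _ := by
        refine mul_le_mul_of_nonneg_right ?_ hδ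
        rw [div_le_iff₀ hψ0]
        nlinarith
  -- Here ψ lies above its tangent plane, so k ≥ 0 suffices, that is α² + β² + 2αβ cosh d(X, Y) ≥ 1.
  · have h1 := one_le_grad_div_add hp0 hp₂ ha hb hab hs₀ hr₀
    have h2 := tangent_le_psi hp ha hb hab hs₀ hr₀ hs.le hr.le
    have h3 := sq_add_sq_le_two_mul_eta X Y w
    rw [← hψ] at h1 h2 heul
    set α := grad p a (eta X.1 (nullVec w)) ψ
    set β := grad p b (eta Y.1 (nullVec w)) ψ
    set s₀ := eta X.1 (nullVec w)
    set r₀ := eta Y.1 (nullVec w)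
    have h4 : ψ * (α / s₀ + β / r₀) = α ^ 2 + β ^ 2 + α * β * ((s₀ ^ 2 + r₀ ^ 2) / (s₀ * r₀)) := by
      rw [← heul]; field_simp; ring
    have h5 : (s₀ ^ 2 + r₀ ^ 2) / (s₀ * r₀) ≤ 2 * eta X.1 Y.1 := by
      rwa [div_le_iff₀ (by positivity)]
    have h6 := mul_le_mul_of_nonneg_left h5 (mul_nonneg hα hβ)
    have hk : 0 ≤ k := by
      by_contra hk
      push Not at hk
      nlinarith
    nlinarith [mul_nonneg hk hδ]

/-- If a vector has nonnegative norm and positive pairing with a vector of the future cone, then it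
lies in the future cone. -/
lemma inFutureCone_of_eta {V N : Mink n} (hN : InFutureCone N) (h : 0 ≤ eta V V)
    (hpos : 0 < eta V N) : InFutureCone V := by
  by_contra hc
  rw [eta_self] at h
  have : InFutureCone (-V) := by
    unfold InFutureCone at hc ⊢
    push Not at hc
    simp only [Prod.fst_neg, Prod.snd_neg, norm_neg]
    nlinarith [norm_nonneg V.1]
  have := this.eta_nonneg hN
  rw [eta_neg_left] at this
  linarith

/-- Two linear conditions on a space of dimension n + 2 ≥ 3. -/
lemma exists_ne_zero_eta_eq_zero (hn : 1 ≤ n) (E N : Mink n) :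
    ∃ m : Mink n, m ≠ 0 ∧ eta m E = 0 ∧ eta m N = 0 := by
  let T : Mink n →ₗ[ℝ] (Fin 2 → ℝ) :=
    { toFun := fun m => ![eta m E, eta m N]
      map_add' := fun x y => by ext i; fin_cases i <;> simp
      map_smul' := fun c x => by ext i; fin_cases i <;> simp }
  have hdim : Module.finrank ℝ (Fin 2 → ℝ) < Module.finrank ℝ (Mink n) := by
    simp; omega
  obtain ⟨m, hm, hm0⟩ := (Submodule.ne_bot_iff _).1 (T.ker_ne_bot_of_finrank_lt hdim)
  refine ⟨m, hm0, ?_, ?_⟩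
  · have := congrFun hm 0; simpa [T] using this
  · have := congrFun hm 1; simpa [T] using this

/-- Caps of the sphere at infinity are connected: if two ideal points with `⟨D, ·⟩` of one sign are
separated by a hyperplane, then there is such a point on the hyperplane. -/
lemma exists_nullVec_between (hn : 1 ≤ n) {D E : Mink n} {z₁ z₂ : Sph n}
    (hD₁ : eta D (nullVec z₁) < 0) (hD₂ : eta D (nullVec z₂) < 0) (hE₁ : eta E (nullVec z₁) < 0)
    (hE₂ : 0 < eta E (nullVec z₂)) : ∃ z : Sph n, eta D (nullVec z) < 0 ∧ eta E (nullVec z) = 0 := by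
  -- A positive combination of the two null vectors that lies on the hyperplane. If it is timelike,
  -- it is moved to the light cone along a spacelike m orthogonal to E and N, with the sign of m
  -- chosen so that the pairing with D does not increase.
  set N := eta E (nullVec z₂) • nullVec z₁ + (-eta E (nullVec z₁)) • nullVec z₂ with hN
  have hNc : InFutureCone N := ((inFutureCone_nullVec _).smul hE₂.le).add
    ((inFutureCone_nullVec _).smul (by linarith))
  have hEN : eta E N = 0 := by simp [hN]; ring
  have hDN : eta D N < 0 := by
    simp only [hN, eta_add_right, eta_smul_right]; nlinarith
  have hN0 : N ≠ 0 := fun h => by rw [h] at hDN; simp at hDN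
  have fin : ∀ Q : Mink n, InFutureCone Q → eta Q Q = 0 → eta D Q < 0 → eta E Q = 0 →
      ∃ z : Sph n, eta D (nullVec z) < 0 ∧ eta E (nullVec z) = 0 := by
    intro Q hQ hQQ hDQ hEQ
    have hQ0 : Q ≠ 0 := fun h => by rw [h] at hDQ; simp at hDQ
    obtain ⟨z, hpos, hz⟩ := exists_eq_smul_nullVec hQ hQ0 hQQ
    refine ⟨z, ?_, ?_⟩
    · rw [hz, eta_smul_right] at hDQ
      by_contra hc
      push Not at hc
      have := mul_nonneg hpos.le hc
      simp only [nullVec] at *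
      linarith
    · rw [hz, eta_smul_right] at hEQ
      exact (mul_eq_zero.1 hEQ).resolve_left hpos.ne'
  rcases (hNc.eta_nonneg hNc).eq_or_lt with h0 | h0
  · exact fin N hNc h0.symm hDN hEN
  obtain ⟨m, hm0, hmE, hmN⟩ := exists_ne_zero_eta_eq_zero hn E N
  wlog hDm : eta D m ≤ 0 generalizing m
  · exact this (-m) (neg_ne_zero.2 hm0) (by simp [hmE]) (by simp [hmN])
      (by rw [eta_neg_right]; linarith)
  have hmm : eta m m < 0 := by
    by_contra hc
    push Not at hc
    exact hm0 (eq_zero_of_eta_eq_zero h0 hmN hc)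
  set τ := √(eta N N / -eta m m) with hτ
  have hτ2 : τ ^ 2 = eta N N / -eta m m := Real.sq_sqrt (by apply div_nonneg <;> linarith)
  have hτ0 : 0 ≤ τ := Real.sqrt_nonneg _
  have hQQ : eta (N + τ • m) (N + τ • m) = 0 := by
    simp only [eta_add_left, eta_add_right, eta_smul_left, eta_smul_right, eta_comm N m, hmN]
    have : τ * (τ * eta m m) = -eta N N := by
      rw [← mul_assoc, ← sq, hτ2, div_neg, neg_mul, div_mul_cancel₀ _ hmm.ne]
    linarith
  refine fin (N + τ • m) (inFutureCone_of_eta hNc hQQ.ge (by simpa [hmN] using h0)) hQQ ?_ ?_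
  · simp only [eta_add_right, eta_smul_right]; nlinarith
  · simp only [eta_add_right, eta_smul_right, hEN, eta_comm E m, hmE]; ring

lemma le_of_forall_coef_le {b r w : ℝ} (h : ∀ u ∈ Ioo (0 : ℝ) 1, w ≤ coef p u b * r) :
    w ≤ b ^ (1 / p) * r := by
  have hc : ContinuousAt (fun u : ℝ => coef p u b * r) 1 := by
    unfold coef
    exact ((Real.continuousAt_rpow_const _ _ (Or.inl one_ne_zero)).mul_const _).mul_const _
  have ht : Filter.Tendsto (fun u : ℝ => coef p u b * r) (𝓝[<] 1) (𝓝 (b ^ (1 / p) * r)) := by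
    have := hc.tendsto.mono_left (nhdsWithin_le_nhds (s := Iio 1))
    rwa [coef_one] at this
  refine ge_of_tendsto ht ?_
  filter_upwards [Ioo_mem_nhdsLT (show (0 : ℝ) < 1 by norm_num)] with u hu using h u hu

lemma psi_zero_left {s r : ℝ} (hp : 0 < p) (hb : 0 ≤ b) (hr : 0 ≤ r) :
    psi p 0 b s r = b ^ (1 / p) * r := by
  rw [psi, zero_mul, zero_add, Real.mul_rpow hb (by positivity), ← Real.rpow_mul hr,
    mul_one_div_cancel hp.ne', Real.rpow_one]

include ha hb hab in
-- The equality case of Hölder's inequality: for t = b r^p/ψ^p the coefficients form the gradient of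
-- ψ, and Euler's identity returns ψ. If a or b vanishes, this t is an endpoint of the interval and
-- is only reached as a limit.
lemma le_psi_of_forall_coef (hp0 : 0 < p) {s r w : ℝ} (hs : 0 < s) (hr : 0 < r)
    (h : ∀ t ∈ Ioo (0 : ℝ) 1, w ≤ coef p (1 - t) a * s + coef p t b * r) :
    w ≤ psi p a b s r := by
  have hz : ∀ u : ℝ, coef p u 0 = 0 := fun u => by
    unfold coef; rw [Real.zero_rpow (one_div_pos.2 hp0).ne', mul_zero]
  rcases ha.eq_or_lt with h0 | ha0
  · subst h0
    rw [psi_zero_left hp0 hb hr.le]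
    refine le_of_forall_coef_le fun u hu => ?_
    simpa [hz] using h u hu
  rcases hb.eq_or_lt with h0 | hb0
  · subst h0
    rw [psi_swap, psi_zero_left hp0 ha hs.le]
    refine le_of_forall_coef_le fun u hu => ?_
    simpa [hz] using h (1 - u) ⟨by linarith [hu.2], by linarith [hu.1]⟩
  have hψ := psi_pos (p := p) ha hb hab hs hr
  have hw := weights_add hp0 ha hb hab hs hr
  have h1 := Real.rpow_pos_of_pos hψ p
  have h2 := Real.rpow_pos_of_pos hs p
  have h3 := Real.rpow_pos_of_pos hr p
  have ht : b * r ^ p / psi p a b s r ^ p ∈ Ioo (0 : ℝ) 1 := by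
    have : 0 < a * s ^ p / psi p a b s r ^ p := by positivity
    exact ⟨by positivity, by linarith⟩
  have := h _ ht
  rwa [show 1 - b * r ^ p / psi p a b s r ^ p = a * s ^ p / psi p a b s r ^ p by linarith,
    coef_opt hp0 ha hs hψ, coef_opt hp0 hb hr hψ, grad_euler hp0 ha hb hab hs hr] at this

include ha hb hab in
lemma pointSum_eq_iInter (hp0 : 0 < p) (hp : p < 1) (X Y : Hyp n) :
    pointSum p a b X Y = ⋂ t ∈ Icc (0 : ℝ) 1, coneSet p t a X b Y := by
  ext W
  simp only [mem_iInter, pointSum, mem_ofPred_eq]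
  constructor
  · intro h t ht
    unfold coneSet
    rw [if_neg hp.ne]
    split_ifs with hc
    · trivial
    · have ht0 : 0 < t := lt_of_le_of_ne ht.1 fun h => hc ⟨hp, Or.inl h.symm⟩
      have ht1 : t < 1 := lt_of_le_of_ne ht.2 fun h => hc ⟨hp, Or.inr h⟩
      rw [mem_ofPred_eq, inFutureCone_iff]
      intro z
      have := psi_le_coef hp0 hp.le ha hb (eta_point_nullVec_pos z X).le
        (eta_point_nullVec_pos z Y).le ht0 ht1
      simp only [eta_sub_left, eta_add_left, eta_smul_left]
      linarith [h z]
  · intro h z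
    refine le_psi_of_forall_coef ha hb hab hp0 (eta_point_nullVec_pos z X)
      (eta_point_nullVec_pos z Y) fun t ht => ?_
    have h1 := h t ⟨ht.1.le, ht.2.le⟩
    unfold coneSet at h1
    rw [if_neg hp.ne, if_neg (by rintro ⟨-, h | h⟩ <;> [exact ht.1.ne' h; exact ht.2.ne h]),
      mem_ofPred_eq, inFutureCone_iff] at h1
    have := h1 z
    simp only [eta_sub_left, eta_add_left, eta_smul_left] at this
    linarith

include ha hb hab in
-- For each z there is an optimal weight t(z), at which Hölder's inequality is an equality. If each
-- t failed at some z, the t failing at a z with t(z) < t and those failing at a z with t(z) > t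
-- would be two open sets covering [0, 1], so both kinds of failure would occur for one t. The ideal
-- points at which this t fails form a connected cap, which would then contain a z with t(z) = t;
-- there no failure is possible.
lemma exists_mem_coneSet_of_mem_pointSum (hn : 1 ≤ n) (hp : 1 < p) {X Y W : Hyp n}
    (hW : W ∈ pointSum p a b X Y) : ∃ t ∈ Icc (0 : ℝ) 1,
      InFutureCone (coef p (1 - t) a • X.1 + coef p t b • Y.1 - W.1) := by
  by_contra hcon
  push Not at hcon
  have hp0 : 0 < p := by linarith
  set V : ℝ → Mink n := fun t => coef p (1 - t) a • X.1 + coef p t b • Y.1 - W.1 with hV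
  have hexp : 0 ≤ 1 - 1 / p := by
    rw [sub_nonneg, div_le_one hp0]; exact hp.le
  have hVc : Continuous V := by
    have h1 : Continuous fun t : ℝ => t ^ (1 - 1 / p) :=
      Real.continuous_rpow_const hexp
    have h2 : Continuous fun t : ℝ => (1 - t) ^ (1 - 1 / p) :=
      h1.comp (continuous_const.sub continuous_id)
    simp only [hV, coef]
    fun_prop
  have hcon' : ∀ t ∈ Icc (0 : ℝ) 1, ∃ z, eta (V t) (nullVec z) < 0 := fun t ht => by
    have := hcon t ht
    rw [inFutureCone_iff] at this
    push Not at this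
    exact this
  -- The excluded equation says that t is the optimal weight at z.
  have hne : ∀ t z, eta (V t) (nullVec z) < 0 →
      (1 - t) * (b * eta Y.1 (nullVec z) ^ p) ≠ t * (a * eta X.1 (nullVec z) ^ p) := by
    intro t z hneg heq
    have hs := eta_point_nullVec_pos z X
    have hr := eta_point_nullVec_pos z Y
    have hψ := psi_pos (p := p) ha hb hab hs hr
    have hψp := psi_rpow hp0 ha hb hs.le hr.le
    have hpos := Real.rpow_pos_of_pos hψ p
    have ht : t = b * eta Y.1 (nullVec z) ^ p /
        psi p a b (eta X.1 (nullVec z)) (eta Y.1 (nullVec z)) ^ p := by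
      rw [eq_div_iff hpos.ne', hψp]; linarith
    have ht' : 1 - t = a * eta X.1 (nullVec z) ^ p /
        psi p a b (eta X.1 (nullVec z)) (eta Y.1 (nullVec z)) ^ p := by
      rw [ht]; linarith [weights_add hp0 ha hb hab hs hr]
    simp only [hV, eta_sub_left, eta_add_left, eta_smul_left] at hneg
    rw [ht', ht, coef_opt hp0 ha hs hψ, coef_opt hp0 hb hr hψ,
      grad_euler hp0 ha hb hab hs hr] at hneg
    linarith [hW z]
  -- The two inequalities, here and in `T₂`, read t(z) < t and t(z) > t.
  let T₁ : Set ℝ := {t | ∃ z, eta (V t) (nullVec z) < 0 ∧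
    (1 - t) * (b * eta Y.1 (nullVec z) ^ p) < t * (a * eta X.1 (nullVec z) ^ p)}
  let T₂ : Set ℝ := {t | ∃ z, eta (V t) (nullVec z) < 0 ∧
    t * (a * eta X.1 (nullVec z) ^ p) < (1 - t) * (b * eta Y.1 (nullVec z) ^ p)}
  have hT₁ : IsOpen T₁ := by
    have : T₁ = ⋃ z, {t | eta (V t) (nullVec z) < 0 ∧
      (1 - t) * (b * eta Y.1 (nullVec z) ^ p) < t * (a * eta X.1 (nullVec z) ^ p)} := by
      ext t; simp [T₁]
    rw [this]
    exact isOpen_iUnion fun z => IsOpen.and (isOpen_lt (by fun_prop) (by fun_prop))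
      (isOpen_lt (by fun_prop) (by fun_prop))
  have hT₂ : IsOpen T₂ := by
    have : T₂ = ⋃ z, {t | eta (V t) (nullVec z) < 0 ∧
      t * (a * eta X.1 (nullVec z) ^ p) < (1 - t) * (b * eta Y.1 (nullVec z) ^ p)} := by
      ext t; simp [T₂]
    rw [this]
    exact isOpen_iUnion fun z => IsOpen.and (isOpen_lt (by fun_prop) (by fun_prop))
      (isOpen_lt (by fun_prop) (by fun_prop))
  have hcov : Icc (0 : ℝ) 1 ⊆ T₁ ∪ T₂ := fun t ht => by
    obtain ⟨z, hz⟩ := hcon' t ht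
    rcases lt_or_gt_of_ne (hne t z hz) with h | h
    · exact Or.inl ⟨z, hz, h⟩
    · exact Or.inr ⟨z, hz, h⟩
  have h1 : (Icc (0 : ℝ) 1 ∩ T₁).Nonempty := by
    have h1m : (1 : ℝ) ∈ Icc (0 : ℝ) 1 := ⟨by norm_num, le_refl _⟩
    refine ⟨1, h1m, (hcov h1m).resolve_right ?_⟩
    rintro ⟨z, -, hlt⟩
    have := Real.rpow_pos_of_pos (eta_point_nullVec_pos z X) p
    have : 0 ≤ a * eta X.1 (nullVec z) ^ p := by positivity
    simp at hlt; linarith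
  have h2 : (Icc (0 : ℝ) 1 ∩ T₂).Nonempty := by
    have h1m : (0 : ℝ) ∈ Icc (0 : ℝ) 1 := ⟨le_refl _, by norm_num⟩
    refine ⟨0, h1m, (hcov h1m).resolve_left ?_⟩
    rintro ⟨z, -, hlt⟩
    have := Real.rpow_pos_of_pos (eta_point_nullVec_pos z Y) p
    have : 0 ≤ b * eta Y.1 (nullVec z) ^ p := by positivity
    simp at hlt; linarith
  obtain ⟨t, ht, ⟨z₁, hz₁, hlt₁⟩, z₂, hz₂, hlt₂⟩ :=
    isPreconnected_Icc T₁ T₂ hT₁ hT₂ hcov h1 h2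
  have hs₁ := eta_point_nullVec_pos z₁ X
  have hr₁ := eta_point_nullVec_pos z₁ Y
  have hs₂ := eta_point_nullVec_pos z₂ X
  have hr₂ := eta_point_nullVec_pos z₂ Y
  have hta : 0 < t * a := by
    have hl : 0 ≤ (1 - t) * (b * eta Y.1 (nullVec z₁) ^ p) := by
      have := sub_nonneg.2 ht.2; positivity
    have hr := Real.rpow_pos_of_pos hs₁ p
    by_contra hc
    push Not at hc
    nlinarith
  have htb : 0 < (1 - t) * b := by
    have hl : 0 ≤ t * (a * eta X.1 (nullVec z₂) ^ p) := by
      have := ht.1; positivity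
    have hr := Real.rpow_pos_of_pos hr₂ p
    by_contra hc
    push Not at hc
    nlinarith
  -- The ratio of the heights of Y and X at which t is optimal, so that the hyperplane orthogonal to
  -- Y - ρX separates the two kinds of failure.
  set ρ := (t * a / ((1 - t) * b)) ^ (1 / p) with hρ
  have hρ0 : 0 < ρ := by positivity
  have hρp : ρ ^ p = t * a / ((1 - t) * b) := by
    rw [hρ, ← Real.rpow_mul (by positivity), one_div_mul_cancel hp0.ne', Real.rpow_one]
  have hρs : ∀ z : Sph n, (1 - t) * b * (ρ * eta X.1 (nullVec z)) ^ p =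
      t * (a * eta X.1 (nullVec z) ^ p) := fun z => by
    rw [Real.mul_rpow hρ0.le (eta_point_nullVec_pos z X).le, hρp, ← mul_assoc,
      mul_div_cancel₀ _ htb.ne', mul_assoc]
  obtain ⟨z, hz, hEz⟩ := exists_nullVec_between hn (E := Y.1 - ρ • X.1) hz₁ hz₂
    (by
      simp only [eta_sub_left, eta_smul_left, sub_neg]
      rw [← Real.rpow_lt_rpow_iff hr₁.le (by positivity) hp0]
      have := hρs z₁
      refine lt_of_mul_lt_mul_left ?_ htb.le
      linarith)
    (by
      simp only [eta_sub_left, eta_smul_left, sub_pos]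
      rw [← Real.rpow_lt_rpow_iff (by positivity) hr₂.le hp0]
      have := hρs z₂
      refine lt_of_mul_lt_mul_left ?_ htb.le
      linarith)
  simp only [eta_sub_left, eta_smul_left, sub_eq_zero] at hEz
  apply hne t z hz
  rw [hEz, ← hρs z]; ring

include ha hb hab in
lemma mem_pointSum_iff (hn : 1 ≤ n) (hp : 1 ≤ p) (X Y W : Hyp n) :
    W ∈ pointSum p a b X Y ↔ ∃ t ∈ Icc (0 : ℝ) 1, W ∈ coneSet p t a X b Y := by
  rcases hp.eq_or_lt with h | h
  · subst h
    simp only [coneSet, if_true, mem_ofPred_eq]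
    have h01 : ∃ t : ℝ, t ∈ Icc (0 : ℝ) 1 := ⟨0, le_refl _, by norm_num⟩
    simp only [pointSum, mem_ofPred_eq, inFutureCone_iff, psi, Real.rpow_one, div_one,
      eta_sub_left, eta_add_left, eta_smul_left, sub_nonneg]
    exact ⟨fun h => h01.imp fun t ht => ⟨ht, h⟩, fun ⟨t, _, h⟩ => h⟩
  · constructor
    · intro hW
      obtain ⟨t, ht, h2⟩ := exists_mem_coneSet_of_mem_pointSum ha hb hab hn h hW
      refine ⟨t, ht, ?_⟩
      rw [coneSet, if_neg h.ne', if_neg (by rintro ⟨h3, -⟩; linarith)]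
      exact h2
    · rintro ⟨t, ht, h2⟩ z
      rw [coneSet, if_neg h.ne', if_neg (by rintro ⟨h3, -⟩; linarith), mem_ofPred_eq,
        inFutureCone_iff] at h2
      have h3 := h2 z
      simp only [eta_sub_left, eta_add_left, eta_smul_left] at h3
      have := coef_le_psi h ha hb (eta_point_nullVec_pos z X).le (eta_point_nullVec_pos z Y).le ht
      linarith

include ha hb hab in
/-- The light cone sum of two sets is the union of the sums of their points. -/
lemma mem_coneSum_iff (hn : 1 ≤ n) (hp0 : 0 < p) (K L : Set (Hyp n)) (W : Hyp n) :
    W ∈ coneSum p a b K L ↔ ∃ X ∈ K, ∃ Y ∈ L, W ∈ pointSum p a b X Y := by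
  unfold coneSum
  split_ifs with hp
  · simp only [mem_iUnion, mem_pointSum_iff ha hb hab hn hp, exists_prop]
  · push Not at hp
    simp only [mem_iUnion, pointSum_eq_iInter ha hb hab hp0 hp, exists_prop]

end PairOfPoints

/-- A set of points is cone convex if it contains all points in the causal past of chords. For
compact sets this is the same as being an intersection of closed horo-balls. -/
def ConeConvex {n : ℕ} (K : Set (Hyp n)) : Prop :=
  ∀ X ∈ K, ∀ Y ∈ K, ∀ s ∈ Icc (0 : ℝ) 1, ∀ V : Hyp n,
    InFutureCone ((1 - s) • X.1 + s • Y.1 - V.1) → V ∈ K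

/-! ### One pair of points for all ideal points -/

section Core

variable {n : ℕ} {p a b : ℝ}

lemma one_le_eta_comb (X Y : Hyp n) {s : ℝ} (hs : s ∈ Icc (0 : ℝ) 1) :
    1 ≤ eta ((1 - s) • X.1 + s • Y.1) ((1 - s) • X.1 + s • Y.1) := by
  rw [eta_comb_self]
  have h1 := one_le_eta X Y
  have h2 : 0 ≤ (1 - s) * s := mul_nonneg (sub_nonneg.2 hs.2) hs.1
  nlinarith

lemma inFutureCone_comb (X Y : Hyp n) {α β : ℝ} (hα : 0 ≤ α) (hβ : 0 ≤ β) :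
    InFutureCone (α • X.1 + β • Y.1) :=
  ((inFutureCone_point X).smul hα).add ((inFutureCone_point Y).smul hβ)

@[fun_prop]
lemma continuous_eta_point_nullVec {α : Type*} [TopologicalSpace α] {f : α → Hyp n} {g : α → Sph n}
    (hf : Continuous f) (hg : Continuous g) :
    Continuous fun x => eta (f x).1 (nullVec (g x)) := by fun_prop

lemma continuousAt_psi_eta (ha : 0 ≤ a) (hb : 0 ≤ b) (hab : 1 ≤ a + b) (q : (Hyp n × Hyp n) × Sph n) :
    ContinuousAt (fun q : (Hyp n × Hyp n) × Sph n =>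
      psi p a b (eta q.1.1.1 (nullVec q.2)) (eta q.1.2.1 (nullVec q.2))) q := by
  have hc : Continuous fun q : (Hyp n × Hyp n) × Sph n =>
      (eta q.1.1.1 (nullVec q.2), eta q.1.2.1 (nullVec q.2)) := by fun_prop
  exact ContinuousAt.comp (f := fun q : (Hyp n × Hyp n) × Sph n =>
      (eta q.1.1.1 (nullVec q.2), eta q.1.2.1 (nullVec q.2)))
    (g := fun x : ℝ × ℝ => psi p a b x.1 x.2)
    (continuousAt_psi ha hb hab (eta_point_nullVec_pos _ _) (eta_point_nullVec_pos _ _))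
    hc.continuousAt

lemma continuous_psi_eta (ha : 0 ≤ a) (hb : 0 ≤ b) (hab : 1 ≤ a + b) :
    Continuous (fun q : (Hyp n × Hyp n) × Sph n =>
      psi p a b (eta q.1.1.1 (nullVec q.2)) (eta q.1.2.1 (nullVec q.2))) :=
  continuous_iff_continuousAt.2 fun q => continuousAt_psi_eta ha hb hab q

lemma continuous_grad_eta (ha : 0 ≤ a) (hb : 0 ≤ b) (hab : 1 ≤ a + b) (c : ℝ)
    {f : (Hyp n × Hyp n) × Sph n → Hyp n} (hf : Continuous f) :
    Continuous (fun q : (Hyp n × Hyp n) × Sph n => grad p c (eta (f q).1 (nullVec q.2))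
      (psi p a b (eta q.1.1.1 (nullVec q.2)) (eta q.1.2.1 (nullVec q.2)))) := by
  have h1 := continuous_psi_eta (n := n) (p := p) ha hb hab
  have h2 : Continuous fun q : (Hyp n × Hyp n) × Sph n => eta (f q).1 (nullVec q.2) := by fun_prop
  have hpos : ∀ q : (Hyp n × Hyp n) × Sph n, 0 <
      psi p a b (eta q.1.1.1 (nullVec q.2)) (eta q.1.2.1 (nullVec q.2)) := fun q =>
    psi_pos ha hb hab (eta_point_nullVec_pos _ _) (eta_point_nullVec_pos _ _)
  unfold grad
  refine continuous_const.mul ((h2.div₀ h1 fun q => (hpos q).ne').rpow_const fun q => Or.inl ?_)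
  exact (div_pos (eta_point_nullVec_pos _ _) (hpos q)).ne'

/-- The component of a vector orthogonal to a given ideal point. -/
noncomputable def proj (w : Sph n) (V : Mink n) : EuclideanSpace ℝ (Fin (n + 1)) :=
  V.1 - (inner ℝ V.1 w.1 : ℝ) • w.1

@[simp] lemma proj_add (w : Sph n) (U V : Mink n) : proj w (U + V) = proj w U + proj w V := by
  simp only [proj, Prod.fst_add, inner_add_left, add_smul]; abel

@[simp] lemma proj_sub (w : Sph n) (U V : Mink n) : proj w (U - V) = proj w U - proj w V := by
  simp only [proj, Prod.fst_sub, inner_sub_left, sub_smul]; abel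

@[simp] lemma proj_smul (w : Sph n) (c : ℝ) (V : Mink n) : proj w (c • V) = c • proj w V := by
  simp only [proj, Prod.smul_fst, real_inner_smul_left, smul_sub, mul_smul]

@[simp] lemma proj_nullVec (w : Sph n) : proj w (nullVec w) = 0 := by
  simp [proj, nullVec]

@[fun_prop]
lemma continuous_proj (w : Sph n) : Continuous (proj w) := by
  unfold proj; fun_prop

lemma eq_smul_nullVec_of_proj {w : Sph n} {V : Mink n} (h : proj w V = 0)
    (h' : eta V (nullVec w) = 0) : V = V.2 • nullVec w := by
  rw [eta_nullVec_right] at h'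
  have h1 : V.1 = (inner ℝ V.1 w.1 : ℝ) • w.1 := sub_eq_zero.1 h
  rw [← sub_eq_zero.1 h'] at h1
  ext1
  · simpa [nullVec] using h1
  · simp [nullVec]

lemma inner_proj (w : Sph n) (m : EuclideanSpace ℝ (Fin (n + 1))) (V : Mink n) :
    (inner ℝ m (proj w V) : ℝ) = inner ℝ (m - (inner ℝ m w.1 : ℝ) • w.1) V.1 := by
  simp only [proj, inner_sub_right, inner_sub_left, real_inner_smul_right, real_inner_smul_left,
    real_inner_comm w.1 V.1]
  ring

/-- The part of a cone convex set on a horosphere is convex, up to the null direction. -/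
lemma ConeConvex.exists_proj_eq {K : Set (Hyp n)} (hK : ConeConvex K) {w : Sph n} {h : ℝ}
    {X Y : Hyp n} (hX : X ∈ K) (hY : Y ∈ K) (hXw : eta X.1 (nullVec w) = h)
    (hYw : eta Y.1 (nullVec w) = h) {s : ℝ} (hs : s ∈ Icc (0 : ℝ) 1) :
    ∃ Z ∈ K, eta Z.1 (nullVec w) = h ∧
      proj w Z.1 = (1 - s) • proj w X.1 + s • proj w Y.1 := by
  have hh : 0 < h := hXw ▸ eta_point_nullVec_pos w X
  have hM : eta ((1 - s) • X.1 + s • Y.1) (nullVec w) = h := by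
    simp only [eta_add_left, eta_smul_left, hXw, hYw]; ring
  -- Sliding the chord point along (w, 1) to the hyperboloid changes neither its height at w nor its
  -- projection. The vector from Z to the chord point is future directed because the chord point has
  -- norm at least 1.
  obtain ⟨Z, hZ⟩ := exists_point_eq_sub_smul (V := (1 - s) • X.1 + s • Y.1)
    (inFutureCone_nullVec w) (eta_nullVec_self w) (hM ▸ hh)
  refine ⟨Z, hK X hX Y hY s hs Z ?_, ?_, ?_⟩
  · rw [hZ, sub_sub_cancel]
    refine (inFutureCone_nullVec w).smul (div_nonneg ?_ ?_)
    · linarith [one_le_eta_comb X Y hs]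
    · rw [hM]; linarith
  · rw [hZ, eta_sub_left, hM, eta_smul_left, eta_nullVec_self]; ring
  · rw [hZ]; simp

/-- ψ is strictly increasing in a variable of positive weight. A pair attaining the maximum of ψ
therefore has maximal height in each set, unless that set has weight zero and its point is
irrelevant. -/
lemma eq_zero_or_eq_of_psi_eq (hp0 : 0 < p) (ha : 0 ≤ a) (hb : 0 ≤ b) {s r s₀ r₀ : ℝ} (hs : 0 ≤ s)
    (hr : 0 ≤ r) (h1 : s ≤ s₀) (h2 : r ≤ r₀) (h : psi p a b s₀ r₀ ≤ psi p a b s r) :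
    a = 0 ∨ s = s₀ := by
  by_contra hc
  push Not at hc
  have ha' : 0 < a := lt_of_le_of_ne ha (Ne.symm hc.1)
  have hlt : s < s₀ := lt_of_le_of_ne h1 hc.2
  have : psi p a b s r < psi p a b s₀ r₀ := by
    unfold psi
    refine Real.rpow_lt_rpow (by positivity) ?_ (by positivity)
    have := Real.rpow_lt_rpow hs hlt hp0
    have := Real.rpow_le_rpow hr h2 hp0.le
    nlinarith
  linarith

variable (hp₁ : 1 / 2 ≤ p) (hp₂ : p ≤ 2) (ha : 0 ≤ a) (hb : 0 ≤ b) (hab : 1 ≤ a + b)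

include hp₁ ha hb hab in
/-- Comparison of `psi` at two ideal points with a linear expression. -/
lemma exists_tangent {X Y W : Hyp n} {z w : Sph n}
    (hz : eta W.1 (nullVec z) ≤ psi p a b (eta X.1 (nullVec z)) (eta Y.1 (nullVec z)))
    (hw : psi p a b (eta X.1 (nullVec w)) (eta Y.1 (nullVec w)) ≤ eta W.1 (nullVec w)) :
    ∃ ζ : Sph n, (ζ = z ∨ ζ = w) ∧ ∀ α β : ℝ,
      α = grad p a (eta X.1 (nullVec ζ))
        (psi p a b (eta X.1 (nullVec ζ)) (eta Y.1 (nullVec ζ))) →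
      β = grad p b (eta Y.1 (nullVec ζ))
        (psi p a b (eta X.1 (nullVec ζ)) (eta Y.1 (nullVec ζ))) →
      0 ≤ eta (α • X.1 + β • Y.1 - W.1) (nullVec z) ∧
        eta (α • X.1 + β • Y.1 - W.1) (nullVec w) ≤ 0 := by
  have hp0 : 0 < p := by linarith
  have hs := eta_point_nullVec_pos z X
  have hr := eta_point_nullVec_pos z Y
  have hs' := eta_point_nullVec_pos w X
  have hr' := eta_point_nullVec_pos w Y
  -- The tangent plane is taken at w if ψ is concave, where it lies above ψ at z, and at z if ψ is
  -- convex, where it lies below ψ at w.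
  rcases le_total p 1 with hp | hp
  · refine ⟨w, Or.inr rfl, ?_⟩
    rintro α β rfl rfl
    simp only [eta_sub_left, eta_add_left, eta_smul_left]
    have h1 := psi_le_tangent hp0 hp ha hb hab hs' hr' hs.le hr.le
    have h2 := grad_euler hp0 ha hb hab hs' hr'
    constructor <;> linarith
  · refine ⟨z, Or.inl rfl, ?_⟩
    rintro α β rfl rfl
    simp only [eta_sub_left, eta_add_left, eta_smul_left]
    have h1 := tangent_le_psi hp ha hb hab hs hr hs'.le hr'.le
    have h2 := grad_euler hp0 ha hb hab hs hr
    constructor <;> linarith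

/-- The null direction obtained by tilting `w` in an orthogonal direction. -/
lemma exists_tilt (w : Sph n) (μ : EuclideanSpace ℝ (Fin (n + 1))) (hμ : inner ℝ μ w.1 = (0 : ℝ))
    (ε : ℝ) : ∃ z : Sph n, √(1 + ε ^ 2 * ‖μ‖ ^ 2) • z.1 = w.1 + ε • μ := by
  have hpos : 0 < 1 + ε ^ 2 * ‖μ‖ ^ 2 := by positivity
  have hn : ‖w.1 + ε • μ‖ = √(1 + ε ^ 2 * ‖μ‖ ^ 2) := by
    rw [eq_comm, Real.sqrt_eq_iff_mul_self_eq hpos.le (norm_nonneg _), ← sq,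
      @norm_add_sq_real, norm_sph, real_inner_smul_right, real_inner_comm, hμ, norm_smul,
      Real.norm_eq_abs, mul_pow, sq_abs]
    ring
  have hs : 0 < √(1 + ε ^ 2 * ‖μ‖ ^ 2) := Real.sqrt_pos.2 hpos
  refine ⟨⟨(√(1 + ε ^ 2 * ‖μ‖ ^ 2))⁻¹ • (w.1 + ε • μ), ?_⟩, ?_⟩
  · rw [mem_sphere_zero_iff_norm, norm_smul, hn, Real.norm_of_nonneg (by positivity),
      inv_mul_cancel₀ hs.ne']
  · rw [smul_smul, mul_inv_cancel₀ hs.ne', one_smul]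

include hp₁ ha hb hab in
/-- First order condition in a direction orthogonal to the touching direction. -/
lemma exists_first_order {K L : Set (Hyp n)} (hK : IsCompact K) (hL : IsCompact L) {W : Hyp n}
    {w : Sph n} (h₁ : ∀ z, ∃ X ∈ K, ∃ Y ∈ L,
      eta W.1 (nullVec z) ≤ psi p a b (eta X.1 (nullVec z)) (eta Y.1 (nullVec z)))
    (h₂ : ∀ X ∈ K, ∀ Y ∈ L,
      psi p a b (eta X.1 (nullVec w)) (eta Y.1 (nullVec w)) ≤ eta W.1 (nullVec w))
    (μ : EuclideanSpace ℝ (Fin (n + 1))) (hμ : inner ℝ μ w.1 = (0 : ℝ)) :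
    ∃ X ∈ K, ∃ Y ∈ L,
      psi p a b (eta X.1 (nullVec w)) (eta Y.1 (nullVec w)) = eta W.1 (nullVec w) ∧
      inner ℝ μ (grad p a (eta X.1 (nullVec w)) (eta W.1 (nullVec w)) • X.1 +
        grad p b (eta Y.1 (nullVec w)) (eta W.1 (nullVec w)) • Y.1 - W.1).1 ≤ (0 : ℝ) := by
  -- Ideal points tilted from w towards μ by ε_k → 0; the pairs that serve them subconverge to the
  -- required pair.
  set ε : ℕ → ℝ := fun k => 1 / ((k : ℝ) + 1) with hε
  have hε0 : ∀ k, 0 < ε k := fun k => by simp only [hε]; positivity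
  have hεlim : Filter.Tendsto ε Filter.atTop (𝓝 0) := tendsto_one_div_add_atTop_nhds_zero_nat
  choose z hz using fun k => exists_tilt w μ hμ (ε k)
  choose X hX Y hY hXY using fun k => h₁ (z k)
  choose ζ hζ hζ' using fun k => exists_tangent hp₁ ha hb hab (hXY k) (h₂ _ (hX k) _ (hY k))
  have hsq : Filter.Tendsto (fun k => √(1 + ε k ^ 2 * ‖μ‖ ^ 2)) Filter.atTop (𝓝 1) := by
    have hc : Continuous fun e : ℝ => √(1 + e ^ 2 * ‖μ‖ ^ 2) := by fun_prop
    have h := (hc.tendsto 0).comp hεlim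
    rw [show √(1 + (0 : ℝ) ^ 2 * ‖μ‖ ^ 2) = 1 by simp] at h
    exact h
  have hspos : ∀ k, 0 < √(1 + ε k ^ 2 * ‖μ‖ ^ 2) := fun k => Real.sqrt_pos.2 (by positivity)
  have hzlim : Filter.Tendsto z Filter.atTop (𝓝 w) := by
    rw [tendsto_subtype_rng]
    have h1 : ∀ k, (z k).1 = (√(1 + ε k ^ 2 * ‖μ‖ ^ 2))⁻¹ • (w.1 + ε k • μ) := fun k => by
      rw [← hz k, smul_smul, inv_mul_cancel₀ (hspos k).ne', one_smul]
    simp only [h1]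
    simpa using (hsq.inv₀ one_ne_zero).smul (tendsto_const_nhds.add (hεlim.smul_const μ))
  have hζlim : Filter.Tendsto ζ Filter.atTop (𝓝 w) := by
    rw [tendsto_iff_dist_tendsto_zero] at hzlim ⊢
    refine squeeze_zero (fun _ => dist_nonneg) (fun k => ?_) hzlim
    rcases hζ k with h | h <;> rw [h]
    rw [dist_self]; exact dist_nonneg
  obtain ⟨⟨X', Y'⟩, ⟨hX', hY'⟩, φ, hφ, hlim⟩ :=
    (hK.prod hL).tendsto_subseq (x := fun k => (X k, Y k)) fun k => ⟨hX k, hY k⟩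
  have hφ' := hφ.tendsto_atTop
  have hlimz : Filter.Tendsto (fun k => (((X (φ k), Y (φ k)), z (φ k)) : (Hyp n × Hyp n) × Sph n))
      Filter.atTop (𝓝 ((X', Y'), w)) := hlim.prodMk_nhds (hzlim.comp hφ')
  have hlimζ : Filter.Tendsto (fun k => (((X (φ k), Y (φ k)), ζ (φ k)) : (Hyp n × Hyp n) × Sph n))
      Filter.atTop (𝓝 ((X', Y'), w)) := hlim.prodMk_nhds (hζlim.comp hφ')
  have hpsi : psi p a b (eta X'.1 (nullVec w)) (eta Y'.1 (nullVec w)) = eta W.1 (nullVec w) := by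
    refine le_antisymm (h₂ _ hX' _ hY') ?_
    have hc1 := ((continuous_psi_eta (n := n) (p := p) ha hb hab).tendsto _).comp hlimz
    have hc2 : Filter.Tendsto (fun k => eta W.1 (nullVec (z (φ k)))) Filter.atTop
        (𝓝 (eta W.1 (nullVec w))) := by
      have : Continuous fun z : Sph n => eta W.1 (nullVec z) := by fun_prop
      exact (this.tendsto w).comp (hzlim.comp hφ')
    exact le_of_tendsto_of_tendsto' hc2 hc1 fun k => hXY (φ k)
  refine ⟨X', hX', Y', hY', hpsi, ?_⟩
  set G : (Hyp n × Hyp n) × Sph n → Mink n := fun q =>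
    grad p a (eta q.1.1.1 (nullVec q.2))
      (psi p a b (eta q.1.1.1 (nullVec q.2)) (eta q.1.2.1 (nullVec q.2))) • q.1.1.1 +
    grad p b (eta q.1.2.1 (nullVec q.2))
      (psi p a b (eta q.1.1.1 (nullVec q.2)) (eta q.1.2.1 (nullVec q.2))) • q.1.2.1 - W.1 with hG
  have hGc : Continuous G := by
    have g1 := continuous_grad_eta (n := n) (p := p) ha hb hab a (f := fun q => q.1.1)
      (by fun_prop)
    have g2 := continuous_grad_eta (n := n) (p := p) ha hb hab b (f := fun q => q.1.2)
      (by fun_prop)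
    exact ((g1.smul (by fun_prop)).add (g2.smul (by fun_prop))).sub continuous_const
  have hGlim : Filter.Tendsto (fun k => G ((X (φ k), Y (φ k)), ζ (φ k))) Filter.atTop
      (𝓝 (G ((X', Y'), w))) := (hGc.tendsto _).comp hlimζ
  have hGw : G ((X', Y'), w) = grad p a (eta X'.1 (nullVec w)) (eta W.1 (nullVec w)) • X'.1 +
        grad p b (eta Y'.1 (nullVec w)) (eta W.1 (nullVec w)) • Y'.1 - W.1 := by
    simp only [hG, hpsi]
  rw [← hGw]
  -- Let S = √(1 + e²|μ|²). Comparing S times the pairing with the tilted null vector to the pairing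
  -- with (w, 1) isolates e⟨v, μ⟩, up to (S - 1)v_{n+1}, which is of order e².
  have hineq : ∀ k, inner ℝ μ (G ((X (φ k), Y (φ k)), ζ (φ k))).1 ≤
      |(G ((X (φ k), Y (φ k)), ζ (φ k))).2| * (ε (φ k) * ‖μ‖ ^ 2) := fun k => by
    obtain ⟨h1, h2⟩ := hζ' (φ k) _ _ rfl rfl
    change 0 ≤ eta (G ((X (φ k), Y (φ k)), ζ (φ k))) _ at h1
    change eta (G ((X (φ k), Y (φ k)), ζ (φ k))) _ ≤ 0 at h2
    set V := G ((X (φ k), Y (φ k)), ζ (φ k))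
    set e := ε (φ k)
    have he : 0 < e := hε0 (φ k)
    have hS := hspos (φ k)
    have hzk := hz (φ k)
    set S := √(1 + e ^ 2 * ‖μ‖ ^ 2) with hSdef
    have hS2 : S ^ 2 = 1 + e ^ 2 * ‖μ‖ ^ 2 := Real.sq_sqrt (by positivity)
    rw [eta_nullVec_right] at h1 h2
    have h3 : 0 ≤ S * V.2 - (inner ℝ V.1 w.1 + e * inner ℝ V.1 μ) := by
      have := mul_nonneg hS.le h1
      rwa [mul_sub, ← real_inner_smul_right, hzk, inner_add_right, real_inner_smul_right] at this
    have hS1 : 1 ≤ S := by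
      rw [hSdef]; exact Real.one_le_sqrt.2 (by have := sq_nonneg (e * ‖μ‖); nlinarith)
    have hS3 : S - 1 ≤ e ^ 2 * ‖μ‖ ^ 2 := by nlinarith
    have h4 : (S - 1) * V.2 ≤ e ^ 2 * ‖μ‖ ^ 2 * |V.2| :=
      (mul_le_mul_of_nonneg_left (le_abs_self _) (by linarith)).trans
        (mul_le_mul_of_nonneg_right hS3 (abs_nonneg _))
    have h5 : e * inner ℝ V.1 μ ≤ e * (|V.2| * (e * ‖μ‖ ^ 2)) := by nlinarith
    rw [real_inner_comm]
    exact le_of_mul_le_mul_left h5 he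
  have hl : Filter.Tendsto (fun k => inner ℝ μ (G ((X (φ k), Y (φ k)), ζ (φ k))).1) Filter.atTop
      (𝓝 (inner ℝ μ (G ((X', Y'), w)).1 : ℝ)) := by
    have : Continuous fun V : Mink n => (inner ℝ μ V.1 : ℝ) := by fun_prop
    exact (this.tendsto _).comp hGlim
  have hr : Filter.Tendsto (fun k => |(G ((X (φ k), Y (φ k)), ζ (φ k))).2| * (ε (φ k) * ‖μ‖ ^ 2))
      Filter.atTop (𝓝 0) := by
    have h1 : Filter.Tendsto (fun k => |(G ((X (φ k), Y (φ k)), ζ (φ k))).2|) Filter.atTop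
        (𝓝 |(G ((X', Y'), w)).2|) := by
      have : Continuous fun V : Mink n => |V.2| := by fun_prop
      exact (this.tendsto _).comp hGlim
    simpa using h1.mul ((hεlim.comp hφ').mul_const (‖μ‖ ^ 2))
  exact le_of_tendsto_of_tendsto' hl hr hineq

include hp₁ hp₂ ha hb hab in
/-- If the support function of the sum touches that of a point, then the point lies in the sum of
two points. -/
lemma exists_mem_pointSum_of_touching {K L : Set (Hyp n)} (hK : IsCompact K) (hL : IsCompact L)
    (hK' : ConeConvex K) (hL' : ConeConvex L) {W : Hyp n}
    {w : Sph n} (h₁ : ∀ z, ∃ X ∈ K, ∃ Y ∈ L,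
      eta W.1 (nullVec z) ≤ psi p a b (eta X.1 (nullVec z)) (eta Y.1 (nullVec z)))
    (h₂ : ∀ X ∈ K, ∀ Y ∈ L,
      psi p a b (eta X.1 (nullVec w)) (eta Y.1 (nullVec w)) ≤ eta W.1 (nullVec w)) :
    ∃ X ∈ K, ∃ Y ∈ L, W ∈ pointSum p a b X Y := by
  have hp0 : 0 < p := by linarith
  obtain ⟨X₁, hX₁, Y₁, hY₁, h11⟩ := h₁ w
  have hcw : Continuous fun X : Hyp n => eta X.1 (nullVec w) := by fun_prop
  obtain ⟨X₀, hX₀, hXmax⟩ := hK.exists_isMaxOn ⟨X₁, hX₁⟩ hcw.continuousOn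
  obtain ⟨Y₀, hY₀, hYmax⟩ := hL.exists_isMaxOn ⟨Y₁, hY₁⟩ hcw.continuousOn
  have hXmax' : ∀ X ∈ K, eta X.1 (nullVec w) ≤ eta X₀.1 (nullVec w) := fun X hX => hXmax hX
  have hYmax' : ∀ Y ∈ L, eta Y.1 (nullVec w) ≤ eta Y₀.1 (nullVec w) := fun X hX => hYmax hX
  have hs := eta_point_nullVec_pos w X₀
  have hr := eta_point_nullVec_pos w Y₀
  have hψ : psi p a b (eta X₀.1 (nullVec w)) (eta Y₀.1 (nullVec w)) = eta W.1 (nullVec w) :=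
    le_antisymm (h₂ _ hX₀ _ hY₀) (h11.trans (psi_mono hp0 ha hb
      (eta_point_nullVec_pos w X₁).le (eta_point_nullVec_pos w Y₁).le (hXmax' _ hX₁)
      (hYmax' _ hY₁)))
  have heul := grad_euler hp0 ha hb hab hs hr
  rw [hψ] at heul
  set ψ := eta W.1 (nullVec w) with hψdef
  set α := grad p a (eta X₀.1 (nullVec w)) ψ with hα
  set β := grad p b (eta Y₀.1 (nullVec w)) ψ with hβ
  -- The faces of K and L on their supporting horospheres at w. Modulo the null direction they are
  -- convex, so the projected vectors αX + βY - W form a compact convex set, and the aim is to show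
  -- that it contains 0.
  set FK := K ∩ {X : Hyp n | eta X.1 (nullVec w) = eta X₀.1 (nullVec w)} with hFK
  set FL := L ∩ {X : Hyp n | eta X.1 (nullVec w) = eta Y₀.1 (nullVec w)} with hFL
  have hFKc : IsCompact FK := hK.inter_right (isClosed_eq hcw continuous_const)
  have hFLc : IsCompact FL := hL.inter_right (isClosed_eq hcw continuous_const)
  set g : Hyp n × Hyp n → EuclideanSpace ℝ (Fin (n + 1)) :=
    fun q => proj w (α • q.1.1 + β • q.2.1 - W.1) with hg
  have hgc : Continuous g := by
    simp only [hg]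
    exact (continuous_proj w).comp (by fun_prop)
  have hAc : IsCompact (g '' (FK ×ˢ FL)) := (hFKc.prod hFLc).image hgc
  have hconv : Convex ℝ (g '' (FK ×ˢ FL)) := by
    rintro _ ⟨⟨X, Y⟩, ⟨hX, hY⟩, rfl⟩ _ ⟨⟨X', Y'⟩, ⟨hX', hY'⟩, rfl⟩ c d hc hd hcd
    obtain rfl : c = 1 - d := by linarith
    obtain ⟨Z, hZ, hZw, hZp⟩ := hK'.exists_proj_eq hX.1 hX'.1 hX.2 hX'.2
      (s := d) ⟨hd, by linarith⟩
    obtain ⟨Z', hZ', hZw', hZp'⟩ := hL'.exists_proj_eq hY.1 hY'.1 hY.2 hY'.2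
      (s := d) ⟨hd, by linarith⟩
    refine ⟨(Z, Z'), ⟨⟨hZ, hZw⟩, hZ', hZw'⟩, ?_⟩
    simp only [hg, proj_sub, proj_add, proj_smul, hZp, hZp']
    module
  have h0 : (0 : EuclideanSpace ℝ (Fin (n + 1))) ∈ g '' (FK ×ˢ FL) := by
    by_contra hnot
    -- The normal of a separating hyperplane, made orthogonal to w, contradicts the first order
    -- condition, once the pair given by that condition is replaced by points of the faces with the
    -- same gradient terms.
    obtain ⟨f, u, hu0, hu⟩ := geometric_hahn_banach_point_closed hconv hAc.isClosed hnot
    rw [map_zero] at hu0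
    set m := (InnerProductSpace.toDual ℝ (EuclideanSpace ℝ (Fin (n + 1)))).symm f with hm
    have hfm : ∀ v, f v = inner ℝ m v := fun v => by
      rw [hm, InnerProductSpace.toDual_symm_apply]
    obtain ⟨X, hX, Y, hY, hXY, hle⟩ := exists_first_order hp₁ ha hb hab hK hL h₁ h₂
      (m - (inner ℝ m w.1 : ℝ) • w.1) (by
        rw [inner_sub_left, real_inner_smul_left, real_inner_self_eq_norm_sq, norm_sph]; ring)
    rw [← inner_proj] at hle
    have hX0 := eta_point_nullVec_pos w X
    have hY0 := eta_point_nullVec_pos w Y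
    obtain ⟨X', hX', hXX'⟩ : ∃ X' ∈ FK, grad p a (eta X.1 (nullVec w)) ψ • X.1 = α • X'.1 := by
      rcases eq_zero_or_eq_of_psi_eq hp0 ha hb hX0.le hY0.le (hXmax' _ hX) (hYmax' _ hY)
        (hψ.trans hXY.symm).le with h | h
      · exact ⟨X₀, ⟨hX₀, rfl⟩, by simp [hα, grad, h]⟩
      · exact ⟨X, ⟨hX, h⟩, by rw [hα, h]⟩
    obtain ⟨Y', hY', hYY'⟩ : ∃ Y' ∈ FL, grad p b (eta Y.1 (nullVec w)) ψ • Y.1 = β • Y'.1 := by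
      rcases eq_zero_or_eq_of_psi_eq hp0 hb ha hY0.le hX0.le (hYmax' _ hY) (hXmax' _ hX)
        (by rw [psi_swap p b, psi_swap p b]; exact (hψ.trans hXY.symm).le) with h | h
      · exact ⟨Y₀, ⟨hY₀, rfl⟩, by simp [hβ, grad, h]⟩
      · exact ⟨Y, ⟨hY, h⟩, by rw [hβ, h]⟩
    rw [hXX', hYY'] at hle
    have := hu _ ⟨(X', Y'), ⟨hX', hY'⟩, rfl⟩
    rw [hfm] at this
    simp only [hg] at this
    linarith
  obtain ⟨⟨X, Y⟩, ⟨hX, hY⟩, hXY⟩ := h0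
  have hXw : eta X.1 (nullVec w) = eta X₀.1 (nullVec w) := hX.2
  have hYw : eta Y.1 (nullVec w) = eta Y₀.1 (nullVec w) := hY.2
  refine ⟨X, hX.1, Y, hY.1, ?_⟩
  have hV := eq_smul_nullVec_of_proj hXY (by
    simp only [eta_sub_left, eta_add_left, eta_smul_left, hXw, hYw]; linarith)
  refine mem_pointSum_of_touching hp₁ hp₂ ha hb hab (w := w) (ψ := ψ)
    (k := (α • X.1 + β • Y.1 - W.1).2) (by rw [hXw, hYw, hψ]) ?_
  rw [hXw, hYw, ← hα, ← hβ]
  exact sub_eq_iff_eq_add'.1 hV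

/-- The part of a set in a closed ball. -/
def cap (K : Set (Hyp n)) (X₀ : Hyp n) (c : ℝ) : Set (Hyp n) := {X | X ∈ K ∧ eta X.1 X₀.1 ≤ c}

lemma cap_mono (K : Set (Hyp n)) (X₀ : Hyp n) {c d : ℝ} (h : c ≤ d) : cap K X₀ c ⊆ cap K X₀ d :=
  fun _ hX => ⟨hX.1, hX.2.trans h⟩

lemma isCompact_cap {K : Set (Hyp n)} (hK : IsCompact K) (X₀ : Hyp n) (c : ℝ) :
    IsCompact (cap K X₀ c) :=
  hK.inter_right (isClosed_le (f := fun X : Hyp n => eta X.1 X₀.1) (by fun_prop) continuous_const)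

/-- Pairing with X₀ is affine on chords and monotone for the causal order, so a ball is itself cone
convex. -/
lemma ConeConvex.cap {K : Set (Hyp n)} (hK : ConeConvex K) (X₀ : Hyp n) (c : ℝ) :
    ConeConvex (cap K X₀ c) := by
  intro X hX Y hY s hs V hV
  refine ⟨hK X hX.1 Y hY.1 s hs V hV, ?_⟩
  have h1 := hV.eta_nonneg (inFutureCone_point X₀)
  simp only [eta_sub_left, eta_add_left, eta_smul_left] at h1
  have h2 := mul_le_mul_of_nonneg_left hX.2 (sub_nonneg.2 hs.2)
  have h3 := mul_le_mul_of_nonneg_left hY.2 hs.1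
  linarith

/-- The geodesic between two points, as the radial projection of the chord. -/
lemma exists_geodesic (X Y : Hyp n) : ∃ γ : Icc (0 : ℝ) 1 → Hyp n, Continuous γ ∧ γ 0 = X ∧ γ 1 = Y ∧
    ∀ s : Icc (0 : ℝ) 1, ∃ R : ℝ, 1 ≤ R ∧ R ^ 2 = 1 + 2 * (s * (1 - s)) * (eta X.1 Y.1 - 1) ∧
      (1 - s.1) • X.1 + s.1 • Y.1 = R • (γ s).1 := by
  set V : Icc (0 : ℝ) 1 → Mink n := fun s => (1 - s.1) • X.1 + s.1 • Y.1 with hV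
  have hVc : Continuous V := by simp only [hV]; fun_prop
  have h1 : ∀ s, 1 ≤ eta (V s) (V s) := fun s => one_le_eta_comb X Y s.2
  have hcone : ∀ s, InFutureCone (V s) := fun s =>
    inFutureCone_comb X Y (sub_nonneg.2 s.2.2) s.2.1
  have hpos : ∀ s, 0 < √(eta (V s) (V s)) := fun s => Real.sqrt_pos.2 (by linarith [h1 s])
  have hsq : ∀ s, √(eta (V s) (V s)) ^ 2 = eta (V s) (V s) := fun s =>
    Real.sq_sqrt (by linarith [h1 s])
  set γ : Icc (0 : ℝ) 1 → Hyp n := fun s => ⟨(√(eta (V s) (V s)))⁻¹ • V s, mem_hyp_of_eta (by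
      rw [eta_smul_left, eta_smul_right]
      nth_rewrite 3 [← hsq s]
      have := hpos s
      field_simp) (hcone s) (by
      rw [eta_smul_left]; have := hpos s; have := h1 s; positivity)⟩ with hγ
  have hγV : ∀ s, V s = √(eta (V s) (V s)) • (γ s).1 := fun s => by
    simp only [hγ, smul_smul, mul_inv_cancel₀ (hpos s).ne', one_smul]
  have hval : ∀ (s : Icc (0 : ℝ) 1) (Z : Hyp n), V s = Z.1 → γ s = Z := fun s Z h => by
    apply Subtype.ext
    have h2 := hγV s
    rwa [h, eta_point_self, Real.sqrt_one, one_smul, eq_comm] at h2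
  refine ⟨γ, ?_, hval 0 X (by simp [hV]), hval 1 Y (by simp [hV]), fun s =>
    ⟨√(eta (V s) (V s)), Real.one_le_sqrt.2 (h1 s), ?_, hγV s⟩⟩
  · refine Continuous.subtype_mk (Continuous.smul (Continuous.inv₀ ?_ fun s => (hpos s).ne') hVc) _
    exact Real.continuous_sqrt.comp (continuous_eta hVc hVc)
  · rw [hsq, hV, eta_comb_self]; ring

/-- Points of a cone convex set can be approximated by points in smaller balls. -/
lemma ConeConvex.exists_mem_cap {K : Set (Hyp n)} (hK : ConeConvex K) {X₀ X : Hyp n}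
    (hX₀ : X₀ ∈ K) {c : ℝ} (hc : 1 < c) (hX : X ∈ HypSum.cap K X₀ c) {O : Set (Hyp n)}
    (hO : O ∈ 𝓝 X) : ∃ c' : ℝ, 1 ≤ c' ∧ c' < c ∧ ∃ X' ∈ HypSum.cap K X₀ c', X' ∈ O := by
  obtain ⟨γ, hγ, h0, h1, hR⟩ := exists_geodesic X₀ X
  -- Points on the geodesic from X₀ that approach X. Their pairing with X₀ is at most 1 - τ + τc,
  -- which is less than c since c > 1 and τ < 1.
  set τ : ℕ → Icc (0 : ℝ) 1 := fun k => ⟨1 - 1 / ((k : ℝ) + 1), by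
    have : 1 / ((k : ℝ) + 1) ≤ 1 := by rw [div_le_one (by positivity)]; simp
    have : 0 < 1 / ((k : ℝ) + 1) := by positivity
    constructor <;> linarith⟩ with hτ
  have hlim : Filter.Tendsto τ Filter.atTop (𝓝 1) := by
    rw [tendsto_subtype_rng]
    have := (tendsto_const_nhds (x := (1 : ℝ))).sub (tendsto_one_div_add_atTop_nhds_zero_nat (𝕜 := ℝ))
    simpa [hτ] using this
  have hev := ((hγ.tendsto 1).comp hlim).eventually (h1.symm ▸ hO)
  obtain ⟨k, hk⟩ := hev.exists
  have hτ1 : (τ k).1 < 1 := by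
    have : 0 < 1 / ((k : ℝ) + 1) := by positivity
    simp only [hτ]; linarith
  have hτ0 := (τ k).2.1
  obtain ⟨R, hR1, -, hRV⟩ := hR (τ k)
  have hle : 1 - (τ k).1 + (τ k).1 * c < c := by nlinarith
  refine ⟨1 - (τ k).1 + (τ k).1 * c, by nlinarith, hle, γ (τ k), ⟨?_, ?_⟩, hk⟩
  · refine hK X₀ hX₀ X hX.1 _ (τ k).2 _ ?_
    rw [hRV, show R • (γ (τ k)).1 - (γ (τ k)).1 = (R - 1) • (γ (τ k)).1 by rw [sub_smul, one_smul]]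
    exact (inFutureCone_point _).smul (by linarith)
  · have h2 : R * eta (γ (τ k)).1 X₀.1 = 1 - (τ k).1 + (τ k).1 * eta X.1 X₀.1 := by
      rw [← eta_smul_left, ← hRV]
      simp [eta_point_self]
    have h3 := one_le_eta (γ (τ k)) X₀
    have h4 := mul_le_mul_of_nonneg_left hX.2 hτ0
    nlinarith

lemma continuous_psi_eta_nullVec (ha : 0 ≤ a) (hb : 0 ≤ b) (hab : 1 ≤ a + b) (z : Sph n) :
    Continuous fun q : Hyp n × Hyp n =>
      psi p a b (eta q.1.1 (nullVec z)) (eta q.2.1 (nullVec z)) :=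
  (continuous_psi_eta (n := n) (p := p) ha hb hab).comp
    (f := fun q : Hyp n × Hyp n => (q, z)) (by fun_prop)

/-- The point `W` is below the support function of the sum of the two caps of radius `c` at `z`. -/
def CapBound (p a b : ℝ) (K L : Set (Hyp n)) (X₀ Y₀ W : Hyp n) (c : ℝ) (z : Sph n) : Prop :=
  ∃ X ∈ cap K X₀ c, ∃ Y ∈ cap L Y₀ c,
    eta W.1 (nullVec z) ≤ psi p a b (eta X.1 (nullVec z)) (eta Y.1 (nullVec z))

lemma CapBound.mono {K L : Set (Hyp n)} {X₀ Y₀ W : Hyp n} {c d : ℝ} {z : Sph n}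
    (h : CapBound p a b K L X₀ Y₀ W c z) (hcd : c ≤ d) : CapBound p a b K L X₀ Y₀ W d z :=
  let ⟨X, hX, Y, hY, hle⟩ := h
  ⟨X, cap_mono K X₀ hcd hX, Y, cap_mono L Y₀ hcd hY, hle⟩

include ha hb hab in
/-- The bounds at all ideal points pass to the infimum of the radii. -/
lemma exists_min_capBound {K L : Set (Hyp n)} (hK : IsCompact K) (hL : IsCompact L)
    {X₀ Y₀ W : Hyp n} (h : ∀ z, ∃ X ∈ K, ∃ Y ∈ L,
      eta W.1 (nullVec z) ≤ psi p a b (eta X.1 (nullVec z)) (eta Y.1 (nullVec z))) :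
    ∃ c, 1 ≤ c ∧ (∀ z, CapBound p a b K L X₀ Y₀ W c z) ∧
      ∀ d, 1 ≤ d → (∀ z, CapBound p a b K L X₀ Y₀ W d z) → c ≤ d := by
  let S : Set ℝ := {c | 1 ≤ c ∧ ∀ z, CapBound p a b K L X₀ Y₀ W c z}
  have hc1 : Continuous fun X : Hyp n => eta X.1 X₀.1 := by fun_prop
  have hc2 : Continuous fun X : Hyp n => eta X.1 Y₀.1 := by fun_prop
  have hSne : S.Nonempty := by
    obtain ⟨c₁, hc₁⟩ := (hK.image hc1).bddAbove
    obtain ⟨c₂, hc₂⟩ := (hL.image hc2).bddAbove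
    refine ⟨max 1 (max c₁ c₂), le_max_left _ _, fun z => ?_⟩
    obtain ⟨X, hX, Y, hY, hle⟩ := h z
    refine ⟨X, ⟨hX, (hc₁ (mem_image_of_mem _ hX)).trans ?_⟩, Y,
      ⟨hY, (hc₂ (mem_image_of_mem _ hY)).trans ?_⟩, hle⟩
    · exact (le_max_left _ _).trans (le_max_right _ _)
    · exact (le_max_right _ _).trans (le_max_right _ _)
  have hSb : BddBelow S := ⟨1, fun c hc => hc.1⟩
  refine ⟨sInf S, le_csInf hSne fun d hd => hd.1, fun z => ?_, fun d h1 h2 => csInf_le hSb ⟨h1, h2⟩⟩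
  -- For fixed z the least radius that works is a minimum over the compact set of admissible pairs,
  -- so it is attained and does not exceed the infimum.
  have hA : IsCompact ((K ×ˢ L) ∩ {q : Hyp n × Hyp n | eta W.1 (nullVec z) ≤
      psi p a b (eta q.1.1 (nullVec z)) (eta q.2.1 (nullVec z))}) :=
    (hK.prod hL).inter_right
      (isClosed_le continuous_const (continuous_psi_eta_nullVec ha hb hab z))
  obtain ⟨X, hX, Y, hY, hle⟩ := h z
  have hmc : Continuous fun q : Hyp n × Hyp n => max (eta q.1.1 X₀.1) (eta q.2.1 Y₀.1) :=
    (hc1.comp continuous_fst).max (hc2.comp continuous_snd)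
  obtain ⟨⟨X', Y'⟩, ⟨⟨hX', hY'⟩, hle'⟩, hmin⟩ :=
    hA.exists_isMinOn ⟨(X, Y), ⟨hX, hY⟩, hle⟩ hmc.continuousOn
  have hm : max (eta X'.1 X₀.1) (eta Y'.1 Y₀.1) ≤ sInf S := by
    refine le_csInf hSne fun d hd => ?_
    obtain ⟨X₂, hX₂, Y₂, hY₂, hle₂⟩ := hd.2 z
    have := isMinOn_iff.1 hmin (X₂, Y₂) ⟨⟨hX₂.1, hY₂.1⟩, hle₂⟩
    exact this.trans (max_le hX₂.2 hY₂.2)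
  exact ⟨X', ⟨hX', (le_max_left _ _).trans hm⟩, Y', ⟨hY', (le_max_right _ _).trans hm⟩, hle'⟩

include ha hb hab in
-- A strict inequality is stable under small changes of z, X and Y, and X and Y can be approximated
-- from strictly smaller caps.
lemma exists_capBound_nhds {K L : Set (Hyp n)} (hK' : ConeConvex K) (hL' : ConeConvex L)
    {X₀ Y₀ W X Y : Hyp n} (hX₀ : X₀ ∈ K) (hY₀ : Y₀ ∈ L) {c : ℝ} (hc : 1 < c) {z : Sph n}
    (hX : X ∈ cap K X₀ c) (hY : Y ∈ cap L Y₀ c) (hlt : eta W.1 (nullVec z) <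
      psi p a b (eta X.1 (nullVec z)) (eta Y.1 (nullVec z))) :
    ∃ U ∈ 𝓝 z, ∃ d, 1 ≤ d ∧ d < c ∧ ∀ z' ∈ U, CapBound p a b K L X₀ Y₀ W d z' := by
  have hopen : IsOpen {q : (Hyp n × Hyp n) × Sph n | eta W.1 (nullVec q.2) <
      psi p a b (eta q.1.1.1 (nullVec q.2)) (eta q.1.2.1 (nullVec q.2))} :=
    isOpen_lt (by fun_prop) (continuous_psi_eta ha hb hab)
  have hnhds := hopen.mem_nhds (x := ((X, Y), z)) hlt
  rw [nhds_prod_eq, Filter.mem_prod_iff] at hnhds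
  obtain ⟨O, hO, U, hU, hsub⟩ := hnhds
  rw [nhds_prod_eq, Filter.mem_prod_iff] at hO
  obtain ⟨O₁, hO₁, O₂, hO₂, hsub'⟩ := hO
  obtain ⟨d, h1, h2, X', hX', hXO⟩ := hK'.exists_mem_cap hX₀ hc hX hO₁
  obtain ⟨d', h1', h2', Y', hY', hYO⟩ := hL'.exists_mem_cap hY₀ hc hY hO₂
  refine ⟨U, hU, max d d', le_max_of_le_left h1, max_lt h2 h2',
    fun z' hz' => ⟨X', cap_mono _ _ (le_max_left _ _) hX', Y',
      cap_mono _ _ (le_max_right _ _) hY', ?_⟩⟩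
  have : ((X', Y'), z') ∈ {q : (Hyp n × Hyp n) × Sph n | eta W.1 (nullVec q.2) <
      psi p a b (eta q.1.1.1 (nullVec q.2)) (eta q.1.2.1 (nullVec q.2))} :=
    hsub ⟨hsub' ⟨hXO, hYO⟩, hz'⟩
  exact le_of_lt this

include hp₁ hp₂ ha hb hab in
/-- A point below the support function of the sum lies in the sum of two points. -/
theorem exists_mem_pointSum {K L : Set (Hyp n)} (hK : IsCompact K) (hL : IsCompact L)
    (hK' : ConeConvex K) (hL' : ConeConvex L) {W : Hyp n} (h : ∀ z, ∃ X ∈ K, ∃ Y ∈ L,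
      eta W.1 (nullVec z) ≤ psi p a b (eta X.1 (nullVec z)) (eta Y.1 (nullVec z))) :
    ∃ X ∈ K, ∃ Y ∈ L, W ∈ pointSum p a b X Y := by
  obtain ⟨X₀, hX₀, Y₀, hY₀, -⟩ := h (Classical.arbitrary _)
  obtain ⟨c, hc1, hGood, hmin⟩ := exists_min_capBound (X₀ := X₀) (Y₀ := Y₀) ha hb hab hK hL h
  -- For c = 1 both caps are single points, and these serve all ideal points.
  rcases hc1.eq_or_lt with hc1' | hc1'
  · refine ⟨X₀, hX₀, Y₀, hY₀, fun z => ?_⟩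
    obtain ⟨X, hX, Y, hY, hle⟩ := hGood z
    have e1 : X = X₀ := eq_of_eta_eq_one (le_antisymm (hc1'.symm ▸ hX.2) (one_le_eta _ _))
    have e2 : Y = Y₀ := eq_of_eta_eq_one (le_antisymm (hc1'.symm ▸ hY.2) (one_le_eta _ _))
    rwa [e1, e2] at hle
  -- Otherwise the bound would be strict at every ideal point, and compactness of the sphere would
  -- allow a smaller radius, against the minimality of c.
  have htouch : ∃ w, ∀ X ∈ cap K X₀ c, ∀ Y ∈ cap L Y₀ c,
      psi p a b (eta X.1 (nullVec w)) (eta Y.1 (nullVec w)) ≤ eta W.1 (nullVec w) := by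
    by_contra hcon
    push Not at hcon
    have hloc : ∃ d, 1 ≤ d ∧ d < c ∧
        ∀ z ∈ (univ : Set (Sph n)), CapBound p a b K L X₀ Y₀ W d z := by
      refine isCompact_univ.induction_on
        (p := fun s : Set (Sph n) => ∃ d, 1 ≤ d ∧ d < c ∧
          ∀ z ∈ s, CapBound p a b K L X₀ Y₀ W d z) ?_ ?_ ?_ ?_
      · exact ⟨1, le_refl _, hc1', fun z hz => hz.elim⟩
      · rintro s t hst ⟨d, h1, h2, h3⟩
        exact ⟨d, h1, h2, fun z hz => h3 z (hst hz)⟩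
      · rintro s t ⟨d, h1, h2, h3⟩ ⟨d', h1', h2', h3'⟩
        refine ⟨max d d', le_max_of_le_left h1, max_lt h2 h2', ?_⟩
        rintro z (hz | hz)
        · exact (h3 z hz).mono (le_max_left _ _)
        · exact (h3' z hz).mono (le_max_right _ _)
      · intro z _
        obtain ⟨X, hX, Y, hY, hlt⟩ := hcon z
        obtain ⟨U, hU, hd⟩ := exists_capBound_nhds ha hb hab hK' hL' hX₀ hY₀ hc1' hX hY hlt
        exact ⟨U, mem_nhdsWithin_of_mem_nhds hU, hd⟩
    obtain ⟨d, h1, h2, h3⟩ := hloc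
    exact absurd (hmin d h1 fun z => h3 z (mem_univ z)) (not_le.2 h2)
  obtain ⟨w, hw⟩ := htouch
  obtain ⟨X, hX, Y, hY, hW⟩ := exists_mem_pointSum_of_touching hp₁ hp₂ ha hb hab
    (isCompact_cap hK X₀ c) (isCompact_cap hL Y₀ c) (hK'.cap X₀ c) (hL'.cap Y₀ c) hGood hw
  exact ⟨X, hX.1, Y, hY.1, hW⟩

end Core

/-! ### Support functions and identification of the p-sum -/

section Support

variable {n : ℕ} {p a b : ℝ}

lemma continuous_eta_nullVec (z : Sph n) : Continuous fun X : Hyp n => eta X.1 (nullVec z) := by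
  fun_prop

lemma IsCompact.exists_supp_eq {K : Set (Hyp n)} (hK : IsCompact K) (hne : K.Nonempty) (z : Sph n) :
    ∃ X ∈ K, (∀ Y ∈ K, eta Y.1 (nullVec z) ≤ eta X.1 (nullVec z)) ∧
      supp K z = Real.log (eta X.1 (nullVec z)) := by
  obtain ⟨X, hX, hmax⟩ := hK.exists_isMaxOn hne (continuous_eta_nullVec z).continuousOn
  have hmax' : ∀ Y ∈ K, eta Y.1 (nullVec z) ≤ eta X.1 (nullVec z) := fun Y hY => hmax hY
  refine ⟨X, hX, hmax', IsGreatest.csSup_eq ⟨⟨X, hX, by simp only [neg_lor]⟩, ?_⟩⟩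
  rintro _ ⟨Y, hY, rfl⟩
  simp only [neg_lor]
  exact Real.log_le_log (eta_point_nullVec_pos z Y) (hmax' Y hY)

lemma log_psi (ha : 0 ≤ a) (hb : 0 ≤ b) (hab : 1 ≤ a + b) {s r : ℝ} (hs : 0 < s)
    (hr : 0 < r) : 1 / p * Real.log (a * Real.exp (p * Real.log s) + b * Real.exp (p * Real.log r))
      = Real.log (psi p a b s r) := by
  have := psi_arg_pos (p := p) ha hb hab hs hr
  rw [psi, Real.log_rpow this, Real.rpow_def_of_pos hs, Real.rpow_def_of_pos hr, mul_comm p,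
    mul_comm p]

lemma mem_closedHoroball_iff {X : Hyp n} {z : Sph n} {r : ℝ} :
    X ∈ closedHoroball z r ↔ Real.log (eta X.1 (nullVec z)) ≤ r := by
  simp only [closedHoroball, neg_lor, mem_ofPred_eq]

lemma isClosed_hyp : IsClosed {X : Mink n | lor X X = -1 ∧ 0 < X.2} := by
  have : {X : Mink n | lor X X = -1 ∧ 0 < X.2} = {X : Mink n | eta X X = 1 ∧ 0 ≤ X.2} := by
    ext X
    simp only [mem_ofPred_eq, lor_eq, neg_inj]
    refine and_congr_right fun h => ⟨le_of_lt, fun h2 => lt_of_le_of_ne h2 fun h3 => ?_⟩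
    rw [eta_self, ← h3] at h
    nlinarith [norm_nonneg X.1]
  rw [this]
  exact (isClosed_eq (by fun_prop) continuous_const).inter
    (isClosed_le continuous_const continuous_snd)

lemma isCompact_snd_le (M : ℝ) : IsCompact {X : Hyp n | X.1.2 ≤ M} := by
  have h := (isClosed_hyp (n := n)).isClosedEmbedding_subtypeVal.isCompact_preimage
    (isCompact_closedBall (0 : Mink n) M)
  refine h.of_isClosed_subset (isClosed_le (by fun_prop) continuous_const) fun X hX => ?_
  simp only [mem_preimage, mem_closedBall_zero_iff, Prod.norm_def]
  have h1 := norm_lt_snd X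
  have h2 := X.2.2
  have h3 : X.1.2 ≤ M := hX
  rw [Real.norm_of_nonneg h2.le]
  exact max_le (by linarith) h3

/-- The heights at z and -z add up to 2w_{n+1}, so two opposite ideal points already bound the set.
-/
lemma isCompact_iInter_le (φ : Sph n → ℝ) :
    IsCompact {W : Hyp n | ∀ z, eta W.1 (nullVec z) ≤ φ z} := by
  obtain ⟨z⟩ : Nonempty (Sph n) := inferInstance
  refine (isCompact_snd_le ((φ z + φ (-z)) / 2)).of_isClosed_subset ?_ fun W hW => ?_
  · rw [show {W : Hyp n | ∀ z, eta W.1 (nullVec z) ≤ φ z} =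
      ⋂ z, {W : Hyp n | eta W.1 (nullVec z) ≤ φ z} by ext; simp]
    exact isClosed_iInter fun z => isClosed_le (continuous_eta_nullVec z) continuous_const
  · have h1 := hW z
    have h2 := hW (-z)
    rw [eta_nullVec_right] at h1 h2
    have h3 : ((-z : Sph n) : EuclideanSpace ℝ (Fin (n + 1))) = -z.1 := rfl
    rw [h3, inner_neg_right] at h2
    simp only [mem_ofPred_eq]
    linarith

/-- A set with the given support function which is an intersection of horo-balls is the set of all
points below the support function. -/
lemma IsHConvex.eq_of_supp {Ω : Set (Hyp n)} (h : IsHConvex Ω) :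
    Ω = {W : Hyp n | ∀ z, Real.log (eta W.1 (nullVec z)) ≤ supp Ω z} := by
  obtain ⟨hne, hc, S, hS⟩ := h
  refine Subset.antisymm (fun W hW z => ?_) fun W hW => ?_
  · obtain ⟨X, -, hmax, hsupp⟩ := IsCompact.exists_supp_eq hc hne z
    rw [hsupp]
    exact Real.log_le_log (eta_point_nullVec_pos z W) (hmax W hW)
  · have hW' : ∀ z, Real.log (eta W.1 (nullVec z)) ≤ supp Ω z := hW
    rw [hS]
    simp only [mem_iInter]
    rintro ⟨z, r⟩ hzr
    obtain ⟨X, hX, -, hsupp⟩ := IsCompact.exists_supp_eq hc hne z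
    rw [mem_closedHoroball_iff]
    refine (hW' z).trans (hsupp ▸ ?_)
    rw [hS] at hX
    exact mem_closedHoroball_iff.1 (mem_iInter₂.1 hX (z, r) hzr)

variable (hn : 1 ≤ n) (hp₁ : 1 / 2 ≤ p) (hp₂ : p ≤ 2) (ha : 0 ≤ a) (hb : 0 ≤ b) (hab : 1 ≤ a + b)

include hn hp₁ hp₂ ha hb hab in
/-- The light cone sum is the hyperbolic `p`-sum. -/
theorem isHypPSum_iff {K L : Set (Hyp n)} (hK : IsCompact K) (hL : IsCompact L)
    (hKne : K.Nonempty) (hLne : L.Nonempty) (hK' : ConeConvex K) (hL' : ConeConvex L)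
    (Ω : Set (Hyp n)) : IsHypPSum p a b K L Ω ↔ Ω = coneSum p a b K L := by
  have hp0 : 0 < p := by linarith
  choose X hX hXmax hXsupp using fun z => IsCompact.exists_supp_eq hK hKne z
  choose Y hY hYmax hYsupp using fun z => IsCompact.exists_supp_eq hL hLne z
  set φ : Sph n → ℝ := fun z => psi p a b (eta (X z).1 (nullVec z)) (eta (Y z).1 (nullVec z))
    with hφ
  have hφpos : ∀ z, 0 < φ z := fun z => psi_pos ha hb hab (eta_point_nullVec_pos z _)
    (eta_point_nullVec_pos z _)
  have hlog : ∀ z, 1 / p * Real.log (a * Real.exp (p * supp K z) + b * Real.exp (p * supp L z)) =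
      Real.log (φ z) := fun z => by
    rw [hXsupp, hYsupp, log_psi ha hb hab (eta_point_nullVec_pos z _)
      (eta_point_nullVec_pos z _)]
  have hle : ∀ z, ∀ X' ∈ K, ∀ Y' ∈ L,
      psi p a b (eta X'.1 (nullVec z)) (eta Y'.1 (nullVec z)) ≤ φ z := fun z X' hX' Y' hY' =>
    psi_mono hp0 ha hb (eta_point_nullVec_pos z _).le (eta_point_nullVec_pos z _).le
      (hXmax z X' hX') (hYmax z Y' hY')
  have hS : coneSum p a b K L = {W : Hyp n | ∀ z, eta W.1 (nullVec z) ≤ φ z} := by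
    ext W
    rw [mem_coneSum_iff ha hb hab hn hp0]
    constructor
    · rintro ⟨X', hX', Y', hY', hW⟩ z
      exact (hW z).trans (hle z X' hX' Y' hY')
    · intro hW
      exact exists_mem_pointSum hp₁ hp₂ ha hb hab hK hL hK' hL' fun z =>
        ⟨X z, hX z, Y z, hY z, hW z⟩
  -- The gradient combination of points of K and L of maximal height at z, slid along (z, 1) to the
  -- hyperboloid, is in first order contact at z, hence in the sum. Its height is ψ of the maximal
  -- heights by Euler's identity.
  have hatt : ∀ z, ∃ W ∈ coneSum p a b K L, eta W.1 (nullVec z) = φ z := by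
    intro z
    have heul := grad_euler hp0 ha hb hab (eta_point_nullVec_pos z (X z))
      (eta_point_nullVec_pos z (Y z))
    set V := grad p a (eta (X z).1 (nullVec z)) (φ z) • (X z).1 +
      grad p b (eta (Y z).1 (nullVec z)) (φ z) • (Y z).1 with hV
    have hVz : eta V (nullVec z) = φ z := by
      simp only [hV, eta_add_left, eta_smul_left]; exact heul
    obtain ⟨W, hW⟩ := exists_point_eq_sub_smul (inFutureCone_nullVec z) (eta_nullVec_self z)
      (hVz.symm ▸ hφpos z)
    refine ⟨W, (mem_coneSum_iff ha hb hab hn hp0 _ _ _).2 ⟨X z, hX z, Y z, hY z,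
      mem_pointSum_of_touching hp₁ hp₂ ha hb hab (ψ := φ z) rfl (sub_eq_iff_eq_add.1 hW.symm)⟩, ?_⟩
    rw [hW, eta_sub_left, eta_smul_left, eta_nullVec_self, hVz]; ring
  have hset : {W : Hyp n | ∀ z, eta W.1 (nullVec z) ≤ φ z} =
      {W : Hyp n | ∀ z, Real.log (eta W.1 (nullVec z)) ≤ Real.log (φ z)} := by
    ext W
    exact forall_congr' fun z =>
      (Real.log_le_log_iff (eta_point_nullVec_pos z W) (hφpos z)).symm
  constructor
  · rintro ⟨hconv, hsupp⟩
    rw [hconv.eq_of_supp, hS, hset]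
    simp only [hsupp, hlog]
  · rintro rfl
    have hcomp : IsCompact (coneSum p a b K L) := hS ▸ isCompact_iInter_le φ
    have hne : (coneSum p a b K L).Nonempty :=
      let ⟨W, hW, _⟩ := hatt (Classical.arbitrary _)
      ⟨W, hW⟩
    refine ⟨⟨hne, hcomp, {q | q.2 = Real.log (φ q.1)}, ?_⟩, fun z => ?_⟩
    · rw [hS, hset]
      ext W
      simp only [mem_iInter, mem_closedHoroball_iff, mem_ofPred_eq, Prod.forall]
      exact ⟨fun h z r hr => hr ▸ h z, fun h z => h z _ rfl⟩
    · obtain ⟨W, hW, hWmax, hWsupp⟩ := IsCompact.exists_supp_eq hcomp hne z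
      obtain ⟨W', hW', hWz⟩ := hatt z
      rw [hWsupp, hlog]
      congr 1
      refine le_antisymm ?_ (hWz ▸ hWmax W' hW')
      rw [hS] at hW
      exact hW z

end Support

/-! ### Geodesic balls as cone conditions -/

section Balls

variable {n : ℕ}

lemma cosh_hdist (X Y : Hyp n) : Real.cosh (hdist X Y) = eta X.1 Y.1 := by
  rw [hdist, neg_lor, Real.cosh_arcosh (one_le_eta X Y)]

lemma hdist_nonneg (X Y : Hyp n) : 0 ≤ hdist X Y := by
  rw [hdist, neg_lor]; exact Real.arcosh_nonneg (one_le_eta X Y)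

lemma hdist_comm (X Y : Hyp n) : hdist X Y = hdist Y X := by
  rw [hdist, hdist, neg_lor, neg_lor, eta_comm]

lemma sinh_hdist_nonneg (X Y : Hyp n) : 0 ≤ Real.sinh (hdist X Y) :=
  Real.sinh_nonneg_iff.2 (hdist_nonneg X Y)

lemma sinh_hdist_sq (X Y : Hyp n) : Real.sinh (hdist X Y) ^ 2 = eta X.1 Y.1 ^ 2 - 1 := by
  rw [Real.sinh_sq, cosh_hdist]

lemma radiusR_eq (α β : ℝ) (X Y : Hyp n) :
    radiusR α X β Y = √(eta (α • X.1 + β • Y.1) (α • X.1 + β • Y.1)) := by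
  rw [radiusR, cosh_hdist, eta_comb_self]

/-- Both conditions single out the radial projection of αX + βY. The hyperbolic cosines of the
distances to X and Y determine the sines, and the addition theorems express that P lies on the
segment; conversely the conditions on P force its pairing with the projection to be 1. -/
lemma isCenterP_iff {α β : ℝ} (hα : 0 ≤ α) (hβ : 0 ≤ β) {X Y P : Hyp n}
    (hR : 0 < radiusR α X β Y) :
    IsCenterP α X β Y P ↔ α • X.1 + β • Y.1 = radiusR α X β Y • P.1 := by
  have hV := inFutureCone_comb X Y hα hβ
  have hVV : 0 < eta (α • X.1 + β • Y.1) (α • X.1 + β • Y.1) := by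
    rw [radiusR_eq] at hR; exact Real.sqrt_pos.1 hR
  have hR2 : radiusR α X β Y ^ 2 = α ^ 2 + β ^ 2 + 2 * α * β * eta X.1 Y.1 := by
    rw [radiusR_eq, Real.sq_sqrt hVV.le, eta_comb_self]
  have hsd := sinh_hdist_sq X Y
  have hs0 := sinh_hdist_nonneg X Y
  have sinh_eq : ∀ (Z P : Hyp n) (γ δ : ℝ), 0 ≤ γ →
      eta P.1 Z.1 = (δ + γ * eta X.1 Y.1) / radiusR α X β Y →
      radiusR α X β Y ^ 2 = δ ^ 2 + γ ^ 2 + 2 * δ * γ * eta X.1 Y.1 →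
      Real.sinh (hdist P Z) = γ * Real.sinh (hdist X Y) / radiusR α X β Y := by
    intro Z P γ δ hγ h1 h2
    rw [← sq_eq_sq₀ (sinh_hdist_nonneg P Z) (by positivity), sinh_hdist_sq, h1, div_pow, div_pow,
      mul_pow, hsd, div_sub_one (by positivity), h2]
    congr 1; ring
  obtain ⟨Q, hQ⟩ := exists_point_eq_smul hV hVV
  rw [← radiusR_eq] at hQ
  constructor
  · rintro ⟨hseg, hcosh⟩
    rw [cosh_hdist, cosh_hdist] at hcosh
    have hs1 := sinh_eq X P β α hβ hcosh hR2
    have hPY : eta P.1 Y.1 = (α * eta X.1 Y.1 + β) / radiusR α X β Y := by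
      have h1 : hdist P Y = hdist X Y - hdist P X := by
        have : hdist X P + hdist P Y = hdist X Y := hseg
        rw [hdist_comm X P] at this; linarith
      rw [← cosh_hdist, h1, Real.cosh_sub, hs1, cosh_hdist, cosh_hdist, hcosh]
      have : Real.sinh (hdist X Y) * (β * Real.sinh (hdist X Y) / radiusR α X β Y) =
        β * Real.sinh (hdist X Y) ^ 2 / radiusR α X β Y := by ring
      rw [this, hsd]
      field_simp; ring
    have h2 : eta P.1 (radiusR α X β Y • Q.1) = radiusR α X β Y := by
      rw [← hQ, eta_add_right, eta_smul_right, eta_smul_right, hcosh, hPY]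
      field_simp
      rw [hR2]; ring
    rw [eta_smul_right] at h2
    have h3 : eta P.1 Q.1 = 1 := by
      have := hR.ne'
      field_simp at h2
      exact h2
    rw [eq_of_eta_eq_one h3]
    exact hQ
  · intro hP
    have hPX : eta P.1 X.1 = (α + β * eta X.1 Y.1) / radiusR α X β Y := by
      rw [eq_div_iff hR.ne', mul_comm, ← eta_smul_left, ← hP]
      simp [eta_point_self, eta_comm Y.1 X.1]
    have hPY : eta P.1 Y.1 = (β + α * eta X.1 Y.1) / radiusR α X β Y := by
      rw [eq_div_iff hR.ne', mul_comm, ← eta_smul_left, ← hP]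
      simp [eta_point_self]; ring
    refine ⟨?_, by rw [cosh_hdist, cosh_hdist, hPX]⟩
    have hs1 := sinh_eq X P β α hβ hPX hR2
    have hs2 := sinh_eq Y P α β hα hPY (by rw [hR2]; ring)
    change hdist X P + hdist P Y = hdist X Y
    have h0 : 0 ≤ hdist X P + hdist P Y := add_nonneg (hdist_nonneg _ _) (hdist_nonneg _ _)
    refine Real.cosh_strictMonoOn.injOn h0 (hdist_nonneg X Y) ?_
    rw [Real.cosh_add, hdist_comm X P, hs1, hs2, cosh_hdist, cosh_hdist, cosh_hdist, hPX, hPY]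
    have : β * Real.sinh (hdist X Y) / radiusR α X β Y * (α * Real.sinh (hdist X Y) /
        radiusR α X β Y) = α * β * Real.sinh (hdist X Y) ^ 2 / radiusR α X β Y ^ 2 := by ring
    rw [this, hsd, div_mul_div_comm, ← sq, ← add_div, div_eq_iff (by positivity), hR2]
    ring

/-- The geodesic ball associated with a pair of points is given by a light cone condition. -/
lemma mem_pairBall_iff {α β : ℝ} (hα : 0 ≤ α) (hβ : 0 ≤ β) (X Y W : Hyp n) :
    W ∈ pairBall α X β Y ↔ InFutureCone (α • X.1 + β • Y.1 - W.1) := by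
  have hV := inFutureCone_comb X Y hα hβ
  rw [inFutureCone_sub_iff hV, pairBall, mem_ofPred_eq,
    ← Real.one_le_sqrt (x := eta (α • X.1 + β • Y.1) (α • X.1 + β • Y.1)), ← radiusR_eq]
  refine and_congr_right fun hR => ?_
  have hR0 : 0 < radiusR α X β Y := by linarith
  have hVV : 0 < eta (α • X.1 + β • Y.1) (α • X.1 + β • Y.1) := by
    rw [radiusR_eq] at hR0; exact Real.sqrt_pos.1 hR0
  have hR2 : radiusR α X β Y ^ 2 = eta (α • X.1 + β • Y.1) (α • X.1 + β • Y.1) := by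
    rw [radiusR_eq, Real.sq_sqrt hVV.le]
  have hball : ∀ P : Hyp n, α • X.1 + β • Y.1 = radiusR α X β Y • P.1 →
      (W ∈ closedGeodBall P (Real.log (radiusR α X β Y)) ↔ 2 * eta (α • X.1 + β • Y.1) W.1 ≤
        eta (α • X.1 + β • Y.1) (α • X.1 + β • Y.1) + 1) := by
    intro P hP
    rw [← hR2]
    change hdist W P ≤ _ ↔ _
    -- For V = RP the cone condition 2R cosh d(W, P) ≤ R² + 1 is cosh d(W, P) ≤ (R + 1/R)/2 =
    -- cosh(log R).
    rw [← abs_of_nonneg (hdist_nonneg W P), ← abs_of_nonneg (Real.log_nonneg hR),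
      ← Real.cosh_le_cosh, cosh_hdist, Real.cosh_log hR0, hP, eta_smul_left, eta_comm W.1 P.1,
      le_div_iff₀ two_pos]
    constructor
    · intro h
      have := mul_le_mul_of_nonneg_left h hR0.le
      rw [mul_add, mul_inv_cancel₀ hR0.ne'] at this
      linarith
    · intro h
      refine le_of_mul_le_mul_left ?_ hR0
      rw [mul_add, mul_inv_cancel₀ hR0.ne']
      linarith
  constructor
  · rintro ⟨P, hP, hW⟩
    exact (hball P ((isCenterP_iff hα hβ hR0).1 hP)).1 hW
  · intro h
    obtain ⟨Q, hQ⟩ := exists_point_eq_smul hV hVV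
    rw [← radiusR_eq] at hQ
    exact ⟨Q, (isCenterP_iff hα hβ hR0).2 hQ, (hball Q hQ).2 h⟩

/-- The two descriptions of the pointwise sum agree. -/
theorem ballSum_eq_coneSum {p a b : ℝ} (ha : 0 ≤ a) (hb : 0 ≤ b) (K L : Set (Hyp n)) :
    ballSum p a b K L = coneSum p a b K L := by
  have key : ∀ (X Y : Hyp n) (t : ℝ), t ∈ Icc (0 : ℝ) 1 → p ≠ 1 →
      ballPT p t a X b Y = coneSet p t a X b Y := by
    intro X Y t ht hp
    unfold ballPT coneSet
    rw [if_neg hp]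
    split_ifs
    · rfl
    · ext W
      exact mem_pairBall_iff (coef_nonneg (sub_nonneg.2 ht.2) ha) (coef_nonneg ht.1 hb) X Y W
  unfold ballSum coneSum
  rcases lt_trichotomy p 1 with h | h | h
  · rw [if_neg (not_lt.2 h.le), if_neg h.ne, if_neg (not_le.2 h)]
    exact iUnion₂_congr fun X _ => iUnion₂_congr fun Y _ => iInter₂_congr fun t ht =>
      key X Y t ht h.ne
  · subst h
    rw [if_neg (lt_irrefl _), if_pos rfl, if_pos le_rfl]
    refine iUnion₂_congr fun X _ => iUnion₂_congr fun Y _ => ?_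
    ext W
    simp only [coneSet, if_true, mem_iUnion, exists_prop, mem_ofPred_eq]
    rw [mem_pairBall_iff ha hb]
    exact ⟨fun h => ⟨0, ⟨le_rfl, zero_le_one⟩, h⟩, fun ⟨_, _, h⟩ => h⟩
  · rw [if_pos h, if_pos h.le]
    exact iUnion₂_congr fun X _ => iUnion₂_congr fun Y _ => iUnion₂_congr fun t ht =>
      key X Y t ht h.ne'

end Balls

/-! ### Invariance under isometries -/

section Isometries

variable {n : ℕ}

lemma coneConvex_singleton (X : Hyp n) : ConeConvex {X} := by
  rintro _ rfl _ rfl s hs V hV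
  rw [← add_smul, sub_add_cancel, one_smul, inFutureCone_sub_iff (inFutureCone_point _),
    eta_point_self] at hV
  exact (eq_of_eta_eq_one (le_antisymm (by linarith [hV.2]) (one_le_eta _ _))).symm

/-- Points converge if their distances converge to zero. -/
lemma tendsto_of_tendsto_eta {ι : Type*} {l : Filter ι} {f : ι → Hyp n} {X : Hyp n}
    (h : Filter.Tendsto (fun i => eta (f i).1 X.1) l (𝓝 1)) : Filter.Tendsto f l (𝓝 X) := by
  rw [tendsto_subtype_rng, tendsto_iff_norm_sub_tendsto_zero]
  have hX2 := X.2.2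
  have hb : ∀ Y : Hyp n, ‖Y.1 - X.1‖ ≤ (eta Y.1 X.1 - 1) * ‖X.1‖ +
      X.1.2 * √((eta Y.1 X.1) ^ 2 - 1) := by
    intro Y
    set e := eta Y.1 X.1 with he
    have he1 : 1 ≤ e := one_le_eta Y X
    -- D is tangent at X, with ⟨D, D⟩ = e² - 1, and the norm of a vector tangent at X is at most
    -- x_{n+1} times its Lorentzian length.
    set D := Y.1 - e • X.1 with hD
    have hDX : eta D X.1 = 0 := by simp [hD, eta_point_self, he]
    have hDD : eta D D = 1 - e ^ 2 := by
      simp only [hD, eta_sub_left, eta_sub_right, eta_smul_left, eta_smul_right, eta_point_self,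
        eta_comm X.1 Y.1, ← he]
      ring
    have hXX := eta_point_self X
    rw [eta_self] at hDD hXX
    have h1 := abs_real_inner_le_norm D.1 X.1.1
    have h2 : D.2 * X.1.2 = inner ℝ D.1 X.1.1 := by unfold eta at hDX; linarith
    rw [← h2] at h1
    have h3 : (D.2 * X.1.2) ^ 2 ≤ (‖D.1‖ * ‖X.1.1‖) ^ 2 := by
      rw [← sq_abs (D.2 * X.1.2)]; exact pow_le_pow_left₀ (abs_nonneg _) h1 2
    have h4 : ‖D.1‖ ^ 2 ≤ X.1.2 ^ 2 * (e ^ 2 - 1) := by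
      have : X.1.2 ^ 2 * (e ^ 2 - 1) = X.1.2 ^ 2 * ‖D.1‖ ^ 2 - (D.2 * X.1.2) ^ 2 := by
        rw [mul_pow]; linear_combination X.1.2 ^ 2 * hDD
      have h5 : X.1.2 ^ 2 = 1 + ‖X.1.1‖ ^ 2 := by linarith
      rw [this, h5]
      nlinarith
    have h5 : D.2 ^ 2 ≤ ‖D.1‖ ^ 2 := by nlinarith
    have hr : 0 ≤ X.1.2 * √(e ^ 2 - 1) := by positivity
    have hsq : (X.1.2 * √(e ^ 2 - 1)) ^ 2 = X.1.2 ^ 2 * (e ^ 2 - 1) := by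
      rw [mul_pow, Real.sq_sqrt (by nlinarith)]
    have hDn : ‖D‖ ≤ X.1.2 * √(e ^ 2 - 1) := by
      rw [Prod.norm_def]
      refine max_le (abs_le_of_sq_le_sq' (by linarith) hr).2 ?_
      rw [Real.norm_eq_abs]
      exact abs_le_of_sq_le_sq (by linarith) hr
    have : Y.1 - X.1 = (e - 1) • X.1 + D := by rw [hD, sub_smul, one_smul]; abel
    rw [this]
    refine (norm_add_le _ _).trans (add_le_add ?_ hDn)
    rw [norm_smul, Real.norm_of_nonneg (by linarith)]
  refine squeeze_zero (fun i => norm_nonneg _) (fun i => hb (f i)) ?_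
  have hc : Continuous fun e : ℝ => (e - 1) * ‖X.1‖ + X.1.2 * √(e ^ 2 - 1) := by fun_prop
  have := (hc.tendsto 1).comp h
  simpa [Function.comp_def] using this

variable {φ : Hyp n ≃ Hyp n} (hφ : ∀ X Y, hdist (φ X) (φ Y) = hdist X Y)

include hφ

lemma eta_isometry (X Y : Hyp n) : eta (φ X).1 (φ Y).1 = eta X.1 Y.1 := by
  rw [← cosh_hdist, hφ, cosh_hdist]

lemma continuous_isometry : Continuous φ := by
  rw [continuous_iff_continuousAt]
  intro X
  refine tendsto_of_tendsto_eta ?_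
  simp only [eta_isometry hφ]
  have hc : Continuous fun Y : Hyp n => eta Y.1 X.1 := by fun_prop
  simpa [eta_point_self] using hc.tendsto X

/-- By `inFutureCone_sub_iff` the condition involves only mutual pairings of the points, so no
linear extension of the isometry is required. -/
lemma inFutureCone_isometry_iff {α β : ℝ} (hα : 0 ≤ α) (hβ : 0 ≤ β) (X Y W : Hyp n) :
    InFutureCone (α • (φ X).1 + β • (φ Y).1 - (φ W).1) ↔
      InFutureCone (α • X.1 + β • Y.1 - W.1) := by
  rw [inFutureCone_sub_iff (inFutureCone_comb _ _ hα hβ),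
    inFutureCone_sub_iff (inFutureCone_comb _ _ hα hβ), eta_comb_self, eta_comb_self]
  simp only [eta_add_left, eta_smul_left, eta_isometry hφ]

lemma ConeConvex.image {K : Set (Hyp n)} (hK : ConeConvex K) : ConeConvex (φ '' K) := by
  rintro _ ⟨X, hX, rfl⟩ _ ⟨Y, hY, rfl⟩ s hs V hV
  obtain ⟨W, rfl⟩ := φ.surjective V
  exact mem_image_of_mem _ (hK X hX Y hY s hs W
    ((inFutureCone_isometry_iff hφ (sub_nonneg.2 hs.2) hs.1 X Y W).1 hV))

lemma mem_coneSet_isometry_iff {p t a b : ℝ} (ha : 0 ≤ a) (hb : 0 ≤ b) (ht : t ∈ Icc (0 : ℝ) 1)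
    (X Y W : Hyp n) : φ W ∈ coneSet p t a (φ X) b (φ Y) ↔ W ∈ coneSet p t a X b Y := by
  unfold coneSet
  split_ifs
  · exact inFutureCone_isometry_iff hφ ha hb X Y W
  · simp
  · exact inFutureCone_isometry_iff hφ (coef_nonneg (sub_nonneg.2 ht.2) ha)
      (coef_nonneg ht.1 hb) X Y W

theorem coneSum_image {p a b : ℝ} (ha : 0 ≤ a) (hb : 0 ≤ b) (K L : Set (Hyp n)) :
    coneSum p a b (φ '' K) (φ '' L) = φ '' coneSum p a b K L := by
  ext V
  obtain ⟨W, rfl⟩ := φ.surjective V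
  rw [φ.injective.mem_set_image]
  unfold coneSum
  split_ifs
  · simp only [mem_iUnion, exists_prop, exists_mem_image]
    refine exists_congr fun X => and_congr_right fun _ => exists_congr fun Y =>
      and_congr_right fun _ => exists_congr fun t => and_congr_right fun ht =>
      mem_coneSet_isometry_iff hφ ha hb ht X Y W
  · simp only [mem_iUnion, mem_iInter, exists_prop, exists_mem_image]
    refine exists_congr fun X => and_congr_right fun _ => exists_congr fun Y =>
      and_congr_right fun _ => forall_congr' fun t => forall_congr' fun ht =>
      mem_coneSet_isometry_iff hφ ha hb ht X Y W

end Isometries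

/-! ### A mountain pass principle -/

section MountainPass

variable {E : Type*} [NormedAddCommGroup E] [NormedSpace ℝ E]

/-- Near `x`, moving in the direction `e` leads from `K` to the interior of `K`. -/
def PushesInto (K : Set E) (x e : E) : Prop :=
  ∃ ε > 0, ∀ y ∈ K ∩ Metric.ball x ε, ∀ s : ℝ, 0 < s → y + s • e ∈ Metric.ball x ε →
    y + s • e ∈ interior K

/-- Near `x`, the function `G` increases in the direction `e`. -/
def RisesAlong (G : E → ℝ) (x e : E) : Prop :=
  ∃ ε > 0, ∀ y ∈ Metric.ball x ε, ∀ s : ℝ, 0 < s → y + s • e ∈ Metric.ball x ε →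
    G y < G (y + s • e)

/-- Translation by s₁e carries all points of K near x into one ball inside K, along segments that
stay in U ∩ K. Local connectedness statements at x reduce to the convexity of that ball. -/
lemma PushesInto.exists_cylinder {K : Set E} {x e : E} (h : PushesInto K x e) (hx : x ∈ K)
    {U : Set E} (hU : U ∈ 𝓝 x) :
    ∃ s₁ : ℝ, 0 < s₁ ∧ x + s₁ • e ∈ interior K ∧ x + s₁ • e ∈ U ∧ ∀ O ∈ 𝓝 (x + s₁ • e),
      ∃ V ∈ 𝓝 x, ∃ ρ > 0, Metric.ball (x + s₁ • e) ρ ⊆ O ∩ (U ∩ K) ∧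
        ∀ y ∈ V, y + s₁ • e ∈ Metric.ball (x + s₁ • e) ρ ∧
          (y ∈ K → ∀ s ∈ Icc (0 : ℝ) s₁, y + s • e ∈ U ∩ K) := by
  obtain ⟨ε₀, hε₀, hpush⟩ := h
  obtain ⟨ε₁, hε₁, hball⟩ := Metric.mem_nhds_iff.1 hU
  set ε := min ε₀ ε₁ with hε
  have hε0 : 0 < ε := lt_min hε₀ hε₁
  have hεU : Metric.ball x ε ⊆ U := (Metric.ball_subset_ball (min_le_right _ _)).trans hball
  have hε' : Metric.ball x ε ⊆ Metric.ball x ε₀ := Metric.ball_subset_ball (min_le_left _ _)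
  set s₁ := ε / 2 / (‖e‖ + 1) with hs₁
  have hs₁0 : 0 < s₁ := by positivity
  have hs₁e : s₁ * ‖e‖ < ε / 2 := by
    rw [hs₁, div_mul_eq_mul_div, div_lt_iff₀ (by positivity)]
    nlinarith [norm_nonneg e]
  have hx₁ : x + s₁ • e ∈ Metric.ball x ε := by
    rw [mem_ball_iff_norm, add_sub_cancel_left, norm_smul, Real.norm_of_nonneg hs₁0.le]
    linarith
  have hx₁K : x + s₁ • e ∈ interior K :=
    hpush x ⟨hx, Metric.mem_ball_self hε₀⟩ s₁ hs₁0 (hε' hx₁)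
  refine ⟨s₁, hs₁0, hx₁K, hεU hx₁, fun O hO => ?_⟩
  have hn : O ∩ (Metric.ball x ε ∩ interior K) ∈ 𝓝 (x + s₁ • e) :=
    Filter.inter_mem hO (Filter.inter_mem (Metric.isOpen_ball.mem_nhds hx₁)
      (isOpen_interior.mem_nhds hx₁K))
  obtain ⟨ρ₀, hρ₀, hρ⟩ := Metric.mem_nhds_iff.1 hn
  set ρ := min ρ₀ (ε / 2)
  have hρpos : 0 < ρ := lt_min hρ₀ (by linarith)
  refine ⟨Metric.ball x ρ, Metric.ball_mem_nhds x hρpos, ρ, hρpos, ?_, fun y hy => ⟨?_, ?_⟩⟩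
  · intro y hy
    obtain ⟨h1, h2, h3⟩ := hρ (Metric.ball_subset_ball (min_le_left _ _) hy)
    exact ⟨h1, hεU h2, interior_subset h3⟩
  · rw [mem_ball_iff_norm] at hy ⊢
    rwa [add_sub_add_right_eq_sub]
  · intro hyK s hs
    have hyρ : ‖y - x‖ < ε / 2 := (mem_ball_iff_norm.1 hy).trans_le (min_le_right _ _)
    have hyε : y ∈ Metric.ball x ε := by rw [mem_ball_iff_norm]; linarith
    have hys : y + s • e ∈ Metric.ball x ε := by
      rw [mem_ball_iff_norm, add_sub_right_comm]
      refine (norm_add_le _ _).trans_lt ?_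
      rw [norm_smul, Real.norm_of_nonneg hs.1]
      have := mul_le_mul_of_nonneg_right hs.2 (norm_nonneg e)
      linarith
    refine ⟨hεU hys, ?_⟩
    rcases hs.1.eq_or_lt with h0 | h0
    · rwa [← h0, zero_smul, add_zero]
    · exact interior_subset (hpush y ⟨hyK, hε' hyε⟩ s h0 (hε' hys))

lemma joinedIn_line {S : Set E} {y e : E} {s₁ : ℝ} (hs₁ : 0 ≤ s₁)
    (h : ∀ s ∈ Icc (0 : ℝ) s₁, y + s • e ∈ S) : JoinedIn S y (y + s₁ • e) := by
  refine JoinedIn.of_segment_subset ?_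
  rw [segment_eq_image']
  rintro _ ⟨θ, hθ, rfl⟩
  simp only [add_sub_cancel_left, smul_smul]
  exact h _ ⟨mul_nonneg hθ.1 hs₁, mul_le_of_le_one_left hs₁ hθ.2⟩

lemma joinedIn_ball {S : Set E} {x y z : E} {ρ : ℝ} (h : Metric.ball x ρ ⊆ S)
    (hy : y ∈ Metric.ball x ρ) (hz : z ∈ Metric.ball x ρ) : JoinedIn S y z :=
  JoinedIn.of_segment_subset (((convex_ball x ρ).segment_subset hy hz).trans h)

lemma PushesInto.exists_joinedIn {K : Set E} {x e : E} (h : PushesInto K x e) (hx : x ∈ K)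
    {U : Set E} (hU : U ∈ 𝓝 x) : ∃ V ∈ 𝓝 x, ∀ y ∈ V ∩ K, JoinedIn (U ∩ K) x y := by
  obtain ⟨s₁, hs₁, -, -, hO⟩ := h.exists_cylinder hx hU
  obtain ⟨V, hV, ρ, hρ, hball, hy⟩ := hO univ Filter.univ_mem
  have hb : Metric.ball (x + s₁ • e) ρ ⊆ U ∩ K := hball.trans inter_subset_right
  have hxV := hy x (mem_of_mem_nhds hV)
  refine ⟨V, hV, fun y hyV => ?_⟩
  have hyV' := hy y hyV.1
  exact ((joinedIn_line hs₁.le (hxV.2 hx)).trans (joinedIn_ball hb hxV.1 hyV'.1)).trans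
    (joinedIn_line hs₁.le (hyV'.2 hyV.2)).symm

lemma PushesInto.exists_joinedIn_interior {K : Set E} {x e : E} (h : PushesInto K x e)
    (hx : x ∈ K) : ∃ y ∈ interior K, JoinedIn K x y := by
  obtain ⟨s₁, hs₁, hint, -, hO⟩ := h.exists_cylinder hx Filter.univ_mem
  obtain ⟨V, hV, ρ, hρ, hball, hy⟩ := hO univ Filter.univ_mem
  exact ⟨_, hint, joinedIn_line hs₁.le fun s hs =>
    ((hy x (mem_of_mem_nhds hV)).2 hx s hs).2⟩

/-- The direction e leads into K and upwards at once, so points of the superlevel set near x can be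
joined by rising first, and points on the level of x are limits of higher ones. -/
lemma PushesInto.exists_superlevel {K : Set E} {x e : E} {G : E → ℝ} (hG : Continuous G)
    (h : PushesInto K x e) (hr : RisesAlong G x e) (hx : x ∈ K) :
    ∃ V ∈ 𝓝 x, (∀ y ∈ V ∩ (K ∩ {y | G x < G y}), ∀ y' ∈ V ∩ (K ∩ {y | G x < G y}),
      JoinedIn (K ∩ {y | G x < G y}) y y') ∧
      ∀ y ∈ V ∩ (K ∩ {y | G x ≤ G y}), y ∈ closure (K ∩ {y | G x < G y}) := by
  obtain ⟨ε, hε, hrise⟩ := hr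
  obtain ⟨s₁, hs₁, -, hU, hO⟩ := h.exists_cylinder hx (Metric.ball_mem_nhds x hε)
  have hGx : G x < G (x + s₁ • e) := hrise x (Metric.mem_ball_self hε) s₁ hs₁ hU
  obtain ⟨V, hV, ρ, hρ, hball, hy⟩ := hO {y | G x < G y}
    ((isOpen_lt continuous_const hG).mem_nhds hGx)
  have hb : Metric.ball (x + s₁ • e) ρ ⊆ K ∩ {y | G x < G y} := fun y hy =>
    ⟨(hball hy).2.2, (hball hy).1⟩
  have hup : ∀ y ∈ V, y ∈ K → ∀ s ∈ Ioc (0 : ℝ) s₁, G y < G (y + s • e) := by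
    intro y hyV hyK s hs
    have h0 := ((hy y hyV).2 hyK 0 ⟨le_rfl, hs₁.le⟩).1
    rw [zero_smul, add_zero] at h0
    exact hrise y h0 s hs.1 ((hy y hyV).2 hyK s ⟨hs.1.le, hs.2⟩).1
  have hline : ∀ y ∈ V ∩ (K ∩ {y | G x < G y}),
      JoinedIn (K ∩ {y | G x < G y}) y (y + s₁ • e) := by
    rintro y ⟨hyV, hyK, hyG⟩
    refine joinedIn_line hs₁.le fun s hs => ⟨((hy y hyV).2 hyK s hs).2, ?_⟩
    rcases hs.1.eq_or_lt with h0 | h0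
    · rwa [← h0, zero_smul, add_zero]
    · exact lt_trans hyG (hup y hyV hyK s ⟨h0, hs.2⟩)
  refine ⟨V, hV, fun y hyV y' hyV' => ?_, ?_⟩
  · exact ((hline y hyV).trans (joinedIn_ball hb (hy y hyV.1).1 (hy y' hyV'.1).1)).trans
      (hline y' hyV').symm
  · rintro y ⟨hyV, hyK, hyG⟩
    have ht : Filter.Tendsto (fun s : ℝ => y + s • e) (𝓝[>] 0) (𝓝 y) := by
      have hc : Continuous fun s : ℝ => y + s • e := by fun_prop
      have := (hc.tendsto 0).mono_left (nhdsWithin_le_nhds (s := Ioi 0))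
      simpa using this
    refine mem_closure_of_tendsto ht ?_
    filter_upwards [Ioc_mem_nhdsGT hs₁] with s hs
    exact ⟨((hy y hyV).2 hyK s ⟨hs.1.le, hs.2⟩).2, lt_of_le_of_lt hyG (hup y hyV hyK s hs)⟩

/-- Points joined in all lower superlevel sets are joined in the given superlevel set. -/
lemma joinedIn_superlevel_of_forall_lt {K : Set E} (hK : IsCompact K) {G : E → ℝ}
    (hG : Continuous G) (hpush : ∀ x ∈ K, ∃ e, PushesInto K x e)
    (halt : ∀ x ∈ K, (∀ᶠ y in 𝓝 x, y ∈ K → y ≠ x → G y < G x) ∨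
      ∃ e, PushesInto K x e ∧ RisesAlong G x e) {x₀ x₁ : E} {c : ℝ} (hx₀ : x₀ ∈ K)
    (hx₁ : x₁ ∈ K) (h₀ : c < G x₀) (h₁ : c < G x₁)
    (h : ∀ d < c, JoinedIn (K ∩ {y | d < G y}) x₀ x₁) : JoinedIn (K ∩ {y | c < G y}) x₀ x₁ := by
  by_contra hnot
  set O := K ∩ {y | c < G y} with hO
  set U := {y | JoinedIn O x₀ y} with hU
  have hUO : U ⊆ O := fun y hy => JoinedIn.target_mem hy
  set L := K ∩ {y | c ≤ G y} with hL
  have hLc : IsClosed L := hK.isClosed.inter (isClosed_le continuous_const hG)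
  have hOL : O ⊆ L := fun y hy => ⟨hy.1, le_of_lt (show c < G y from hy.2)⟩
  have hAL : closure U ⊆ L := closure_minimal (hUO.trans hOL) hLc
  have hup : ∀ x ∈ closure U, c < G x → ∃ V ∈ 𝓝 x, V ∩ K ⊆ U := by
    intro x hx hGx
    obtain ⟨e, he⟩ := hpush x (hAL hx).1
    obtain ⟨V, hV, hj⟩ := he.exists_joinedIn (hAL hx).1
      ((isOpen_lt continuous_const hG).mem_nhds (show x ∈ {y | c < G y} from hGx))
    obtain ⟨u, huV, huU⟩ := mem_closure_iff_nhds.1 hx V hV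
    have hsub : {y | c < G y} ∩ K ⊆ O := fun y hy => ⟨hy.2, hy.1⟩
    refine ⟨V, hV, fun y hy => ?_⟩
    have h1 := (hj u ⟨huV, (hUO huU).1⟩).mono hsub
    have h2 := (hj y hy).mono hsub
    exact (JoinedIn.trans huU h1.symm).trans h2
  -- `closure U` is relatively open in {G ≥ c}: a strict local maximum of level c is not a limit of
  -- points above c, and near any other point of that level the superlevel set is connected.
  have hopen : ∀ x ∈ closure U, ∃ V ∈ 𝓝 x, V ∩ L ⊆ closure U := by
    intro x hx
    rcases (show c ≤ G x from (hAL hx).2).eq_or_lt with hGx | hGx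
    · rcases halt x (hAL hx).1 with hmax | ⟨e, hp, hr⟩
      · exfalso
        obtain ⟨u, huV, huU⟩ := mem_closure_iff_nhds.1 hx _ hmax
        have hu2 : c < G u := (hUO huU).2
        have hne : u ≠ x := fun h => by rw [h] at hu2; linarith
        have := huV (hUO huU).1 hne
        linarith
      · obtain ⟨V, hV, hj, hcl⟩ := hp.exists_superlevel hG hr (hAL hx).1
        rw [← hGx] at hj hcl
        obtain ⟨u, huV, huU⟩ := mem_closure_iff_nhds.1 hx V hV
        have hVO : V ∩ O ⊆ U := fun y hy =>
          JoinedIn.trans huU (hj u ⟨huV, hUO huU⟩ y hy)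
        refine ⟨interior V, interior_mem_nhds.2 hV, fun y hy => ?_⟩
        have hy' := hcl y ⟨interior_subset hy.1, hy.2⟩
        rw [mem_closure_iff_nhds] at hy' ⊢
        intro t ht
        obtain ⟨v, hv, hvO⟩ := hy' (t ∩ interior V)
          (Filter.inter_mem ht (isOpen_interior.mem_nhds hy.1))
        exact ⟨v, hv.1, hVO ⟨interior_subset hv.2, hvO⟩⟩
    · obtain ⟨V, hV, hVU⟩ := hup x hx hGx
      exact ⟨V, hV, fun y hy => subset_closure (hVU ⟨hy.1, hy.2.1⟩)⟩
  have hB : IsClosed (L \ closure U) := by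
    refine isClosed_of_closure_subset fun x hx => ⟨?_, fun hxU => ?_⟩
    · exact closure_minimal sdiff_subset hLc hx
    · obtain ⟨V, hV, hVL⟩ := hopen x hxU
      obtain ⟨u, huV, huL, hu⟩ := mem_closure_iff_nhds.1 hx V hV
      exact hu (hVL ⟨huV, huL⟩)
  -- Outside neighbourhoods of the two closed pieces of {G ≥ c}, compactness keeps G at most d for
  -- some d < c. A path above level d cannot pass from one neighbourhood to the other.
  obtain ⟨A', B', hA'o, hB'o, hA', hB', hdisj⟩ :=
    normal_separation isClosed_closure hB (disjoint_sdiff_right (s := closure U) (t := L))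
  have hC : IsCompact (K \ (A' ∪ B')) := hK.diff (hA'o.union hB'o)
  have hlt : ∀ y ∈ K \ (A' ∪ B'), G y < c := by
    rintro y ⟨hyK, hy⟩
    by_contra hc
    push Not at hc
    by_cases hyA : y ∈ closure U
    · exact hy (Or.inl (hA' hyA))
    · exact hy (Or.inr (hB' ⟨⟨hyK, hc⟩, hyA⟩))
  obtain ⟨d, hdc, hd⟩ : ∃ d < c, ∀ y ∈ K \ (A' ∪ B'), G y ≤ d := by
    rcases (K \ (A' ∪ B')).eq_empty_or_nonempty with he | hne
    · exact ⟨c - 1, by linarith, by simp [he]⟩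
    · obtain ⟨y, hy, hmax⟩ := hC.exists_isMaxOn hne hG.continuousOn
      exact ⟨G y, hlt y hy, fun z hz => hmax hz⟩
  have hj := h d hdc
  have hsub : K ∩ {y | d < G y} ⊆ A' ∪ B' := fun y hy => by
    by_contra hc
    exact not_lt.2 (hd y ⟨hy.1, hc⟩) hy.2
  have hx₀A : x₀ ∈ A' := hA' (subset_closure (JoinedIn.refl ⟨hx₀, h₀⟩))
  have hx₁B : x₁ ∈ B' := by
    refine hB' ⟨⟨hx₁, h₁.le⟩, fun hx => ?_⟩
    obtain ⟨V, hV, hVU⟩ := hup x₁ hx h₁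
    exact hnot (hVU ⟨mem_of_mem_nhds hV, hx₁⟩)
  have hpre : IsPreconnected (range hj.somePath) := isPreconnected_range hj.somePath.continuous
  have hrange : range hj.somePath ⊆ A' ∪ B' := by
    rintro _ ⟨t, rfl⟩
    exact hsub (hj.somePath_mem t)
  have := hpre.subset_left_of_subset_union hA'o hB'o hdisj hrange
    ⟨x₀, ⟨0, hj.somePath.source⟩, hx₀A⟩ ⟨1, hj.somePath.target⟩
  exact disjoint_left.1 hdisj this hx₁B

/-- Mountain pass principle: on a compact set with connected interior on which all critical points
of `G` are strict local maxima, a strict local maximum is a global maximum. -/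
theorem le_of_isStrictLocalMax [ProperSpace E] {K : Set E} (hK : IsCompact K) {G : E → ℝ}
    (hG : Continuous G)
    (hint : IsPreconnected (interior K)) (hpush : ∀ x ∈ K, ∃ e, PushesInto K x e)
    (halt : ∀ x ∈ K, (∀ᶠ y in 𝓝 x, y ∈ K → y ≠ x → G y < G x) ∨
      ∃ e, PushesInto K x e ∧ RisesAlong G x e) {x₀ : E} (hx₀ : x₀ ∈ K)
    (hmax : ∀ᶠ y in 𝓝 x₀, y ∈ K → y ≠ x₀ → G y < G x₀) : ∀ x ∈ K, G x ≤ G x₀ := by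
  intro x₁ hx₁
  by_contra hcon
  push Not at hcon
  have hmono : ∀ {c d : ℝ}, c ≤ d → JoinedIn (K ∩ {y | d < G y}) x₀ x₁ →
      JoinedIn (K ∩ {y | c < G y}) x₀ x₁ := fun hcd h =>
    h.mono fun y hy => ⟨hy.1, lt_of_le_of_lt hcd hy.2⟩
  -- On a small sphere about x₀ the values of G are bounded by some d < G x₀, while x₁ lies outside
  -- the sphere; a path above level d would have to cross it.
  obtain ⟨c₁, hc₁, hnot⟩ : ∃ c₁ < G x₀, ¬ JoinedIn (K ∩ {y | c₁ < G y}) x₀ x₁ := by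
    obtain ⟨ρ, hρ, hball⟩ := Metric.nhds_basis_closedBall.eventually_iff.1 hmax
    have hS : IsCompact (K ∩ Metric.sphere x₀ ρ) := hK.inter_right Metric.isClosed_sphere
    have hlt : ∀ y ∈ K ∩ Metric.sphere x₀ ρ, G y < G x₀ := fun y hy =>
      hball (Metric.sphere_subset_closedBall hy.2) hy.1 fun h => by
        have := hy.2; rw [h] at this; simp at this; linarith
    obtain ⟨d, hdc, hd⟩ : ∃ d < G x₀, ∀ y ∈ K ∩ Metric.sphere x₀ ρ, G y ≤ d := by
      rcases (K ∩ Metric.sphere x₀ ρ).eq_empty_or_nonempty with he | hne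
      · exact ⟨G x₀ - 1, by linarith, by simp [he]⟩
      · obtain ⟨y, hy, hm⟩ := hS.exists_isMaxOn hne hG.continuousOn
        exact ⟨G y, hlt y hy, fun z hz => hm hz⟩
    refine ⟨d, hdc, fun hj => ?_⟩
    have hx₁far : ρ ≤ dist x₁ x₀ := by
      by_contra hc
      push Not at hc
      by_cases he : x₁ = x₀
      · rw [he] at hcon; exact lt_irrefl _ hcon
      · exact lt_asymm hcon (hball hc.le hx₁ he)
    have hc : Continuous fun t => dist (hj.somePath t) x₀ :=
      hj.somePath.continuous.dist continuous_const
    obtain ⟨t, ht⟩ := mem_range_of_exists_le_of_exists_ge hc (c := ρ)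
      ⟨0, by simp [hρ.le]⟩ ⟨1, by simpa using hx₁far⟩
    have hm := hj.somePath_mem t
    exact not_lt.2 (hd _ ⟨hm.1, ht⟩) hm.2
  set T := {c | JoinedIn (K ∩ {y | c < G y}) x₀ x₁} with hT
  have hTb : ∀ c ∈ T, c ≤ c₁ := fun c hc => by
    by_contra h
    push Not at h
    exact hnot (hmono h.le hc)
  have hTne : T.Nonempty := by
    obtain ⟨m, hm⟩ := (hK.image hG).bddBelow
    obtain ⟨e₀, he₀⟩ := hpush x₀ hx₀
    obtain ⟨e₁, he₁⟩ := hpush x₁ hx₁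
    obtain ⟨y₀, hy₀, hj₀⟩ := he₀.exists_joinedIn_interior hx₀
    obtain ⟨y₁, hy₁, hj₁⟩ := he₁.exists_joinedIn_interior hx₁
    have hpc := isOpen_interior.isConnected_iff_isPathConnected.1 ⟨⟨y₀, hy₀⟩, hint⟩
    have hj : JoinedIn K x₀ x₁ :=
      (hj₀.trans ((hpc.joinedIn _ hy₀ _ hy₁).mono interior_subset)).trans hj₁.symm
    refine ⟨m - 1, hj.mono fun y hy => ⟨hy, ?_⟩⟩
    have := hm (mem_image_of_mem G hy)
    show m - 1 < G y
    linarith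
  have hTbd : BddAbove T := ⟨c₁, hTb⟩
  set c := sSup T
  have hcc₁ : c ≤ c₁ := csSup_le hTne hTb
  have hJ : JoinedIn (K ∩ {y | c < G y}) x₀ x₁ := by
    refine joinedIn_superlevel_of_forall_lt hK hG hpush halt hx₀ hx₁ (by linarith) (by linarith)
      fun d hd => ?_
    obtain ⟨c', hc', hdc'⟩ := exists_lt_of_lt_csSup hTne hd
    exact hmono hdc'.le hc'
  -- The supremal level c is itself attained, but the minimum of G along a path above c is larger
  -- than c, so the path also works for a higher level.
  obtain ⟨t, -, hmin⟩ := isCompact_univ.exists_isMinOn (univ_nonempty (α := unitInterval))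
    (hG.comp hJ.somePath.continuous).continuousOn
  have hmt : c < G (hJ.somePath t) := (hJ.somePath_mem t).2
  have hmem : (c + G (hJ.somePath t)) / 2 ∈ T := by
    refine ⟨hJ.somePath, fun s => ⟨(hJ.somePath_mem s).1, ?_⟩⟩
    have : G (hJ.somePath t) ≤ G (hJ.somePath s) := hmin (mem_univ s)
    show (c + G (hJ.somePath t)) / 2 < G (hJ.somePath s)
    linarith
  have := le_csSup hTbd hmem
  linarith

end MountainPass

/-! ### Taylor expansion and first order conditions -/

section Taylor

variable {E : Type*} [NormedAddCommGroup E] [NormedSpace ℝ E]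

/-- Second order Taylor formula with Lagrange remainder along a segment. -/
lemma exists_taylor_two {f : E → ℝ} (hf : ContDiff ℝ 2 f) (x d : E) :
    ∃ θ ∈ Ioo (0 : ℝ) 1, f (x + d) = f x + fderiv ℝ f x d +
      1 / 2 * fderiv ℝ (fderiv ℝ f) (x + θ • d) d d := by
  have hline : ∀ s : ℝ, HasDerivAt (fun s : ℝ => x + s • d) d s := fun s => by
    simpa using ((hasDerivAt_id s).smul_const d).const_add x
  have hf1 : Differentiable ℝ f := hf.differentiable two_ne_zero
  have hf2 : Differentiable ℝ (fderiv ℝ f) :=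
    (hf.fderiv_right (m := 1) (by norm_num)).differentiable one_ne_zero
  have h1 : ∀ s : ℝ, HasDerivAt (fun s : ℝ => f (x + s • d)) (fderiv ℝ f (x + s • d) d) s :=
    fun s => (hf1 _).hasFDerivAt.comp_hasDerivAt s (hline s)
  have h2 : ∀ s : ℝ, HasDerivAt (fun s : ℝ => fderiv ℝ f (x + s • d) d)
      (fderiv ℝ (fderiv ℝ f) (x + s • d) d d) s := fun s => by
    have := (hf2 _).hasFDerivAt.comp_hasDerivAt s (hline s)
    simpa using this.clm_apply (hasDerivAt_const s d)
  have h3 : ∀ s : ℝ, HasDerivAt (fun s : ℝ => f (x + s • d) - s * fderiv ℝ f x d)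
      (fderiv ℝ f (x + s • d) d - fderiv ℝ f x d) s := fun s => by
    simpa using (h1 s).fun_sub ((hasDerivAt_id' s).mul_const (fderiv ℝ f x d))
  have h4 : ∀ s : ℝ, HasDerivAt (fun s : ℝ => s ^ 2) (2 * s) s := fun s => by
    simpa using hasDerivAt_pow 2 s
  -- Cauchy's mean value theorem against s², followed by the mean value theorem for the first
  -- derivative.
  obtain ⟨s, hs, hs'⟩ := exists_ratio_hasDerivAt_eq_ratio_slope
    (fun s : ℝ => f (x + s • d) - s * fderiv ℝ f x d)
    (fun s => fderiv ℝ f (x + s • d) d - fderiv ℝ f x d) (zero_lt_one' ℝ)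
    (fun s _ => (h3 s).continuousAt.continuousWithinAt) (fun s _ => h3 s)
    (fun s : ℝ => s ^ 2) (fun s => 2 * s)
    (fun s _ => (h4 s).continuousAt.continuousWithinAt) (fun s _ => h4 s)
  obtain ⟨θ, hθ, hθ'⟩ := exists_hasDerivAt_eq_slope (fun s : ℝ => fderiv ℝ f (x + s • d) d)
    (fun s => fderiv ℝ (fderiv ℝ f) (x + s • d) d d) hs.1
    (fun s _ => (h2 s).continuousAt.continuousWithinAt) (fun s _ => h2 s)
  refine ⟨θ, ⟨hθ.1, hθ.2.trans hs.2⟩, ?_⟩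
  have hs0 : s ≠ 0 := hs.1.ne'
  simp only [one_smul, zero_smul, add_zero, sub_zero, one_pow, one_mul, zero_mul] at hs' hθ'
  rw [eq_div_iff hs0] at hθ'
  norm_num at hs'
  rw [← hθ'] at hs'
  have : s * (fderiv ℝ (fderiv ℝ f) (x + θ • d) d d - 2 * (f (x + d) - fderiv ℝ f x d - f x)) = 0 := by
    linarith
  have := (mul_eq_zero.1 this).resolve_left hs0
  linarith

lemma tendsto_fderiv_fderiv_apply {f : E → ℝ} (hf : ContDiff ℝ 2 f) {x v : ℕ → E} {x₀ u : E}
    (hx : Filter.Tendsto x Filter.atTop (𝓝 x₀)) (hv : Filter.Tendsto v Filter.atTop (𝓝 u)) :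
    Filter.Tendsto (fun m => fderiv ℝ (fderiv ℝ f) (x m) (v m) (v m)) Filter.atTop
      (𝓝 (fderiv ℝ (fderiv ℝ f) x₀ u u)) := by
  have hcont : Continuous (fderiv ℝ (fderiv ℝ f)) :=
    (hf.fderiv_right (m := 1) (by norm_num)).continuous_fderiv one_ne_zero
  have hcont' : Continuous fun q : E × E => fderiv ℝ (fderiv ℝ f) q.1 q.2 q.2 :=
    ((hcont.comp continuous_fst).clm_apply continuous_snd).clm_apply continuous_snd
  exact (hcont'.tendsto (x₀, u)).comp (hx.prodMk_nhds hv)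

lemma risesAlong_of_hasStrictFDerivAt {G : E → ℝ} {G' : E →L[ℝ] ℝ} {x e : E}
    (h : HasStrictFDerivAt G G' x) (he : 0 < G' e) : RisesAlong G x e := by
  have ho := h.isLittleO.def (c := G' e / (2 * (‖e‖ + 1))) (by positivity)
  rw [nhds_prod_eq, Filter.eventually_prod_self_iff'] at ho
  obtain ⟨t, ht, hto⟩ := ho
  obtain ⟨ε, hε, hball⟩ := Metric.mem_nhds_iff.1 ht
  refine ⟨ε, hε, fun y hy s hs hys => ?_⟩
  have h1 := hto (y + s • e) (hball hys) y (hball hy)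
  simp only [add_sub_cancel_left, map_smul, smul_eq_mul, norm_smul, Real.norm_eq_abs,
    abs_of_pos hs] at h1
  have h2 := (abs_le.1 h1).1
  have h3 : G' e / (2 * (‖e‖ + 1)) * (s * ‖e‖) ≤ s * G' e / 2 := by
    rw [div_mul_eq_mul_div, div_le_div_iff₀ (by positivity) two_pos]
    nlinarith [mul_pos hs he, norm_nonneg e]
  nlinarith [mul_pos hs he]

/-- A functional that is nonpositive on a half-space is a multiple of the one defining it. -/
lemma exists_eq_smul_of_forall {F G : E →L[ℝ] ℝ} {e₀ : E} (he₀ : F e₀ < 0)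
    (h : ∀ e, F e < 0 → G e ≤ 0) : ∃ k : ℝ, 0 ≤ k ∧ ∀ e, G e = k * F e := by
  have hker : ∀ e, F e = 0 → G e ≤ 0 := by
    intro e he
    by_contra hc
    push Not at hc
    -- Small enough that adding t • e₀ makes F negative while G keeps at least half of its value.
    set t := G e / (2 * (|G e₀| + 1)) with ht
    have ht0 : 0 < t := by positivity
    have h1 := h (e + t • e₀) (by rw [map_add, map_smul, he, zero_add, smul_eq_mul]; nlinarith)
    rw [map_add, map_smul, smul_eq_mul] at h1
    have h2 : t * |G e₀| ≤ G e / 2 := by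
      rw [ht, div_mul_eq_mul_div, div_le_div_iff₀ (by positivity) two_pos]
      nlinarith [abs_nonneg (G e₀)]
    have h3 := neg_abs_le (G e₀)
    nlinarith
  refine ⟨G e₀ / F e₀, div_nonneg_of_nonpos (h _ he₀) he₀.le, fun e => ?_⟩
  have h1 : F (e - (F e / F e₀) • e₀) = 0 := by
    rw [map_sub, map_smul, smul_eq_mul, div_mul_cancel₀ _ he₀.ne, sub_self]
  have h2 := hker _ h1
  have h3 := hker (-(e - (F e / F e₀) • e₀)) (by rw [map_neg, h1, neg_zero])
  rw [map_neg] at h3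
  rw [map_sub, map_smul, smul_eq_mul] at h2 h3
  have h4 : G e = F e / F e₀ * G e₀ := by linarith
  rw [h4]; ring

end Taylor

/-! ### Tangent horospheres and the second order condition -/

section Hyperboloid

variable {n : ℕ}

lemma eq_zero_of_forall_eta {Z : Mink n} (h : ∀ V, eta Z V = 0) : Z = 0 := by
  have h1 := h (-Z.1, Z.2)
  simp only [eta, inner_neg_right, real_inner_self_eq_norm_sq] at h1
  have h2 : ‖Z.1‖ = 0 := by nlinarith [norm_nonneg Z.1, mul_self_nonneg Z.2]
  have h3 : Z.2 = 0 := by rw [h2] at h1; nlinarith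
  exact Prod.ext (norm_eq_zero.1 h2) h3

/-- The form as a continuous linear functional in the first variable. -/
noncomputable def etaL (N : Mink n) : Mink n →L[ℝ] ℝ :=
  N.2 • ContinuousLinearMap.snd ℝ _ ℝ - (innerSL ℝ N.1).comp (ContinuousLinearMap.fst ℝ _ ℝ)

lemma etaL_apply (N V : Mink n) : etaL N V = eta V N := by
  simp [etaL, eta, real_inner_comm]; ring

lemma tangent_decomp (X : Hyp n) (V : Mink n) : eta X.1 (V - eta X.1 V • X.1) = 0 := by
  simp [eta_point_self]

/-- A linear functional on the tangent space given by a null vector is determined by its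
normal part. -/
lemma null_eq_of_tangent {X : Hyp n} {N ν : Mink n} {k : ℝ} (hN : InFutureCone N) (hN0 : N ≠ 0)
    (hNN : eta N N = 0) (hν : eta X.1 ν = 0) (hνν : eta ν ν = -1) (hk : 0 ≤ k)
    (h : ∀ w, eta X.1 w = 0 → eta w N = -k * eta ν w) :
    0 < k ∧ N = k • (X.1 - ν) := by
  have hμ := eta_point_pos X hN hN0
  -- This vector is orthogonal to X by construction and to the tangent space by hypothesis. That N
  -- is null then forces its X-coefficient to equal k.
  have hZ : N + k • ν - eta X.1 N • X.1 = 0 := by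
    refine eq_zero_of_forall_eta fun V => ?_
    have h1 := h _ (tangent_decomp X V)
    simp only [eta_sub_left, eta_add_left, eta_smul_left, eta_sub_right, eta_smul_right,
      eta_comm ν X.1, hν, eta_comm V N] at h1 ⊢
    linarith
  have hN' : N = eta X.1 N • X.1 - k • ν := by
    have := sub_eq_zero.1 hZ
    rw [← this]; abel
  have hsq : eta X.1 N ^ 2 = k ^ 2 := by
    have h1 : eta (eta X.1 N • X.1 - k • ν) (eta X.1 N • X.1 - k • ν) =
        eta X.1 N ^ 2 - k ^ 2 := by
      simp only [eta_sub_left, eta_smul_left, eta_sub_right, eta_smul_right, eta_comm ν X.1, hν,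
        hνν, eta_point_self]
      ring
    rw [← hN', hNN] at h1
    linarith
  have hμk : eta X.1 N = k := (pow_left_inj₀ hμ.le hk two_ne_zero).1 hsq
  refine ⟨hμk ▸ hμ, ?_⟩
  rw [smul_sub]
  rw [hμk] at hN'
  exact hN'

/-- At a critical boundary point, uniform horo-convexity makes a horospherical height function a
strict local maximum. -/
lemma isStrictLocalMax_of_secondFF {K : Set (Hyp n)} {X : Hyp n} {f : Mink n → ℝ} {ν : Mink n}
    {c δ k : ℝ} (hf : IsLocalDefiningFunction K X f) (hν : lor X.1 ν = 0) (hνν : lor ν ν = 1)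
    (hc : 0 < c) (hgrad : ∀ w : Mink n, lor X.1 w = 0 → fderiv ℝ f X.1 w = c * lor ν w)
    (hδ : 0 < δ) (hcurv : ∀ v : Mink n, lor X.1 v = 0 → lor ν v = 0 → v ≠ 0 →
      (1 + δ) * lor v v < secondFF f X ν v v) (hk : 0 < k) {N : Mink n}
    (hN : N = (k * c) • (X.1 - ν)) :
    ∀ᶠ Y : Hyp n in 𝓝 X, Y ∈ K → Y ≠ X → eta Y.1 N < eta X.1 N := by
  obtain ⟨hfs, hfX, hloc⟩ := hf
  have hf2 : ContDiff ℝ 2 f := contDiff_infty.1 hfs 2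
  simp only [lor_eq, neg_eq_zero] at hν hgrad hcurv
  have hνν' : eta ν ν = -1 := by rw [lor_eq] at hνν; linarith
  by_contra hcon
  have hfreq : ∃ᶠ Y : Hyp n in 𝓝 X, (Y ∈ K ∧ Y ≠ X ∧ eta X.1 N ≤ eta Y.1 N) ∧
      (Y ∈ K ↔ f Y.1 ≤ 0) := by
    refine Filter.Frequently.and_eventually ?_ hloc
    rw [Filter.not_eventually] at hcon
    refine hcon.mono fun Y hY => ?_
    push Not at hY
    exact hY
  obtain ⟨Y, hYlim, hY⟩ := Filter.exists_seq_forall_of_frequently hfreq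
  have hYlim' : Filter.Tendsto (fun m => (Y m).1 - X.1) Filter.atTop (𝓝 0) := by
    have := ((continuous_subtype_val.tendsto X).comp hYlim).sub_const X.1
    simpa using this
  set d : ℕ → Mink n := fun m => (Y m).1 - X.1 with hd
  have hd0 : ∀ m, 0 < ‖d m‖ := fun m => norm_pos_iff.2 (sub_ne_zero.2 fun h =>
    (hY m).1.2.1 (Subtype.ext h))
  have hdlim : Filter.Tendsto (fun m => ‖d m‖) Filter.atTop (𝓝 0) := by
    simpa using hYlim'.norm
  set v : ℕ → Mink n := fun m => ‖d m‖⁻¹ • d m with hv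
  have hdv : ∀ m, d m = ‖d m‖ • v m := fun m => by
    simp only [hv, smul_smul, mul_inv_cancel₀ (hd0 m).ne', one_smul]
  have hv1 : ∀ m, v m ∈ Metric.sphere (0 : Mink n) 1 := fun m => by
    rw [mem_sphere_zero_iff_norm]
    simp only [hv, norm_smul, norm_inv, norm_norm, inv_mul_cancel₀ (hd0 m).ne']
  -- Both X and X + d lie on the hyperboloid, so the component of d along X is of second order.
  have hηd : ∀ m, eta X.1 (d m) = -(1 / 2) * eta (d m) (d m) := fun m => by
    simp only [hd, eta_sub_left, eta_sub_right, eta_point_self, eta_comm (Y m).1 X.1]; ring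
  have hNd : ∀ m, 0 ≤ eta N (d m) := fun m => by
    rw [eta_comm, hd, eta_sub_left]
    exact sub_nonneg.2 (hY m).1.2.2
  have hfd : ∀ m, f (X.1 + d m) ≤ 0 := fun m => by
    have : X.1 + d m = (Y m).1 := by simp [hd]
    rw [this]; exact (hY m).2.1 (hY m).1.1
  clear_value v d
  choose θ hθ hT using fun m => exists_taylor_two hf2 X.1 (d m)
  obtain ⟨u, hu, φ, hφ, hlim⟩ := (isCompact_sphere (0 : Mink n) 1).tendsto_subseq hv1
  have hu0 : u ≠ 0 := fun h => by rw [h] at hu; simp at hu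
  have hdlim' := hdlim.comp hφ.tendsto_atTop
  have hD2 : Filter.Tendsto (fun m => fderiv ℝ (fderiv ℝ f) (X.1 + θ (φ m) • d (φ m)) (v (φ m))
      (v (φ m))) Filter.atTop (𝓝 (fderiv ℝ (fderiv ℝ f) X.1 u u)) := by
    have hpt : Filter.Tendsto (fun m => X.1 + θ (φ m) • d (φ m)) Filter.atTop (𝓝 X.1) := by
      have h0 : Filter.Tendsto (fun m => θ (φ m) • d (φ m)) Filter.atTop (𝓝 0) := by
        rw [tendsto_zero_iff_norm_tendsto_zero]
        refine squeeze_zero (fun _ => norm_nonneg _) (fun m => ?_) hdlim'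
        rw [norm_smul, Real.norm_of_nonneg (hθ _).1.le]
        exact mul_le_of_le_one_left (norm_nonneg _) (hθ _).2.le
      simpa using h0.const_add X.1
    exact tendsto_fderiv_fderiv_apply hf2 hpt hlim
  have hηv : ∀ m, eta X.1 (v m) = -(1 / 2) * ‖d m‖ * eta (v m) (v m) := fun m => by
    have h1 : eta X.1 (d m) = ‖d m‖ * eta X.1 (v m) := by
      conv_lhs => rw [hdv m, eta_smul_right]
    have h2 : eta (d m) (d m) = ‖d m‖ * (‖d m‖ * eta (v m) (v m)) := by
      conv_lhs => rw [hdv m, eta_smul_right, eta_smul_left]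
    refine mul_left_cancel₀ (hd0 m).ne' ?_
    linarith [hηd m]
  have lim_eta : ∀ A : Mink n, Filter.Tendsto (fun m => eta A (v (φ m))) Filter.atTop
      (𝓝 (eta A u)) := fun A => by
    have hcont : Continuous fun V : Mink n => eta A V := by fun_prop
    exact (hcont.tendsto u).comp hlim
  have lim_vv : Filter.Tendsto (fun m => eta (v (φ m)) (v (φ m))) Filter.atTop (𝓝 (eta u u)) := by
    have hcont : Continuous fun V : Mink n => eta V V := by fun_prop
    exact (hcont.tendsto u).comp hlim
  have hXu : eta X.1 u = 0 := by
    refine tendsto_nhds_unique (lim_eta X.1) ?_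
    simp only [hηv]
    have := (hdlim'.const_mul (-(1 / 2) : ℝ)).mul lim_vv
    simpa using this
  have hTv : ∀ m, fderiv ℝ f X.1 (v m) + 1 / 2 * ‖d m‖ *
      fderiv ℝ (fderiv ℝ f) (X.1 + θ m • d m) (v m) (v m) ≤ 0 := fun m => by
    have h1 := hfd m
    rw [hT m, hfX] at h1
    have h2 : fderiv ℝ f X.1 (d m) = ‖d m‖ * fderiv ℝ f X.1 (v m) := by
      conv_lhs => rw [hdv m]
      rw [map_smul, smul_eq_mul]
    have h3 : fderiv ℝ (fderiv ℝ f) (X.1 + θ m • d m) (d m) (d m) = ‖d m‖ * (‖d m‖ *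
        fderiv ℝ (fderiv ℝ f) (X.1 + θ m • d m) (v m) (v m)) := by
      generalize fderiv ℝ (fderiv ℝ f) (X.1 + θ m • d m) = B
      conv_lhs => rw [hdv m]
      simp only [map_smul, smul_apply, smul_eq_mul]
    rw [h2, h3] at h1
    refine le_of_mul_le_mul_left ?_ (hd0 m)
    linarith
  have hNv : ∀ m, 0 ≤ eta N (v m) := fun m => by
    have h1 : eta N (d m) = ‖d m‖ * eta N (v m) := by
      conv_lhs => rw [hdv m, eta_smul_right]
    have h1 := h1 ▸ hNd m
    exact nonneg_of_mul_nonneg_right h1 (hd0 m)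
  have hDfu : fderiv ℝ f X.1 u ≤ 0 := by
    have h1 : Filter.Tendsto (fun m => fderiv ℝ f X.1 (v (φ m))) Filter.atTop
        (𝓝 (fderiv ℝ f X.1 u)) := ((fderiv ℝ f X.1).continuous.tendsto u).comp hlim
    have h2 := h1.add ((hdlim'.const_mul (1 / 2 : ℝ)).mul hD2)
    simp only [mul_zero, zero_mul, add_zero] at h2
    exact le_of_tendsto' h2 fun m => hTv (φ m)
  have hNu : 0 ≤ eta N u := ge_of_tendsto' (lim_eta N) fun m => hNv (φ m)
  have hNw : ∀ w, eta X.1 w = 0 → eta N w = k * fderiv ℝ f X.1 w := fun w hw => by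
    rw [hgrad w hw, hN, eta_smul_left, eta_sub_left, hw]; ring
  -- Membership in K gives Df(u) ≤ 0 and the height condition gives the opposite sign, since on
  -- tangent vectors the height has derivative k Df.
  have hνu : eta ν u = 0 := by
    rw [hNw u hXu, hgrad u hXu] at hNu
    rw [hgrad u hXu] at hDfu
    have h1 : 0 ≤ eta ν u := by
      by_contra hcc
      push Not at hcc
      nlinarith
    have h2 : 0 ≤ -eta ν u := by
      by_contra hcc
      push Not at hcc
      have := mul_pos hk hc
      nlinarith
    linarith
  have hXN : eta X.1 N = k * c := by
    rw [hN, eta_smul_right, eta_sub_right, hν, eta_point_self]; ring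
  -- The first order terms cancel between k times the Taylor inequality and the height inequality.
  -- The limit of the rest bounds the normal curvature along u by 1, against the hypothesis 1 + δ.
  have hsecond : ∀ m, -eta (v m) (v m) * (k * fderiv ℝ f X.1 X.1 - k * c) +
      k * fderiv ℝ (fderiv ℝ f) (X.1 + θ m • d m) (v m) (v m) ≤ 0 := fun m => by
    have h1 := hTv m
    have h2 := hNv m
    have h3 := hNw _ (tangent_decomp X (v m))
    rw [eta_sub_right, eta_smul_right, map_sub, map_smul, smul_eq_mul, eta_comm N X.1, hXN,
      hηv m] at h3
    have h4 := mul_le_mul_of_nonneg_left h1 hk.le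
    have h5 : 1 / 2 * ‖d m‖ * (-eta (v m) (v m) * (k * fderiv ℝ f X.1 X.1 - k * c) +
      k * fderiv ℝ (fderiv ℝ f) (X.1 + θ m • d m) (v m) (v m)) ≤ 0 := by linarith
    by_contra hcc
    push Not at hcc
    have := mul_pos (mul_pos (one_half_pos (α := ℝ)) (hd0 m)) hcc
    linarith
  have hfin : -eta u u * (k * fderiv ℝ f X.1 X.1 - k * c) +
      k * fderiv ℝ (fderiv ℝ f) X.1 u u ≤ 0 :=
    le_of_tendsto' ((lim_vv.neg.mul_const _).add (hD2.const_mul k)) fun m => hsecond (φ m)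
  have hcu := hcurv u hXu hνu hu0
  have hfν : fderiv ℝ f X.1 ν = c := by rw [hgrad ν hν, hνν']; ring
  rw [secondFF, hfν, lor_eq, lt_div_iff₀ hc] at hcu
  have huu : eta u u ≤ 0 := eta_self_nonpos_of_eta_eq_zero (inFutureCone_point X)
    (point_ne_zero X) (by rw [eta_comm]; exact hXu)
  have := mul_lt_mul_of_pos_left hcu hk
  have : 0 ≤ k * (c * (δ * -eta u u)) := by
    have := neg_nonneg.2 huu; positivity
  nlinarith

end Hyperboloid

/-! ### Sublevel sets and the vertical projection as a chart -/

section Push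

variable {E : Type*} [NormedAddCommGroup E] [NormedSpace ℝ E]

lemma pushesInto_of_mem_interior {K : Set E} {x : E} (hx : x ∈ interior K) (e : E) :
    PushesInto K x e := by
  obtain ⟨ε, hε, hball⟩ := Metric.mem_nhds_iff.1 (isOpen_interior.mem_nhds hx)
  exact ⟨ε, hε, fun y _ s _ h => hball h⟩

lemma pushesInto_of_hasStrictFDerivAt {K : Set E} {F : E → ℝ} {F' : E →L[ℝ] ℝ} {x e : E}
    (hF : Continuous F) (hF' : HasStrictFDerivAt F F' x)
    (hloc : ∀ᶠ y in 𝓝 x, (y ∈ K ↔ F y ≤ 0)) (he : F' e < 0) : PushesInto K x e := by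
  obtain ⟨ε₁, hε₁, h₁⟩ := risesAlong_of_hasStrictFDerivAt (e := e) hF'.neg (by simpa using he)
  obtain ⟨ε₂, hε₂, h₂⟩ := Metric.mem_nhds_iff.1 hloc
  have hb₁ : Metric.ball x (min ε₁ ε₂) ⊆ Metric.ball x ε₁ :=
    Metric.ball_subset_ball (min_le_left _ _)
  have hb₂ : Metric.ball x (min ε₁ ε₂) ⊆ Metric.ball x ε₂ :=
    Metric.ball_subset_ball (min_le_right _ _)
  refine ⟨min ε₁ ε₂, lt_min hε₁ hε₂, fun y hy s hs hys => ?_⟩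
  have h3 := h₁ y (hb₁ hy.2) s hs (hb₁ hys)
  have h4 : F y ≤ 0 := (h₂ (hb₂ hy.2)).1 hy.1
  have h5 : F (y + s • e) < 0 := by
    have : -F y < -F (y + s • e) := h3
    linarith
  refine mem_interior.2 ⟨{z | F z < 0} ∩ Metric.ball x ε₂, fun z hz => (h₂ hz.2).2 hz.1.le,
    (isOpen_lt hF continuous_const).inter Metric.isOpen_ball, h5, hb₂ hys⟩

end Push

section Chart

variable {n : ℕ}

/-- The vertical projection of the hyperboloid onto `ℝ^{n+1}`, as a global chart. -/
noncomputable def chart (n : ℕ) : EuclideanSpace ℝ (Fin (n + 1)) ≃ₜ Hyp n where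
  toFun x := ⟨(x, Real.sqrt (1 + ‖x‖ ^ 2)), by
    have h : 0 < 1 + ‖x‖ ^ 2 := by positivity
    refine ⟨?_, Real.sqrt_pos.2 h⟩
    rw [lor, Real.mul_self_sqrt h.le, real_inner_self_eq_norm_sq]; ring⟩
  invFun X := X.1.1
  left_inv _ := rfl
  right_inv X := by
    refine Subtype.ext (Prod.ext rfl ?_)
    have h := eta_point_self X
    rw [eta_self] at h
    change Real.sqrt (1 + ‖X.1.1‖ ^ 2) = X.1.2
    rw [show 1 + ‖X.1.1‖ ^ 2 = X.1.2 ^ 2 by linarith, Real.sqrt_sq X.2.2.le]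
  continuous_toFun := by
    refine Continuous.subtype_mk ?_ _
    fun_prop
  continuous_invFun := by fun_prop

/-- The linear isomorphism of `ℝ^{n+1}` with the tangent space at `X` inverse to the vertical
projection. -/
noncomputable def tangentLift (X : Hyp n) : EuclideanSpace ℝ (Fin (n + 1)) →L[ℝ] Mink n :=
  (ContinuousLinearMap.id ℝ _).prod (X.1.2⁻¹ • innerSL ℝ X.1.1)

lemma tangentLift_fst {X : Hyp n} {w : Mink n} (hw : eta X.1 w = 0) :
    tangentLift X w.1 = w := by
  refine Prod.ext (by simp [tangentLift]) ?_
  have : X.1.2 * w.2 = inner ℝ X.1.1 w.1 := by unfold eta at hw; linarith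
  simp [tangentLift, ← this, inv_mul_cancel_left₀ X.2.2.ne']

lemma hasStrictFDerivAt_chart (x : EuclideanSpace ℝ (Fin (n + 1))) :
    HasStrictFDerivAt (fun x => (chart n x).1) (tangentLift (chart n x)) x := by
  have h : 1 + ‖x‖ ^ 2 ≠ 0 := by positivity
  have h1 := ((hasStrictFDerivAt_norm_sq x).const_add 1).sqrt h
  refine ((hasStrictFDerivAt_id x).prodMk h1).congr_fderiv ?_
  ext e
  · rfl
  · simp [tangentLift, chart]
    ring

end Chart

/-! ### From local to global horo-convexity -/

section Support

variable {n : ℕ}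

lemma inFutureCone_of_eta_self {X : Hyp n} {N : Mink n} (hNN : eta N N = 0)
    (h : 0 < eta X.1 N) : InFutureCone N := by
  rw [eta_self] at hNN
  have h1 : ‖N.1‖ = |N.2| := by
    rw [← abs_norm]; exact (sq_eq_sq_iff_abs_eq_abs _ _).1 (by linarith)
  rcases le_total 0 N.2 with h2 | h2
  · rw [abs_of_nonneg h2] at h1; exact h1.le
  · exfalso
    have h3 : InFutureCone (-N) := by
      rw [abs_of_nonpos h2] at h1
      simp [InFutureCone, h1]
    have := (inFutureCone_point X).eta_nonneg h3
    rw [← neg_one_smul ℝ N, eta_smul_right] at this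
    linarith

/-- `N` is the null vector of an outer horosphere tangent to `∂K` at `X`, normalized by
`-⟨X, N⟩ = 1`. -/
def IsOuterNull (K : Set (Hyp n)) (X : Hyp n) (N : Mink n) : Prop :=
  InFutureCone N ∧ eta N N = 0 ∧ eta X.1 N = 1 ∧ ∀ Y ∈ K, eta Y.1 N ≤ 1

/-- The null vector X₀ - ν₀ defines the tangent horosphere at X₀. Its height function has no
critical point inside K, and at a boundary point where no inward direction raises it the curvature
bound makes the point a strict local maximum. The mountain pass principle, transported through the
chart, makes X₀ a global maximum. -/
theorem IsSmoothUnifHConvex.exists_isOuterNull {K : Set (Hyp n)} (hK : IsSmoothUnifHConvex K)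
    {X₀ : Hyp n} (hX₀ : X₀ ∈ frontier K) : ∃ N, IsOuterNull K X₀ N := by
  obtain ⟨hcomp, hconn, δ, hδ, hfr⟩ := hK
  obtain ⟨f₀, ν₀, hf₀, ⟨hν₀, hνν₀, c₀, hc₀, hgrad₀⟩, hcurv₀⟩ := hfr X₀ hX₀
  have hν₀' : eta X₀.1 ν₀ = 0 := by rw [lor_eq] at hν₀; linarith
  have hνν₀' : eta ν₀ ν₀ = -1 := by rw [lor_eq] at hνν₀; linarith
  set N := X₀.1 - ν₀ with hNdef
  have hNN : eta N N = 0 := by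
    simp [hNdef, eta_point_self, hν₀', hνν₀', eta_comm ν₀ X₀.1]
  have hXN : eta X₀.1 N = 1 := by simp [hNdef, eta_point_self, hν₀']
  have hN : InFutureCone N := inFutureCone_of_eta_self hNN (by rw [hXN]; norm_num)
  have hN0 : N ≠ 0 := fun h => by simp [h] at hXN
  have hmax := isStrictLocalMax_of_secondFF hf₀ hν₀ hνν₀ hc₀ hgrad₀ hδ hcurv₀
    (k := c₀⁻¹) (by positivity) (N := N) (by rw [inv_mul_cancel₀ hc₀.ne', one_smul])
  set Φ := chart n
  have hG' : ∀ x, HasStrictFDerivAt (fun x => eta (Φ x).1 N) ((etaL N).comp (tangentLift (Φ x))) x :=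
    fun x => by
      have := (etaL N).hasStrictFDerivAt.comp x (hasStrictFDerivAt_chart x)
      simpa only [Function.comp_def, etaL_apply] using this
  have hfront : ∀ x, Φ x ∈ frontier K → ∃ (f : Mink n → ℝ) (ν : Mink n) (c : ℝ),
      IsLocalDefiningFunction K (Φ x) f ∧ lor (Φ x).1 ν = 0 ∧ lor ν ν = 1 ∧ 0 < c ∧
      (∀ w : Mink n, lor (Φ x).1 w = 0 → fderiv ℝ f (Φ x).1 w = c * lor ν w) ∧
      (∀ v : Mink n, lor (Φ x).1 v = 0 → lor ν v = 0 → v ≠ 0 →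
        (1 + δ) * lor v v < secondFF f (Φ x) ν v v) ∧
      (∀ e, (fderiv ℝ f (Φ x).1).comp (tangentLift (Φ x)) e < 0 → PushesInto (Φ ⁻¹' K) x e) ∧
      (fderiv ℝ f (Φ x).1).comp (tangentLift (Φ x)) (-ν).1 < 0 := by
    intro x hx
    obtain ⟨f, ν, hf, ⟨hν, hνν, c, hc, hgrad⟩, hcurv⟩ := hfr _ hx
    refine ⟨f, ν, c, hf, hν, hνν, hc, hgrad, hcurv, fun e he => ?_, ?_⟩
    · have hF' : HasStrictFDerivAt (fun x => f (Φ x).1)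
          ((fderiv ℝ f (Φ x).1).comp (tangentLift (Φ x))) x :=
        (hf.1.contDiffAt.hasStrictFDerivAt (by simp)).comp x (hasStrictFDerivAt_chart x)
      refine pushesInto_of_hasStrictFDerivAt (hf.1.continuous.comp
        (continuous_subtype_val.comp Φ.continuous)) hF' ?_ he
      exact (Φ.continuous.tendsto x).eventually hf.2.2
    · have hν' : eta (Φ x).1 (-ν) = 0 := by
        rw [lor_eq] at hν
        rw [← neg_one_smul ℝ ν, eta_smul_right]; linarith
      rw [ContinuousLinearMap.comp_apply, tangentLift_fst hν', map_neg, hgrad ν hν, hνν]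
      linarith
  have hcases : ∀ x ∈ Φ ⁻¹' K, x ∈ interior (Φ ⁻¹' K) ∨ Φ x ∈ frontier K := by
    intro x hx
    rw [← Φ.preimage_interior, mem_preimage, hcomp.isClosed.frontier_eq]
    by_cases h : Φ x ∈ interior K
    · exact Or.inl h
    · exact Or.inr ⟨hx, h⟩
  have hmem₀ : Φ.symm X₀ ∈ Φ ⁻¹' K := by
    rw [mem_preimage, Φ.apply_symm_apply]; exact hcomp.isClosed.frontier_subset hX₀
  have hstrict : ∀ x, (∀ᶠ Y : Hyp n in 𝓝 (Φ x), Y ∈ K → Y ≠ Φ x → eta Y.1 N < eta (Φ x).1 N) →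
      ∀ᶠ y in 𝓝 x, y ∈ Φ ⁻¹' K → y ≠ x → eta (Φ y).1 N < eta (Φ x).1 N := fun x h =>
    ((Φ.continuous.tendsto x).eventually h).mono fun y hy h1 h2 => hy h1 (Φ.injective.ne h2)
  have key := le_of_isStrictLocalMax (K := Φ ⁻¹' K) (G := fun x => eta (Φ x).1 N)
    (x₀ := Φ.symm X₀) (Φ.isCompact_preimage.2 hcomp) (by fun_prop)
    (by rw [← Φ.preimage_interior]; exact (Φ.isPreconnected_preimage).2 hconn.isPreconnected)
    (fun x hx => ?_) (fun x hx => ?_) hmem₀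
    (hstrict _ (by simpa only [Φ.apply_symm_apply] using hmax))
  · refine ⟨N, hN, hNN, hXN, fun Y hY => ?_⟩
    have := key (Φ.symm Y) (by rw [mem_preimage, Φ.apply_symm_apply]; exact hY)
    simpa only [Φ.apply_symm_apply, hXN] using this
  · rcases hcases x hx with h | h
    · exact ⟨0, pushesInto_of_mem_interior h 0⟩
    · obtain ⟨f, ν, c, -, -, -, -, -, -, hpush, he⟩ := hfront x h
      exact ⟨_, hpush _ he⟩
  · rcases hcases x hx with h | h
    -- At an interior point the derivative along minus the tangential part of N is the square of the
    -- height, hence positive.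
    · have hμ := eta_point_pos (Φ x) hN hN0
      have hw := tangent_decomp (Φ x) N
      refine Or.inr ⟨-(N - eta (Φ x).1 N • (Φ x).1).1, pushesInto_of_mem_interior h _,
        risesAlong_of_hasStrictFDerivAt (hG' x) ?_⟩
      rw [map_neg, ContinuousLinearMap.comp_apply, tangentLift_fst hw, etaL_apply, eta_sub_left,
        hNN, eta_smul_left]
      nlinarith
    · obtain ⟨f, ν, c, hf, hν, hνν, hc, hgrad, hcurv, hpush, he₀⟩ := hfront x h
      -- If no direction into K raises the height, its differential is a nonnegative multiple of
      -- that of the defining function, so the horosphere is tangent to the boundary with the same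
      -- outward normal.
      by_cases hex : ∃ e, (fderiv ℝ f (Φ x).1).comp (tangentLift (Φ x)) e < 0 ∧
          0 < (etaL N).comp (tangentLift (Φ x)) e
      · obtain ⟨e, he, he'⟩ := hex
        exact Or.inr ⟨e, hpush e he, risesAlong_of_hasStrictFDerivAt (hG' x) he'⟩
      · push Not at hex
        left
        obtain ⟨k, hk, hkF⟩ := exists_eq_smul_of_forall he₀ hex
        have hν' : eta (Φ x).1 ν = 0 := by rw [lor_eq] at hν; linarith
        have hνν' : eta ν ν = -1 := by rw [lor_eq] at hνν; linarith
        obtain ⟨hkc, hNeq⟩ := null_eq_of_tangent hN hN0 hNN hν' hνν' (k := k * c) (by positivity)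
          fun w hw => by
            have h1 := hkF w.1
            rw [ContinuousLinearMap.comp_apply, ContinuousLinearMap.comp_apply,
              tangentLift_fst hw, etaL_apply, hgrad w (by rw [lor_eq, hw, neg_zero]), lor_eq] at h1
            rw [h1]; ring
        exact hstrict x (isStrictLocalMax_of_secondFF hf hν hνν hc hgrad hδ hcurv
          (pos_of_mul_pos_left hkc hc.le) hNeq)

/-- V satisfies all supporting horosphere inequalities of K. If V were outside K, a geodesic from an
interior point Q to V would meet the boundary at a point of height 1 for its outer null vector N.
The chord point above it is R ≥ 1 times that point and has height at most 1, so R = 1, which only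
happens at the ends or if Q = V. -/
theorem IsSmoothUnifHConvex.coneConvex {K : Set (Hyp n)} (hK : IsSmoothUnifHConvex K) :
    ConeConvex K := by
  intro X hX Y hY s hs V hV
  have hsupp : ∀ X₀ N, IsOuterNull K X₀ N → eta V.1 N ≤ 1 := fun X₀ N hN => by
    have h := hV.eta_nonneg hN.1
    simp only [eta_sub_left, eta_add_left, eta_smul_left] at h
    nlinarith [mul_le_mul_of_nonneg_left (hN.2.2.2 X hX) (sub_nonneg.2 hs.2),
      mul_le_mul_of_nonneg_left (hN.2.2.2 Y hY) hs.1]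
  by_contra hVK
  obtain ⟨Q, hQ⟩ := hK.2.1.nonempty
  obtain ⟨γ, hγ, hγ0, hγ1, hγR⟩ := exists_geodesic Q V
  obtain ⟨t, ht⟩ := (nonempty_frontier_iff (s := γ ⁻¹' K)).2
    ⟨⟨0, by rw [mem_preimage, hγ0]; exact interior_subset hQ⟩, fun h => hVK <| by
      have : (1 : Icc (0 : ℝ) 1) ∈ γ ⁻¹' K := h ▸ mem_univ _
      rwa [mem_preimage, hγ1] at this⟩
  have htK : γ t ∈ frontier K := hγ.frontier_preimage_subset K ht
  obtain ⟨N, hN⟩ := hK.exists_isOuterNull htK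
  obtain ⟨R, hR1, hR2, hReq⟩ := hγR t
  have h1 : R ≤ 1 := by
    have h := congrArg (fun Z => eta Z N) hReq
    simp only [eta_add_left, eta_smul_left, hN.2.2.1, mul_one] at h
    nlinarith [mul_le_mul_of_nonneg_left (hN.2.2.2 Q (interior_subset hQ))
      (sub_nonneg.2 t.2.2), mul_le_mul_of_nonneg_left (hsupp _ N hN) t.2.1]
  have hR : R = 1 := le_antisymm h1 hR1
  have h0 : t.1 * (1 - t.1) * (eta Q.1 V.1 - 1) = 0 := by rw [hR] at hR2; linarith
  rcases mul_eq_zero.1 h0 with h | h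
  · rcases mul_eq_zero.1 h with h | h
    · have : t = 0 := Subtype.ext h
      rw [this, hγ0] at htK
      exact htK.2 hQ
    · have : t = 1 := Subtype.ext (show t.1 = 1 by linarith)
      rw [this, hγ1] at htK
      exact hVK (hK.1.isClosed.frontier_subset htK)
  · have : Q = V := eq_of_eta_eq_one (by linarith)
    exact hVK (this ▸ interior_subset hQ)

end Support

end HypSum

theorem mainTheorem2 (n : ℕ) (hn : 1 ≤ n) (p a b : ℝ) (hp₁ : 1 / 2 ≤ p) (hp₂ : p ≤ 2)
    (ha : 0 ≤ a) (hb : 0 ≤ b) (hab : 1 ≤ a + b) (K L : Set (HypSum.Hyp n))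
    (hK : HypSum.IsSmoothUnifHConvex K ∨ ∃ X, K = {X})
    (hL : HypSum.IsSmoothUnifHConvex L ∨ ∃ Y, L = {Y}) :
    (∀ Ω : Set (HypSum.Hyp n),
      HypSum.IsHypPSum p a b K L Ω ↔ Ω = HypSum.coneSum p a b K L) ∧
    (∀ Ω : Set (HypSum.Hyp n),
      HypSum.IsHypPSum p a b K L Ω ↔ Ω = HypSum.ballSum p a b K L) ∧
    (∀ φ : HypSum.Hyp n ≃ HypSum.Hyp n,
      (∀ X Y, HypSum.hdist (φ X) (φ Y) = HypSum.hdist X Y) →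
      (∀ Ω : Set (HypSum.Hyp n),
        HypSum.IsHypPSum p a b K L Ω →
          HypSum.IsHypPSum p a b (φ '' K) (φ '' L) (φ '' Ω)) ∧
      HypSum.coneSum p a b (φ '' K) (φ '' L) = φ '' HypSum.coneSum p a b K L ∧
      HypSum.ballSum p a b (φ '' K) (φ '' L) = φ '' HypSum.ballSum p a b K L) := by
  have basic : ∀ M : Set (HypSum.Hyp n), (HypSum.IsSmoothUnifHConvex M ∨ ∃ X, M = {X}) →
      IsCompact M ∧ M.Nonempty ∧ HypSum.ConeConvex M := by
    rintro M (h | ⟨X, rfl⟩)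
    · exact ⟨h.1, h.2.1.nonempty.mono interior_subset, h.coneConvex⟩
    · exact ⟨isCompact_singleton, singleton_nonempty X, HypSum.coneConvex_singleton X⟩
  obtain ⟨hKc, hKne, hK'⟩ := basic K hK
  obtain ⟨hLc, hLne, hL'⟩ := basic L hL
  have main := HypSum.isHypPSum_iff hn hp₁ hp₂ ha hb hab hKc hLc hKne hLne hK' hL'
  have hball := HypSum.ballSum_eq_coneSum (n := n) (p := p) ha hb
  refine ⟨main, fun Ω => by rw [hball, main], fun φ hφ => ⟨fun Ω hΩ => ?_,
    HypSum.coneSum_image hφ ha hb K L, ?_⟩⟩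
  · have hφc := HypSum.continuous_isometry hφ
    rw [HypSum.isHypPSum_iff hn hp₁ hp₂ ha hb hab (hKc.image hφc) (hLc.image hφc) (hKne.image φ)
      (hLne.image φ) (hK'.image hφ) (hL'.image hφ), (main Ω).1 hΩ,
      HypSum.coneSum_image hφ ha hb]
  · rw [hball, hball, HypSum.coneSum_image hφ ha hb]
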